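/- Let $n\ge 2$, let $(Y,h)$ be a closed (compact, without boundary) smooth Riemannian manifold of dimension $n-1$ and let $V_0\in C^\infty(Y)$ be real-valued. Let $\Delta_h$ be the positive Laplace–Beltrami operator, and suppose that the smallest eigenvalue of $\Delta_h+V_0+\frac{(n-2)^2}{4}$ is $\nu_0^2$ with $\nu_0>0$. Put $$\Lambda_\infty=\{\nu>0:\ \nu^2 \text{ is an eigenvalue of } \Delta_h+V_0+\tfrac{(n-2)^2}{4}\},$$ and let $d(\nu)$ be the multiplicity of the eigenvalue $\nu^2$. For $\nu>-\frac12$ and $r>0$ let $$J_\nu(r)=\frac{(r/2)^\nu}{\Gamma(\nu+\frac12)\Gamma(\frac12)}\int_{-1}^1e^{isr}(1-s^2)^{(2\nu-1)/2}\,ds$$ be the Bessel function of order $\nu$. Let $2\le q\le\infty$ and $\frac1q+\frac1{q'}=1$ (with $1/\infty=0$), and let $I=[1,2]$. There is a constant $C$, depending only on $q$, $n$, $(Y,h)$ and $V_0$, such that for every $\varphi\in C_c^\infty(\mathbb R)$ (real- or complex-valued) supported in $I$, every dyadic number $R=2^k$, $k\in\mathbb Z$, with $S_R=[R/2,R]$,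 and every family of measurable functions $b_{\nu,\ell}$ ($\nu\in\Lambda_\infty$, $1\le \ell\le d(\nu)$) on $I$, the square function $$\mathcal S(t,r)=\Big(\sum_{\nu\in\Lambda_\infty}\sum_{\ell=1}^{d(\nu)}\Big|\int_0^\infty r^{-\frac{n-2}2}J_\nu(r\rho)e^{-it\rho}\,b_{\nu,\ell}(\rho)\varphi(\rho)\,\rho^{\frac{n-2}2}\,d\rho\Big|^2\Big)^{1/2}$$ satisfies $$\|\mathcal S\|_{L^q_tL^q_{r^{n-1}dr}(\mathbb R\times S_R)}\le C\min\Big\{R^{\frac nq+\nu_0-\frac{n-2}2},\,R^{-\frac{3n-4}6\left[1-\frac{2(3n-1)}{(3n-4)q}\right]}\Big\}\Big\|\Big(\sum_{\nu\in\Lambda_\infty}\sum_{\ell=1}^{d(\nu)}|b_{\nu,\ell}(\rho)|^2\Big)^{1/2}\varphi(\rho)\Big\|_{L^{q'}_\rho(I)}$$ and $$\|\mathcal S\|_{L^q_tL^q_{r^{n-1}dr}(\mathbb R\times S_R)}\le C\min\Big\{R^{\frac nq+\nu_0-\frac{n-2}2},\,R^{-\frac{n-1}2\left[1-\frac{2n}{(n-1)q}\right]}\Big\}\Big\|\Big(\sum_{\nu\in\Lambda_\infty}\sum_{\ell=1}^{d(\nu)}|b_{\nu,\ell}(\rho)|^2\Big)^{1/2}\varphi(\rho)\Big\|_{L^{2}_\rho(I)}.$$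 The bounds are trivial if the norm on the right-hand side is infinite; if it is finite, the integrals in $\mathcal S$ converge absolutely. -/

import Mathlib

open MeasureTheory Set
open scoped ENNReal NNReal Manifold ContDiff

/-! ### The Laplace–Beltrami operator of a Riemannian manifold -/

section LaplaceBeltrami

/-- A smooth Riemannian metric on a boundaryless smooth `d`-dimensional manifold `Y`. -/
abbrev SmoothRiemannianMetric (d : ℕ) (Y : Type*) [TopologicalSpace Y]
    [ChartedSpace (EuclideanSpace ℝ (Fin d)) Y] [IsManifold (𝓡 d) ∞ Y] :=
  Bundle.ContMDiffRiemannianMetric (𝓡 d) ∞ (EuclideanSpace ℝ (Fin d))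
    (fun y : Y => TangentSpace (𝓡 d) y)

variable {d : ℕ} {Y : Type*} [TopologicalSpace Y]
  [ChartedSpace (EuclideanSpace ℝ (Fin d)) Y] [IsManifold (𝓡 d) ∞ Y]

/-- The inverse of the preferred chart at `y`, as a local parametrization of `Y` near `y`. -/
noncomputable def chartInv (d : ℕ) {Y : Type*} [TopologicalSpace Y]
    [ChartedSpace (EuclideanSpace ℝ (Fin d)) Y] (y : Y) : EuclideanSpace ℝ (Fin d) → Y :=
  (extChartAt (𝓡 d) y).symm

/-- The Gram matrix `h_{ij}(u) = h(∂_i, ∂_j)` of the metric in the chart at `y`, where `∂_i` is the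
`i`-th coordinate vector field of that chart, at the point with coordinates `u`. -/
noncomputable def gramInChart (h : SmoothRiemannianMetric d Y) (y : Y)
    (u : EuclideanSpace ℝ (Fin d)) : Matrix (Fin d) (Fin d) ℝ :=
  Matrix.of fun i j =>
    h.inner (chartInv d y u)
      (mfderiv 𝓘(ℝ, EuclideanSpace ℝ (Fin d)) (𝓡 d) (chartInv d y) u (EuclideanSpace.single i 1))
      (mfderiv 𝓘(ℝ, EuclideanSpace ℝ (Fin d)) (𝓡 d) (chartInv d y) u (EuclideanSpace.single j 1))

/-- The positive Laplace–Beltrami operator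
`Δ_h f = - |h|^{-1/2} ∑_{i,j} ∂_i (|h|^{1/2} h^{ij} ∂_j f)`, computed at `y` in the chart at `y`. -/
noncomputable def laplaceBeltrami (h : SmoothRiemannianMetric d Y) (f : Y → ℝ) (y : Y) : ℝ :=
  -((Real.sqrt (gramInChart h y (extChartAt (𝓡 d) y y)).det)⁻¹ *
    ∑ i : Fin d,
      fderiv ℝ (fun u : EuclideanSpace ℝ (Fin d) =>
          Real.sqrt (gramInChart h y u).det *
            ∑ j : Fin d, (gramInChart h y u)⁻¹ i j *
              fderiv ℝ (f ∘ chartInv d y) u (EuclideanSpace.single j 1))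
        (extChartAt (𝓡 d) y y) (EuclideanSpace.single i 1))

end LaplaceBeltrami

/-! ### The spectrum of the cross section of an `n`-dimensional metric cone -/

section Spectrum

variable {n : ℕ} {Y : Type*} [TopologicalSpace Y]
  [ChartedSpace (EuclideanSpace ℝ (Fin (n - 1))) Y] [IsManifold (𝓡 (n - 1)) ∞ Y]

/-- The smooth real solutions `f` of `(Δ_h + V₀ + (n-2)²/4) f = lam f`. -/
def eigenfunctions (h : SmoothRiemannianMetric (n - 1) Y)
    (V₀ : C^∞⟮𝓡 (n - 1), Y; 𝓘(ℝ, ℝ), ℝ⟯) (lam : ℝ) :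
    Set C^∞⟮𝓡 (n - 1), Y; 𝓘(ℝ, ℝ), ℝ⟯ :=
  {f | ∀ y : Y, laplaceBeltrami h f y + V₀ y * f y + ((n : ℝ) - 2) ^ 2 / 4 * f y = lam * f y}

/-- The set of eigenvalues of `Δ_h + V₀ + (n-2)²/4`. -/
def coneEigenvalues (h : SmoothRiemannianMetric (n - 1) Y)
    (V₀ : C^∞⟮𝓡 (n - 1), Y; 𝓘(ℝ, ℝ), ℝ⟯) : Set ℝ :=
  {lam | ∃ f ∈ eigenfunctions h V₀ lam, f ≠ 0}

/-- `Λ_∞ = {ν > 0 : ν² is an eigenvalue of Δ_h + V₀ + (n-2)²/4}`. -/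
def LambdaInfty (h : SmoothRiemannianMetric (n - 1) Y)
    (V₀ : C^∞⟮𝓡 (n - 1), Y; 𝓘(ℝ, ℝ), ℝ⟯) : Set ℝ :=
  {ν | 0 < ν ∧ ν ^ 2 ∈ coneEigenvalues h V₀}

/-- `d(ν)`: the multiplicity of the eigenvalue `ν²`, i.e. the dimension of its eigenspace
(`Set.finrank` is the dimension of the linear span). -/
noncomputable def coneMultiplicity (h : SmoothRiemannianMetric (n - 1) Y)
    (V₀ : C^∞⟮𝓡 (n - 1), Y; 𝓘(ℝ, ℝ), ℝ⟯) (ν : ℝ) : ℕ :=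
  Set.finrank ℝ (eigenfunctions h V₀ (ν ^ 2))

/-- The pairs `(ν, ℓ)` with `ν ∈ Λ_∞` and `ℓ` running over `d(ν)` values. -/
abbrev ConeIndex (h : SmoothRiemannianMetric (n - 1) Y)
    (V₀ : C^∞⟮𝓡 (n - 1), Y; 𝓘(ℝ, ℝ), ℝ⟯) : Type :=
  Σ ν : LambdaInfty h V₀, Fin (coneMultiplicity h V₀ ν)

end Spectrum

/-! ### Bessel functions and the localized Hankel wave -/

/-- The Bessel function of order `ν > -1/2` at `r > 0`, by Poisson's integral. -/
noncomputable def besselJ (ν r : ℝ) : ℂ :=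
  (((r / 2) ^ ν / (Real.Gamma (ν + 1 / 2) * Real.Gamma (1 / 2)) : ℝ) : ℂ) *
    ∫ s in (-1 : ℝ)..1,
      Complex.exp (Complex.I * s * r) * (((1 - s ^ 2) ^ ((2 * ν - 1) / 2) : ℝ) : ℂ)

/-- `∫₀^∞ r^{-(n-2)/2} J_ν(rρ) e^{-itρ} b(ρ) φ(ρ) ρ^{(n-2)/2} dρ`. -/
noncomputable def hankelWave (n : ℕ) (ν : ℝ) (φ b : ℝ → ℂ) (t r : ℝ) : ℂ :=
  ∫ ρ in Ioi (0 : ℝ),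
    ((r ^ (-(((n : ℝ) - 2) / 2)) : ℝ) : ℂ) * besselJ ν (r * ρ) *
      Complex.exp (-(Complex.I * t * ρ)) * b ρ * φ ρ * ((ρ ^ (((n : ℝ) - 2) / 2) : ℝ) : ℂ)

/-- The `ℓ²` norm `(∑ |z_i|²)^{1/2}` of a family of complex numbers, in `[0, ∞]`. -/
noncomputable def ell2Norm {ι : Type*} (z : ι → ℂ) : ℝ≥0∞ :=
  (∑' i, ‖z i‖ₑ ^ 2) ^ (1 / 2 : ℝ)

/-- The measure `dt ⊗ r^{n-1} dr` on `ℝ × S_R`, with `S_R = [R/2, R]`. -/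
noncomputable def coneSlabMeasure (n : ℕ) (R : ℝ) : Measure (ℝ × ℝ) :=
  (volume : Measure ℝ).prod
    ((volume.restrict (Icc (R / 2) R)).withDensity fun r => ENNReal.ofReal (r ^ (n - 1)))

/-! ### Poisson's integral -/

/-- The real part of Poisson's integral with weight `(1 - s²)^a`. -/
noncomputable def poissonCos (a x : ℝ) : ℝ :=
  ∫ s in (-1 : ℝ)..1, Real.cos (s * x) * (1 - s ^ 2) ^ a

theorem one_sub_sq_rpow_le_add {a s : ℝ} (ha : a < 0) (hs : s ∈ Ioo (-1 : ℝ) 1) :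
    (1 - s ^ 2) ^ a ≤ (1 - s) ^ a + (1 + s) ^ a := by
  obtain ⟨h1, h2⟩ := hs
  have p1 : 0 ≤ (1 - s) ^ a := Real.rpow_nonneg (by linarith) _
  have p2 : 0 ≤ (1 + s) ^ a := Real.rpow_nonneg (by linarith) _
  rcases le_total 0 s with h | h
  · have := Real.rpow_le_rpow_of_nonpos (show 0 < 1 - s by linarith)
      (show 1 - s ≤ 1 - s ^ 2 by nlinarith) ha.le
    linarith
  · have := Real.rpow_le_rpow_of_nonpos (show 0 < 1 + s by linarith)
      (show 1 + s ≤ 1 - s ^ 2 by nlinarith) ha.le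
    linarith

theorem intervalIntegrable_one_sub_sq_rpow {a : ℝ} (ha : -1 < a) :
    IntervalIntegrable (fun s : ℝ => (1 - s ^ 2) ^ a) volume (-1) 1 := by
  rcases le_or_gt 0 a with h | h
  · apply Continuous.intervalIntegrable
    exact (by fun_prop : Continuous fun s : ℝ => 1 - s ^ 2).rpow_const fun _ => Or.inr h
  · have h1 : IntervalIntegrable (fun s : ℝ => (1 - s) ^ a) volume (-1) 1 := by
      have := (intervalIntegral.intervalIntegrable_rpow' (a := 2) (b := 0) ha).comp_sub_left 1
      norm_num at this
      exact this
    have h2 : IntervalIntegrable (fun s : ℝ => (1 + s) ^ a) volume (-1) 1 := by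
      have := (intervalIntegral.intervalIntegrable_rpow' (a := 0) (b := 2) ha).comp_add_left 1
      norm_num at this
      exact this
    have hm : Measurable (fun s : ℝ => (1 - s ^ 2) ^ a) := by fun_prop
    refine (h1.add h2).mono_fun' hm.aestronglyMeasurable ?_
    rw [uIoc_of_le (by norm_num), ← restrict_Ioo_eq_restrict_Ioc]
    filter_upwards [ae_restrict_mem measurableSet_Ioo] with s hs
    rw [Real.norm_of_nonneg (Real.rpow_nonneg (by nlinarith [hs.1, hs.2]) _)]
    exact one_sub_sq_rpow_le_add h hs

theorem intervalIntegrable_continuous_mul_one_sub_sq_rpow {a : ℝ} (ha : -1 < a) {f : ℝ → ℝ}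
    (hf : Continuous f) :
    IntervalIntegrable (fun s : ℝ => f s * (1 - s ^ 2) ^ a) volume (-1) 1 :=
  (intervalIntegrable_one_sub_sq_rpow ha).continuousOn_mul hf.continuousOn

theorem integral_mul_one_sub_sq_rpow_by_parts {a : ℝ} (ha : -1 < a) {f f' : ℝ → ℝ}
    (hf : ∀ s, HasDerivAt f (f' s) s) (hf' : Continuous f') :
    ∫ s in (-1 : ℝ)..1, s * f s * (1 - s ^ 2) ^ a =
      (2 * a + 2)⁻¹ * ∫ s in (-1 : ℝ)..1, f' s * (1 - s ^ 2) ^ (a + 1) := by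
  have hfc : Continuous f := continuous_iff_continuousAt.2 fun s => (hf s).continuousAt
  have i1 := intervalIntegrable_continuous_mul_one_sub_sq_rpow ha (continuous_id.mul hfc)
  have i2 := intervalIntegrable_continuous_mul_one_sub_sq_rpow (a := a + 1) (by linarith) hf'
  have key : ∫ s in (-1 : ℝ)..1, ((-(2 * a + 2)) * (s * f s * (1 - s ^ 2) ^ a)
      + f' s * (1 - s ^ 2) ^ (a + 1)) = 0 := by
    rw [intervalIntegral.integral_eq_sub_of_hasDerivAt_of_le (f := fun s =>
      f s * (1 - s ^ 2) ^ (a + 1)) (by norm_num)]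
    · rw [show (1 : ℝ) - 1 ^ 2 = 0 by norm_num, show (1 : ℝ) - (-1) ^ 2 = 0 by norm_num,
        Real.zero_rpow (by linarith)]
      simp
    · exact (hfc.mul ((by fun_prop : Continuous fun s : ℝ => 1 - s ^ 2).rpow_const
        fun _ => Or.inr (by linarith))).continuousOn
    · intro s hs
      have hp : 0 < 1 - s ^ 2 := by nlinarith [hs.1, hs.2]
      have hd : HasDerivAt (fun s : ℝ => 1 - s ^ 2) (-(2 * s)) s := by
        simpa using (hasDerivAt_pow 2 s).const_sub 1
      have := (hf s).mul (hd.rpow_const (p := a + 1) (Or.inl hp.ne'))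
      refine this.congr_deriv ?_
      rw [add_sub_cancel_right]
      ring
    · exact (i1.const_mul _).add i2
  have i1' : IntervalIntegrable (fun s : ℝ => -(2 * a + 2) * (s * f s * (1 - s ^ 2) ^ a))
    volume (-1) 1 := i1.const_mul _
  rw [intervalIntegral.integral_add i1' i2, intervalIntegral.integral_const_mul] at key
  rw [eq_inv_mul_iff_mul_eq₀ (by linarith)]
  linarith

theorem hasDerivAt_poissonCos {a : ℝ} (ha : -1 < a) (x : ℝ) :
    HasDerivAt (poissonCos a) (-(x / (2 * a + 2)) * poissonCos (a + 1) x) x := by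
  have h := (intervalIntegral.hasDerivAt_integral_of_dominated_loc_of_deriv_le (μ := volume)
    (a := -1) (b := 1)
    (F := fun x s : ℝ => Real.cos (s * x) * (1 - s ^ 2) ^ a)
    (F' := fun x s : ℝ => -(s * Real.sin (s * x)) * (1 - s ^ 2) ^ a) (x₀ := x) (s := univ)
    (bound := fun s => (1 - s ^ 2) ^ a) Filter.univ_mem ?_ ?_ ?_ ?_ ?_ ?_).2
  · refine h.congr_deriv ?_
    have := integral_mul_one_sub_sq_rpow_by_parts ha (f := fun s => Real.sin (s * x))
      (f' := fun s => x * Real.cos (s * x)) (fun s => by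
        have := ((hasDerivAt_id s).mul_const x).sin
        simpa [mul_comm] using this) (by fun_prop)
    simp_rw [neg_mul, intervalIntegral.integral_neg, this]
    simp_rw [mul_assoc, intervalIntegral.integral_const_mul, poissonCos]
    ring
  · exact Filter.Eventually.of_forall fun y => (by fun_prop : Measurable fun s : ℝ =>
      Real.cos (s * y) * (1 - s ^ 2) ^ a).aestronglyMeasurable
  · exact intervalIntegrable_continuous_mul_one_sub_sq_rpow ha (by fun_prop)
  · exact (by fun_prop : Measurable fun s : ℝ =>
      -(s * Real.sin (s * x)) * (1 - s ^ 2) ^ a).aestronglyMeasurable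
  · refine Filter.Eventually.of_forall fun s hs y _ => ?_
    rw [uIoc_of_le (by norm_num)] at hs
    have hp : 0 ≤ 1 - s ^ 2 := by nlinarith [hs.1, hs.2]
    rw [norm_mul, norm_neg, norm_mul, Real.norm_of_nonneg (Real.rpow_nonneg hp a)]
    refine mul_le_of_le_one_left (Real.rpow_nonneg hp a) ?_
    have h1 : ‖s‖ ≤ 1 := abs_le.2 ⟨by linarith [hs.1], hs.2⟩
    have h2 : ‖Real.sin (s * y)‖ ≤ 1 := Real.abs_sin_le_one _
    exact mul_le_one₀ h1 (norm_nonneg _) h2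
  · exact intervalIntegrable_one_sub_sq_rpow ha
  · refine Filter.Eventually.of_forall fun s _ y _ => ?_
    have := (((hasDerivAt_id y).const_mul s).cos).mul_const ((1 - s ^ 2) ^ a)
    refine this.congr_deriv ?_
    simp only [id]
    ring

theorem continuous_poissonCos {a : ℝ} (ha : -1 < a) : Continuous (poissonCos a) :=
  continuous_iff_continuousAt.2 fun x => (hasDerivAt_poissonCos ha x).continuousAt

theorem poissonCos_recurrence {a : ℝ} (ha : -1 < a) (x : ℝ) :
    (2 * a + 3) * poissonCos (a + 1) x =
      (2 * a + 2) * poissonCos a x + x ^ 2 / (2 * a + 4) * poissonCos (a + 2) x := by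
  have h1 := integral_mul_one_sub_sq_rpow_by_parts ha (f := fun s => s * Real.cos (s * x))
    (f' := fun s => Real.cos (s * x) - x * (s * Real.sin (s * x))) (fun s => by
      have h := ((hasDerivAt_id s).mul_const x).cos
      have := (hasDerivAt_id s).mul h
      refine this.congr_deriv ?_
      simp only [id]
      ring) (by fun_prop)
  have h2 := integral_mul_one_sub_sq_rpow_by_parts (a := a + 1) (by linarith)
    (f := fun s => Real.sin (s * x))
    (f' := fun s => x * Real.cos (s * x)) (fun s => by
        have := ((hasDerivAt_id s).mul_const x).sin
        simpa [mul_comm] using this) (by fun_prop)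
  have h3 : ∫ s in (-1 : ℝ)..1, (Real.cos (s * x) - x * (s * Real.sin (s * x))) *
      (1 - s ^ 2) ^ (a + 1) = poissonCos (a + 1) x - x *
      ∫ s in (-1 : ℝ)..1, s * Real.sin (s * x) * (1 - s ^ 2) ^ (a + 1) := by
    rw [poissonCos, ← intervalIntegral.integral_const_mul, ← intervalIntegral.integral_sub]
    · congr 1
      ext s
      ring
    · exact intervalIntegrable_continuous_mul_one_sub_sq_rpow (by linarith) (by fun_prop)
    · exact (intervalIntegrable_continuous_mul_one_sub_sq_rpow (by linarith)
        (by fun_prop)).const_mul x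
  have h4 : poissonCos (a + 1) x = poissonCos a x -
      ∫ s in (-1 : ℝ)..1, s * (s * Real.cos (s * x)) * (1 - s ^ 2) ^ a := by
    rw [poissonCos, poissonCos, ← intervalIntegral.integral_sub]
    · apply intervalIntegral.integral_congr
      intro s hs
      rw [uIcc_of_le (by norm_num)] at hs
      have hp : 0 ≤ 1 - s ^ 2 := by nlinarith [hs.1, hs.2]
      rcases hp.eq_or_lt with h0 | h0
      · have hs1 : s * s = 1 := by linarith
        simp only [← h0, Real.zero_rpow (show a + 1 ≠ 0 by linarith)]
        linear_combination (0 : ℝ) ^ a * Real.cos (s * x) * hs1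
      · simp only [Real.rpow_add h0, Real.rpow_one]
        ring
    · exact intervalIntegrable_continuous_mul_one_sub_sq_rpow ha (by fun_prop)
    · exact intervalIntegrable_continuous_mul_one_sub_sq_rpow ha (by fun_prop)
  simp_rw [mul_assoc x, intervalIntegral.integral_const_mul] at h2
  change _ = _ * (x * poissonCos (a + 1 + 1) x) at h2
  rw [show a + 1 + 1 = a + 2 by ring, show 2 * (a + 1) + 2 = 2 * a + 4 by ring] at h2
  rw [h3, h2] at h1
  rw [h1] at h4
  have e1 : (2 * a + 2) * (2 * a + 2)⁻¹ = 1 := mul_inv_cancel₀ (by linarith)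
  linear_combination (2 * a + 2) * h4 - (poissonCos (a + 1) x -
    x * ((2 * a + 4)⁻¹ * (x * poissonCos (a + 2) x))) * e1

/-! ### The real Bessel function -/

/-- The Bessel function of the first kind as a real-valued function. -/
noncomputable def realBessel (ν x : ℝ) : ℝ :=
  (x / 2) ^ ν / (Real.Gamma (ν + 1 / 2) * Real.Gamma (1 / 2)) * poissonCos (ν - 1 / 2) x

theorem integral_exp_mul_one_sub_sq_rpow {a : ℝ} (ha : -1 < a) (x : ℝ) :
    ∫ s in (-1 : ℝ)..1, Complex.exp (Complex.I * s * x) * (((1 - s ^ 2) ^ a : ℝ) : ℂ) =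
      (poissonCos a x : ℂ) := by
  have hodd : ∫ s in (-1 : ℝ)..1, Real.sin (s * x) * (1 - s ^ 2) ^ a = 0 := by
    have h := intervalIntegral.integral_comp_neg (a := -1) (b := 1)
      (fun s : ℝ => Real.sin (s * x) * (1 - s ^ 2) ^ a)
    simp only [neg_mul, Real.sin_neg, neg_sq, neg_neg, intervalIntegral.integral_neg] at h
    linarith
  have he : ∀ s : ℝ, Complex.exp (Complex.I * s * x) * (((1 - s ^ 2) ^ a : ℝ) : ℂ) =
      ((Real.cos (s * x) * (1 - s ^ 2) ^ a : ℝ) : ℂ) +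
        Complex.I * ((Real.sin (s * x) * (1 - s ^ 2) ^ a : ℝ) : ℂ) := by
    intro s
    rw [show Complex.I * s * x = ((s * x : ℝ) : ℂ) * Complex.I by push_cast; ring,
      Complex.exp_mul_I, ← Complex.ofReal_cos, ← Complex.ofReal_sin]
    push_cast
    ring
  simp_rw [he]
  rw [intervalIntegral.integral_add, intervalIntegral.integral_const_mul,
    intervalIntegral.integral_ofReal, intervalIntegral.integral_ofReal, hodd]
  · simp [poissonCos]
  · have h := intervalIntegrable_continuous_mul_one_sub_sq_rpow ha
      (f := fun s => Real.cos (s * x)) (by fun_prop)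
    exact ⟨h.1.ofReal, h.2.ofReal⟩
  · have h := intervalIntegrable_continuous_mul_one_sub_sq_rpow ha
      (f := fun s => Real.sin (s * x)) (by fun_prop)
    exact IntervalIntegrable.const_mul ⟨h.1.ofReal, h.2.ofReal⟩ _

theorem besselJ_eq_realBessel {ν : ℝ} (hν : -(1 / 2) < ν) (x : ℝ) :
    besselJ ν x = (realBessel ν x : ℂ) := by
  rw [besselJ, realBessel, Complex.ofReal_mul,
    ← integral_exp_mul_one_sub_sq_rpow (a := ν - 1 / 2) (by linarith),
    show (2 * ν - 1) / 2 = ν - 1 / 2 by ring]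

theorem realBessel_add_one {ν x : ℝ} (hν : -(1 / 2) < ν) (hx : 0 < x) :
    realBessel (ν + 1) x = (x / 2) ^ ν / (Real.Gamma (ν + 1 / 2) * Real.Gamma (1 / 2)) *
      (x / (2 * ν + 1) * poissonCos (ν + 1 / 2) x) := by
  have hG : Real.Gamma (ν + 1 + 1 / 2) = (ν + 1 / 2) * Real.Gamma (ν + 1 / 2) := by
    rw [← Real.Gamma_add_one (by linarith)]
    ring_nf
  have g1 : 0 < Real.Gamma (ν + 1 / 2) := Real.Gamma_pos_of_pos (by linarith)
  have g2 : 0 < Real.Gamma (1 / 2) := Real.Gamma_pos_of_pos (by norm_num)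
  rw [realBessel, hG, Real.rpow_add (by linarith), Real.rpow_one,
    show ν + 1 - 1 / 2 = ν + 1 / 2 by ring]
  have e1 : ν + 1 / 2 ≠ 0 := by linarith
  have e2 : 2 * ν + 1 ≠ 0 := by linarith
  rw [show 2 * ν + 1 = 2 * (ν + 1 / 2) by ring]
  field_simp

theorem hasDerivAt_realBessel {ν x : ℝ} (hν : -(1 / 2) < ν) (hx : 0 < x) :
    HasDerivAt (realBessel ν) (ν / x * realBessel ν x - realBessel (ν + 1) x) x := by
  have h1 : HasDerivAt (fun y : ℝ => (y / 2) ^ ν) (ν / x * (x / 2) ^ ν) x := by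
    have := ((hasDerivAt_id x).div_const 2).rpow_const (p := ν) (Or.inl (by simp; linarith))
    refine this.congr_deriv ?_
    simp only [id]
    rw [Real.rpow_sub_one (by positivity)]
    field_simp
  have := (h1.div_const (Real.Gamma (ν + 1 / 2) * Real.Gamma (1 / 2))).mul
    (hasDerivAt_poissonCos (a := ν - 1 / 2) (by linarith) x)
  refine this.congr_deriv ?_
  rw [realBessel_add_one hν hx, realBessel, show ν - 1 / 2 + 1 = ν + 1 / 2 by ring,
    show 2 * (ν - 1 / 2) + 2 = 2 * ν + 1 by ring]
  ring

theorem realBessel_recurrence {ν x : ℝ} (hν : -(1 / 2) < ν) (hx : 0 < x) :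
    2 * (ν + 1) * realBessel (ν + 1) x = x * (realBessel ν x + realBessel (ν + 1 + 1) x) := by
  have h := poissonCos_recurrence (a := ν - 1 / 2) (by linarith) x
  rw [show 2 * (ν - 1 / 2) + 3 = 2 * (ν + 1) by ring,
    show 2 * (ν - 1 / 2) + 2 = 2 * ν + 1 by ring,
    show 2 * (ν - 1 / 2) + 4 = 2 * ν + 3 by ring,
    show ν - 1 / 2 + 1 = ν + 1 / 2 by ring, show ν - 1 / 2 + 2 = ν + 3 / 2 by ring] at h
  have hG : Real.Gamma (ν + 1 + 1 / 2) = (ν + 1 / 2) * Real.Gamma (ν + 1 / 2) := by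
    rw [← Real.Gamma_add_one (by linarith)]
    ring_nf
  have g1 : 0 < Real.Gamma (ν + 1 / 2) := Real.Gamma_pos_of_pos (by linarith)
  have g2 : 0 < Real.Gamma (1 / 2) := Real.Gamma_pos_of_pos (by norm_num)
  rw [realBessel_add_one (ν := ν + 1) (by linarith) hx, realBessel_add_one hν hx, realBessel, hG,
    Real.rpow_add (by linarith), Real.rpow_one, show ν + 1 + 1 / 2 = ν + 3 / 2 by ring,
    show 2 * (ν + 1) + 1 = 2 * ν + 3 by ring]
  have e1 : ν + 1 / 2 ≠ 0 := by linarith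
  have e2 : 2 * ν + 1 ≠ 0 := by linarith
  have e3 : 2 * ν + 3 ≠ 0 := by linarith
  have : poissonCos (ν - 1 / 2) x = (2 * ν + 1)⁻¹ * (2 * (ν + 1) * poissonCos (ν + 1 / 2) x -
      x ^ 2 / (2 * ν + 3) * poissonCos (ν + 3 / 2) x) := by
    rw [h, add_sub_cancel_right, inv_mul_cancel_left₀ e2]
  rw [this, show ν + 1 / 2 = (2 * ν + 1) / 2 by ring]
  generalize poissonCos ((2 * ν + 1) / 2) x = p1
  generalize poissonCos (ν + 3 / 2) x = p2
  generalize (x / 2) ^ ν = p3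
  generalize Real.Gamma ((2 * ν + 1) / 2) = p4
  generalize Real.Gamma (1 / 2) = p5
  by_cases h4 : p4 = 0
  · simp [h4]
  by_cases h5 : p5 = 0
  · simp [h5]
  field_simp
  ring

theorem hasDerivAt_realBessel_add_one {ν x : ℝ} (hν : -(1 / 2) < ν) (hx : 0 < x) :
    HasDerivAt (realBessel (ν + 1))
      (realBessel ν x - (ν + 1) / x * realBessel (ν + 1) x) x := by
  refine (hasDerivAt_realBessel (ν := ν + 1) (by linarith) hx).congr_deriv ?_
  have h := realBessel_recurrence hν hx
  field_simp
  linarith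

theorem measurable_realBessel {ν : ℝ} (hν : -(1 / 2) < ν) : Measurable (realBessel ν) := by
  have := (continuous_poissonCos (a := ν - 1 / 2) (by linarith)).measurable
  unfold realBessel
  fun_prop

/-! ### Decay of Poisson's integral by a contour shift -/

/-- The integrand of Poisson's integral, continued to complex arguments. -/
noncomputable def poissonIntegrand (a x : ℝ) (z : ℂ) : ℂ :=
  Complex.exp (Complex.I * z * x) * ((1 - z) ^ (a : ℂ) * (1 + z) ^ (a : ℂ))

theorem norm_poissonIntegrand (a x s y : ℝ) :
    ‖poissonIntegrand a x (s + y * Complex.I)‖ =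
      Real.exp (-(x * y)) * (‖(1 : ℂ) - (s + y * Complex.I)‖ ^ a *
        ‖(1 : ℂ) + (s + y * Complex.I)‖ ^ a) := by
  rw [poissonIntegrand, norm_mul, norm_mul, Complex.norm_cpow_real, Complex.norm_cpow_real,
    Complex.norm_exp]
  congr 2
  simp [mul_comm]

theorem continuousAt_cpow_const_of_re_nonneg {a : ℝ} (ha : 0 ≤ a) {z : ℂ} (hz : 0 ≤ z.re) :
    ContinuousAt (fun w : ℂ => w ^ (a : ℂ)) z := by
  rcases ha.eq_or_lt with h | h
  · subst h
    simpa using continuousAt_const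
  · exact Complex.continuousAt_cpow_const_of_re_pos (Or.inl hz) (by simpa using h)

theorem poissonIntegrand_rect_eq {a x : ℝ} (ha : 0 ≤ a) (H : ℝ) :
    (∫ s : ℝ in (-1)..1, poissonIntegrand a x s) =
      (∫ s : ℝ in (-1)..1, poissonIntegrand a x (s + H * Complex.I)) -
      Complex.I * (∫ y : ℝ in (0)..H, poissonIntegrand a x ((1 : ℝ) + y * Complex.I)) +
      Complex.I * (∫ y : ℝ in (0)..H, poissonIntegrand a x ((-1 : ℝ) + y * Complex.I)) := by
  have h := Complex.integral_boundary_rect_eq_zero_of_continuousOn_of_differentiableOn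
    (poissonIntegrand a x) (-1) (1 + H * Complex.I) ?_ ?_
  · simp at h
    push_cast
    linear_combination h
  · intro z hz
    simp only [Complex.mem_reProdIm] at hz
    have h1 : z.re ∈ Icc (-1 : ℝ) 1 := by simpa [uIcc_of_le] using hz.1
    apply ContinuousAt.continuousWithinAt
    have c1 : ContinuousAt (fun z : ℂ => (1 - z) ^ (a : ℂ)) z :=
      (continuousAt_cpow_const_of_re_nonneg ha (z := 1 - z) (by simpa using h1.2)).comp
        (f := fun z : ℂ => 1 - z) (by fun_prop)
    have c2 : ContinuousAt (fun z : ℂ => (1 + z) ^ (a : ℂ)) z :=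
      (continuousAt_cpow_const_of_re_nonneg ha (z := 1 + z)
        (by simpa using neg_le_iff_add_nonneg'.1 h1.1)).comp
        (f := fun z : ℂ => 1 + z) (by fun_prop)
    exact (by fun_prop : ContinuousAt (fun z : ℂ => Complex.exp (Complex.I * z * x)) z).mul
      (c1.mul c2)
  · intro z hz
    simp only [Complex.mem_reProdIm] at hz
    have h1 : z.re ∈ Ioo (-1 : ℝ) 1 := by simpa using hz.1
    apply DifferentiableAt.differentiableWithinAt
    have c1 : DifferentiableAt ℂ (fun z : ℂ => (1 - z) ^ (a : ℂ)) z :=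
      DifferentiableAt.cpow_const (by fun_prop) (Or.inl (by simpa using h1.2))
    have c2 : DifferentiableAt ℂ (fun z : ℂ => (1 + z) ^ (a : ℂ)) z :=
      DifferentiableAt.cpow_const (by fun_prop)
        (Or.inl (by simpa using neg_lt_iff_pos_add'.1 h1.1))
    exact (by fun_prop : DifferentiableAt ℂ (fun z : ℂ => Complex.exp (Complex.I * z * x)) z).mul
      (c1.mul c2)

theorem two_add_rpow_le {a y : ℝ} (ha : 0 ≤ a) (hy : 0 ≤ y) :
    (2 + y) ^ a ≤ 2 ^ a * Real.exp (a / 2 * y) := by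
  have h : 2 + y ≤ 2 * Real.exp (y / 2) := by
    have := Real.add_one_le_exp (y / 2)
    linarith
  calc (2 + y) ^ a ≤ (2 * Real.exp (y / 2)) ^ a :=
        Real.rpow_le_rpow (by positivity) h ha
    _ = 2 ^ a * Real.exp (a / 2 * y) := by
        rw [Real.mul_rpow (by norm_num) (Real.exp_pos _).le, ← Real.exp_mul]
        ring_nf

theorem norm_integral_poissonIntegrand_edge_le {a x : ℝ} (ha : 0 ≤ a) (hx : a < x) {H : ℝ}
    (hH : 0 < H) {c : ℝ} (hc : c = 1 ∨ c = -1) :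
    ‖∫ y : ℝ in (0)..H, poissonIntegrand a x (c + y * Complex.I)‖ ≤
      2 ^ a * ((1 / (x - a / 2)) ^ (a + 1) * Real.Gamma (a + 1)) := by
  have hr : 0 < x - a / 2 := by linarith
  have hint : IntegrableOn (fun y : ℝ => y ^ (a + 1 - 1) * Real.exp (-((x - a / 2) * y)))
      (Ioi 0) := by
    have := integrableOn_rpow_mul_exp_neg_mul_rpow (p := 1) (s := a) (b := x - a / 2)
      (by linarith) one_pos hr
    simpa only [add_sub_cancel_right, Real.rpow_one, neg_mul] using this
  calc ‖∫ y : ℝ in (0)..H, poissonIntegrand a x (c + y * Complex.I)‖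
      ≤ ∫ y : ℝ in (0)..H, 2 ^ a * (y ^ (a + 1 - 1) * Real.exp (-((x - a / 2) * y))) := by
        apply intervalIntegral.norm_integral_le_of_norm_le hH.le
        · refine Filter.Eventually.of_forall fun y hy => ?_
          have hy0 : 0 < y := hy.1
          have n1 : ‖-((y : ℂ) * Complex.I)‖ = y := by simp [abs_of_pos hy0]
          have n2 : ‖(2 : ℂ) + y * Complex.I‖ ≤ 2 + y :=
            (norm_add_le _ _).trans (by simp [abs_of_pos hy0])
          have n2' : ‖(2 : ℂ) - y * Complex.I‖ ≤ 2 + y :=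
            (norm_sub_le _ _).trans (by simp [abs_of_pos hy0])
          have key : ∀ w : ℝ, 0 ≤ w → w ≤ 2 + y → Real.exp (-(x * y)) * (y ^ a * w ^ a) ≤
              2 ^ a * (y ^ (a + 1 - 1) * Real.exp (-((x - a / 2) * y))) := by
            intro w h0 hw
            have e1 : w ^ a ≤ 2 ^ a * Real.exp (a / 2 * y) :=
              (Real.rpow_le_rpow h0 hw ha).trans (two_add_rpow_le ha hy0.le)
            rw [add_sub_cancel_right, show -((x - a / 2) * y) = -(x * y) + a / 2 * y by ring,
              Real.exp_add]
            calc Real.exp (-(x * y)) * (y ^ a * w ^ a)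
                ≤ Real.exp (-(x * y)) * (y ^ a * (2 ^ a * Real.exp (a / 2 * y))) := by gcongr
              _ = _ := by ring
          rw [norm_poissonIntegrand]
          rcases hc with rfl | rfl
          · rw [show (1 : ℂ) - (((1 : ℝ) : ℂ) + y * Complex.I) = -(y * Complex.I) by push_cast; ring,
              show (1 : ℂ) + (((1 : ℝ) : ℂ) + y * Complex.I) = 2 + y * Complex.I by push_cast; ring,
              n1]
            exact key _ (norm_nonneg _) n2
          · rw [show (1 : ℂ) - (((-1 : ℝ) : ℂ) + y * Complex.I) = 2 - y * Complex.I by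
                push_cast; ring,
              show (1 : ℂ) + (((-1 : ℝ) : ℂ) + y * Complex.I) = -(-(y * Complex.I)) by
                push_cast; ring, norm_neg, n1, mul_comm (_ ^ a)]
            exact key _ (norm_nonneg _) n2'
        · exact ((intervalIntegrable_iff_integrableOn_Ioc_of_le hH.le).2
            (hint.mono_set Ioc_subset_Ioi_self)).const_mul _
    _ = 2 ^ a * ∫ y : ℝ in (0)..H, (y ^ (a + 1 - 1) * Real.exp (-((x - a / 2) * y))) :=
        intervalIntegral.integral_const_mul _ _
    _ ≤ 2 ^ a * ∫ y : ℝ in Ioi 0, (y ^ (a + 1 - 1) * Real.exp (-((x - a / 2) * y))) := by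
        gcongr
        rw [intervalIntegral.integral_of_le hH.le]
        apply setIntegral_mono_set hint
        · filter_upwards [ae_restrict_mem measurableSet_Ioi] with y hy
          exact mul_nonneg (Real.rpow_nonneg (le_of_lt hy) _) (Real.exp_pos _).le
        · exact Filter.Eventually.of_forall Ioc_subset_Ioi_self
    _ = _ := by rw [Real.integral_rpow_mul_exp_neg_mul_Ioi (by linarith) hr]

theorem norm_integral_poissonIntegrand_top_le {a x : ℝ} (ha : 0 ≤ a) {H : ℝ} (hH : 0 < H) :
    ‖∫ s : ℝ in (-1)..1, poissonIntegrand a x (s + H * Complex.I)‖ ≤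
      2 * (2 ^ a * 2 ^ a) * Real.exp (-((x - a) * H)) := by
  have h := intervalIntegral.norm_integral_le_of_norm_le_const (a := -1) (b := 1)
    (f := fun s : ℝ => poissonIntegrand a x (s + H * Complex.I))
    (C := (2 ^ a * 2 ^ a) * Real.exp (-((x - a) * H))) ?_
  · refine h.trans (le_of_eq ?_)
    norm_num
    ring
  · intro s hs
    rw [uIoc_of_le (by norm_num)] at hs
    have hs1 : |s| ≤ 1 := abs_le.2 ⟨hs.1.le, hs.2⟩
    have n0 : ‖(s : ℂ) + H * Complex.I‖ ≤ 1 + H :=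
      (norm_add_le _ _).trans (by simpa [abs_of_pos hH] using hs1)
    have n1 : ‖(1 : ℂ) + (s + H * Complex.I)‖ ≤ 2 + H :=
      (norm_add_le _ _).trans (by simp; linarith)
    have n2 : ‖(1 : ℂ) - (s + H * Complex.I)‖ ≤ 2 + H :=
      (norm_sub_le _ _).trans (by simp; linarith)
    have e1 := (Real.rpow_le_rpow (norm_nonneg _) n1 ha).trans (two_add_rpow_le ha hH.le)
    have e2 := (Real.rpow_le_rpow (norm_nonneg _) n2 ha).trans (two_add_rpow_le ha hH.le)
    rw [norm_poissonIntegrand]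
    calc _ ≤ Real.exp (-(x * H)) * ((2 ^ a * Real.exp (a / 2 * H)) *
          (2 ^ a * Real.exp (a / 2 * H))) := by gcongr
      _ = 2 ^ a * 2 ^ a * (Real.exp (-(x * H)) * Real.exp (a / 2 * H) * Real.exp (a / 2 * H)) := by
          ring
      _ = _ := by
          rw [← Real.exp_add, ← Real.exp_add]
          ring_nf

theorem abs_poissonCos_le {a x : ℝ} (ha : 0 ≤ a) (hx : a < x) :
    |poissonCos a x| ≤ 2 * (2 ^ a * ((1 / (x - a / 2)) ^ (a + 1) * Real.Gamma (a + 1))) := by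
  have h0 : (poissonCos a x : ℂ) = ∫ s : ℝ in (-1)..1, poissonIntegrand a x s := by
    rw [← integral_exp_mul_one_sub_sq_rpow (by linarith)]
    apply intervalIntegral.integral_congr
    intro s hs
    rw [uIcc_of_le (by norm_num)] at hs
    have h1 : 0 ≤ 1 - s := by linarith [hs.2]
    have h2 : 0 ≤ 1 + s := by linarith [hs.1]
    simp only [poissonIntegrand]
    rw [show 1 - s ^ 2 = (1 - s) * (1 + s) by ring, Real.mul_rpow h1 h2, Complex.ofReal_mul,
      Complex.ofReal_cpow h1, Complex.ofReal_cpow h2]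
    push_cast
    rfl
  set B := 2 ^ a * ((1 / (x - a / 2)) ^ (a + 1) * Real.Gamma (a + 1))
  have hle : ∀ H : ℝ, 0 < H → |poissonCos a x| ≤
      2 * (2 ^ a * 2 ^ a) * Real.exp (-((x - a) * H)) + 2 * B := by
    intro H hH
    have hr := norm_integral_poissonIntegrand_edge_le ha hx hH (c := 1) (Or.inl rfl)
    have hl := norm_integral_poissonIntegrand_edge_le ha hx hH (c := -1) (Or.inr rfl)
    have ht := norm_integral_poissonIntegrand_top_le (x := x) ha hH
    rw [← Real.norm_eq_abs, ← Complex.norm_real, h0, poissonIntegrand_rect_eq ha H]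
    refine (norm_add_le _ _).trans ?_
    refine (add_le_add_left (norm_sub_le _ _) _).trans ?_
    rw [norm_mul, norm_mul, Complex.norm_I, one_mul, one_mul]
    linarith
  have hlim : Filter.Tendsto (fun H : ℝ =>
      2 * (2 ^ a * 2 ^ a) * Real.exp (-((x - a) * H)) + 2 * B) Filter.atTop
      (nhds (2 * (2 ^ a * 2 ^ a) * 0 + 2 * B)) := by
    refine (Filter.Tendsto.const_mul _ ?_).add_const _
    refine Real.tendsto_exp_atBot.comp ?_
    exact Filter.tendsto_neg_atTop_atBot.comp
      (Filter.tendsto_id.const_mul_atTop (by linarith : 0 < x - a))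
  rw [mul_zero, zero_add] at hlim
  refine ge_of_tendsto hlim ?_
  filter_upwards [Filter.eventually_gt_atTop 0] with H hH using hle H hH

theorem eventually_sqrt_mul_abs_realBessel_le_one {ν : ℝ} (hν : 1 / 2 ≤ ν) :
    ∀ᶠ x : ℝ in Filter.atTop, √x * |realBessel ν x| ≤ 1 := by
  have hlim : Filter.Tendsto (fun x : ℝ => √(2 / Real.pi) *
      (x / (x - (ν - 1 / 2) / 2)) ^ (ν + 1 / 2)) Filter.atTop
      (nhds (√(2 / Real.pi) * 1 ^ (ν + 1 / 2))) := by
    refine (Filter.Tendsto.rpow_const ?_ (Or.inl one_ne_zero)).const_mul _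
    set c := (ν - 1 / 2) / 2
    have h1 : Filter.Tendsto (fun x : ℝ => 1 + c / (x - c)) Filter.atTop (nhds (1 + 0)) :=
      (tendsto_const_nhds.div_atTop
        (Filter.tendsto_atTop_add_const_right _ (-c) Filter.tendsto_id)).const_add 1
    rw [add_zero] at h1
    refine h1.congr' ?_
    filter_upwards [Filter.eventually_gt_atTop c] with x hx
    have : x - c ≠ 0 := by linarith
    field_simp
    ring
  have hlt : √(2 / Real.pi) * 1 ^ (ν + 1 / 2) < 1 := by
    rw [Real.one_rpow, mul_one, Real.sqrt_lt' one_pos, div_lt_iff₀ Real.pi_pos]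
    linarith [Real.pi_gt_three]
  filter_upwards [hlim.eventually_le_const hlt, Filter.eventually_gt_atTop (ν - 1 / 2),
    Filter.eventually_gt_atTop 0] with x hx hxa hx0
  refine le_trans ?_ hx
  have ha : 0 ≤ ν - 1 / 2 := by linarith
  have hd : 0 < x - (ν - 1 / 2) / 2 := by linarith
  have h := abs_poissonCos_le ha hxa
  rw [show ν - 1 / 2 + 1 = ν + 1 / 2 by ring] at h
  have g1 : 0 < Real.Gamma (ν + 1 / 2) := Real.Gamma_pos_of_pos (by linarith)
  rw [realBessel, abs_mul, abs_of_nonneg (div_nonneg (Real.rpow_nonneg (by linarith) _)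
    (mul_nonneg g1.le (Real.Gamma_pos_of_pos (by norm_num)).le)), Real.Gamma_one_half_eq]
  calc √x * ((x / 2) ^ ν / (Real.Gamma (ν + 1 / 2) * √Real.pi) * |poissonCos (ν - 1 / 2) x|)
      ≤ √x * ((x / 2) ^ ν / (Real.Gamma (ν + 1 / 2) * √Real.pi) *
        (2 * (2 ^ (ν - 1 / 2) * ((1 / (x - (ν - 1 / 2) / 2)) ^ (ν + 1 / 2) *
          Real.Gamma (ν + 1 / 2))))) := by gcongr
    _ = √(2 / Real.pi) * (x / (x - (ν - 1 / 2) / 2)) ^ (ν + 1 / 2) := by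
      rw [Real.div_rpow hx0.le hd.le, Real.div_rpow zero_le_one hd.le, Real.one_rpow,
        Real.div_rpow hx0.le two_pos.le, Real.rpow_sub two_pos, Real.rpow_add hx0,
        ← Real.sqrt_eq_rpow, ← Real.sqrt_eq_rpow, Real.sqrt_div two_pos.le]
      have s2 : √2 ≠ 0 := by positivity
      have s2' : √(2 : ℝ) * √2 = 2 := Real.mul_self_sqrt two_pos.le
      have p2 : (2 : ℝ) ^ ν ≠ 0 := by positivity
      have p3 : √Real.pi ≠ 0 := by have := Real.pi_pos; positivity
      have p4 : (x - (ν - 1 / 2) / 2) ^ (ν + 1 / 2) ≠ 0 := (Real.rpow_pos_of_pos hd _).ne'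
      have : (2 : ℝ) / √2 = √2 := by rw [div_eq_iff s2, s2']
      generalize (x - (ν - 1 / 2) / 2) ^ (ν + 1 / 2) = w at *
      have g1' := g1.ne'
      rw [← this]
      field_simp
      rw [sq, s2']

/-! ### Energy estimates for `u'' + (1 - μ / x²) u = 0` -/

section Energy

variable {μ : ℝ} {u u' : ℝ → ℝ}

theorem hasDerivAt_energy {x : ℝ} (hx : 0 < x) (hu : HasDerivAt u (u' x) x)
    (hu' : HasDerivAt u' (-(1 - μ / x ^ 2) * u x) x) :
    HasDerivAt (fun y => u' y ^ 2 + (1 - μ / y ^ 2) * u y ^ 2) (2 * μ / x ^ 3 * u x ^ 2) x := by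
  have hq : HasDerivAt (fun y : ℝ => 1 - μ / y ^ 2) (2 * μ / x ^ 3) x := by
    have := ((hasDerivAt_pow 2 x).inv (by positivity)).const_mul (-μ) |>.const_add 1
    refine (this.congr_deriv ?_).congr_of_eventuallyEq (Filter.Eventually.of_forall fun y => ?_)
    · norm_num
      field_simp
    · simp [div_eq_mul_inv, sub_eq_add_neg]
  refine ((hu'.pow 2).add (hq.mul (hu.pow 2))).congr_deriv ?_
  norm_num
  ring

theorem monotoneOn_energy (hμ : 0 ≤ μ) (hu : ∀ x, 0 < x → HasDerivAt u (u' x) x)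
    (hu' : ∀ x, 0 < x → HasDerivAt u' (-(1 - μ / x ^ 2) * u x) x) :
    MonotoneOn (fun y => u' y ^ 2 + (1 - μ / y ^ 2) * u y ^ 2) (Ioi 0) := by
  refine monotoneOn_of_hasDerivWithinAt_nonneg (convex_Ioi 0)
    (f' := fun x => 2 * μ / x ^ 3 * u x ^ 2) ?_ ?_ ?_
  · exact fun x hx => (hasDerivAt_energy hx (hu x hx) (hu' x hx)).continuousAt.continuousWithinAt
  · intro x hx
    rw [interior_Ioi] at hx
    exact (hasDerivAt_energy hx (hu x hx) (hu' x hx)).hasDerivWithinAt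
  · intro x hx
    rw [interior_Ioi] at hx
    have : 0 < x := hx
    positivity

theorem energy_le (hμ : 0 ≤ μ) (hu : ∀ x, 0 < x → HasDerivAt u (u' x) x)
    (hu' : ∀ x, 0 < x → HasDerivAt u' (-(1 - μ / x ^ 2) * u x) x)
    (hlim : ∀ᶠ x in Filter.atTop, |u x| ≤ 1 ∧ |u' x| ≤ 2) {x : ℝ} (hx : 0 < x) :
    u' x ^ 2 + (1 - μ / x ^ 2) * u x ^ 2 ≤ 5 := by
  obtain ⟨y, ⟨h1, h2⟩, hxy⟩ := (hlim.and (Filter.eventually_ge_atTop x)).exists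
  have hy : 0 < y := hx.trans_le hxy
  refine (monotoneOn_energy hμ hu hu' hx hy hxy).trans ?_
  have e1 : u y ^ 2 ≤ 1 := by rw [← sq_abs]; nlinarith [abs_nonneg (u y)]
  have e2 : u' y ^ 2 ≤ 4 := by rw [← sq_abs]; nlinarith [abs_nonneg (u' y)]
  have e3 : 0 ≤ μ / y ^ 2 := by positivity
  simp only
  nlinarith [sq_nonneg (u y), mul_nonneg e3 (sq_nonneg (u y))]

theorem sq_le_of_energy (hμ : 0 ≤ μ) (hu : ∀ x, 0 < x → HasDerivAt u (u' x) x)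
    (hu' : ∀ x, 0 < x → HasDerivAt u' (-(1 - μ / x ^ 2) * u x) x)
    (hlim : ∀ᶠ x in Filter.atTop, |u x| ≤ 1 ∧ |u' x| ≤ 2) {x : ℝ} (hx : 0 < x)
    (hx2 : 4 * μ ≤ x ^ 2) : u x ^ 2 ≤ 7 ∧ u' x ^ 2 ≤ 5 := by
  have h := energy_le hμ hu hu' hlim hx
  have hq : 3 / 4 ≤ 1 - μ / x ^ 2 := by
    have : μ / x ^ 2 ≤ 1 / 4 := by
      rw [div_le_div_iff₀ (by positivity) (by norm_num)]
      linarith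
    linarith
  constructor <;> nlinarith [sq_nonneg (u x), sq_nonneg (u' x)]

theorem energy_nonneg (hμ : 0 ≤ μ) (hu : ∀ x, 0 < x → HasDerivAt u (u' x) x)
    (hu' : ∀ x, 0 < x → HasDerivAt u' (-(1 - μ / x ^ 2) * u x) x)
    (h0 : Filter.Tendsto (fun x => u x ^ 2 / x ^ 2) (nhdsWithin 0 (Ioi 0)) (nhds 0))
    {x : ℝ} (hx : 0 < x) : 0 ≤ u' x ^ 2 + (1 - μ / x ^ 2) * u x ^ 2 := by
  have h1 : Filter.Tendsto (fun x => -μ * (u x ^ 2 / x ^ 2)) (nhdsWithin 0 (Ioi 0)) (nhds 0) := by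
    simpa using h0.const_mul (-μ)
  refine le_of_tendsto' (b := u' x ^ 2 + (1 - μ / x ^ 2) * u x ^ 2) (h1.congr' (f₂ := fun y =>
    if y ∈ Ioo 0 x then -μ * (u y ^ 2 / y ^ 2) else u' x ^ 2 + (1 - μ / x ^ 2) * u x ^ 2) ?_) ?_
  · filter_upwards [Ioo_mem_nhdsGT hx] with y hy
    rw [if_pos hy]
  · intro y
    split_ifs with hy
    · refine le_trans ?_ (monotoneOn_energy hμ hu hu' hy.1 hx hy.2.le)
      have : (1 - μ / y ^ 2) * u y ^ 2 = u y ^ 2 - μ * (u y ^ 2 / y ^ 2) := by ring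
      simp only [this]
      nlinarith [sq_nonneg (u y), sq_nonneg (u' y)]
    · exact le_rfl

theorem integral_sq_div_le (hμ : 0 ≤ μ) (hu : ∀ x, 0 < x → HasDerivAt u (u' x) x)
    (hu' : ∀ x, 0 < x → HasDerivAt u' (-(1 - μ / x ^ 2) * u x) x)
    (hlim : ∀ᶠ x in Filter.atTop, |u x| ≤ 1 ∧ |u' x| ≤ 2)
    (h0 : 0 < μ → Filter.Tendsto (fun x => u x ^ 2 / x ^ 2) (nhdsWithin 0 (Ioi 0)) (nhds 0))
    {X : ℝ} (hX : 0 < X) : ∫ x in X..(2 * X), u x ^ 2 / x ≤ 40 := by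
  have hsub : ∀ x ∈ uIcc X (2 * X), 0 < x := fun x hx => by
    rw [uIcc_of_le (by linarith)] at hx
    exact hX.trans_le hx.1
  have hcu : ContinuousOn u (uIcc X (2 * X)) := fun x hx =>
    (hu x (hsub x hx)).continuousAt.continuousWithinAt
  have hi : IntervalIntegrable (fun x => u x ^ 2 / x) volume X (2 * X) :=
    ((hcu.pow 2).div continuousOn_id fun x hx => (hsub x hx).ne').intervalIntegrable
  rcases le_or_gt (4 * μ) (X ^ 2) with h | h
  · have hle : ∫ x in X..(2 * X), u x ^ 2 / x ≤ ∫ x in X..(2 * X), 7 / X := by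
      refine intervalIntegral.integral_mono_on (by linarith) hi (by simp) fun x hx => ?_
      have hx0 : 0 < x := hX.trans_le hx.1
      have := (sq_le_of_energy hμ hu hu' hlim hx0 (by nlinarith [hx.1])).1
      gcongr
      exact hx.1
    refine hle.trans ?_
    simp only [intervalIntegral.integral_const, smul_eq_mul]
    field_simp
    norm_num
  · have hμ' : 0 < μ := by nlinarith
    have hid : IntervalIntegrable (fun x => 2 * μ / x ^ 3 * u x ^ 2) volume X (2 * X) :=
      ((ContinuousOn.div continuousOn_const (by fun_prop) fun x hx => by
        have := hsub x hx
        positivity).mul (hcu.pow 2)).intervalIntegrable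
    have hE : ∫ x in X..(2 * X), 2 * μ / x ^ 3 * u x ^ 2 ≤ 5 := by
      rw [intervalIntegral.integral_eq_sub_of_hasDerivAt (fun x hx =>
        hasDerivAt_energy (hsub x hx) (hu x (hsub x hx)) (hu' x (hsub x hx))) hid]
      have e1 := energy_le hμ hu hu' hlim (x := 2 * X) (by linarith)
      have e2 := energy_nonneg hμ hu hu' (h0 hμ') hX
      linarith
    have hle : ∫ x in X..(2 * X), u x ^ 2 / x ≤
        ∫ x in X..(2 * X), 8 * (2 * μ / x ^ 3 * u x ^ 2) := by
      refine intervalIntegral.integral_mono_on (by linarith) hi (hid.const_mul _) fun x hx => ?_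
      have hx0 : 0 < x := hX.trans_le hx.1
      rw [show 8 * (2 * μ / x ^ 3 * u x ^ 2) = 16 * μ / x ^ 2 * (u x ^ 2 / x) by
        field_simp; ring]
      refine le_mul_of_one_le_left (by positivity) ?_
      rw [one_le_div (by positivity)]
      nlinarith [hx.1, hx.2]
    rw [intervalIntegral.integral_const_mul] at hle
    linarith

/-- The modified energy `p u'² - p' u u' + (p''/2 + (1 - μ/x²) p) u²` for
`p = x / √((1 + s²) x² - μ)`. -/
noncomputable def transitionEnergy (μ s : ℝ) (u u' : ℝ → ℝ) (x : ℝ) : ℝ :=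
  x / √((1 + s ^ 2) * x ^ 2 - μ) * u' x ^ 2 + μ / √((1 + s ^ 2) * x ^ 2 - μ) ^ 3 * (u x * u' x) +
    (3 * μ * (1 + s ^ 2) / 2 * (x / √((1 + s ^ 2) * x ^ 2 - μ) ^ 5) +
      (1 - μ / x ^ 2) * (x / √((1 + s ^ 2) * x ^ 2 - μ))) * u x ^ 2

theorem hasDerivAt_transitionEnergy {s x : ℝ} (hx : 0 < x) (hD : 0 < (1 + s ^ 2) * x ^ 2 - μ)
    (hu : HasDerivAt u (u' x) x) (hu' : HasDerivAt u' (-(1 - μ / x ^ 2) * u x) x) :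
    HasDerivAt (transitionEnergy μ s u u')
      (μ / √((1 + s ^ 2) * x ^ 2 - μ) ^ 7 * (2 * s ^ 2 * ((1 + s ^ 2) * x ^ 2 - μ) ^ 2 -
        3 / 2 * (1 + s ^ 2) * (4 * (1 + s ^ 2) * x ^ 2 + μ)) * u x ^ 2) x := by
  have hw : HasDerivAt (fun y : ℝ => √((1 + s ^ 2) * y ^ 2 - μ))
      ((1 + s ^ 2) * x / √((1 + s ^ 2) * x ^ 2 - μ)) x := by
    have := (((hasDerivAt_pow 2 x).const_mul (1 + s ^ 2)).sub_const μ).sqrt hD.ne'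
    refine this.congr_deriv ?_
    norm_num
    ring
  have hw0 : 0 < √((1 + s ^ 2) * x ^ 2 - μ) := Real.sqrt_pos.2 hD
  have hw2 : √((1 + s ^ 2) * x ^ 2 - μ) ^ 2 = (1 + s ^ 2) * x ^ 2 - μ := Real.sq_sqrt hD.le
  have hq : HasDerivAt (fun y : ℝ => 1 - μ / y ^ 2) (2 * μ / x ^ 3) x := by
    have := ((hasDerivAt_pow 2 x).inv (by positivity)).const_mul (-μ) |>.const_add 1
    refine (this.congr_deriv ?_).congr_of_eventuallyEq (Filter.Eventually.of_forall fun y => ?_)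
    · norm_num
      field_simp
    · simp [div_eq_mul_inv, sub_eq_add_neg]
  have hp := (hasDerivAt_id x).div hw hw0.ne'
  have hp3 := (hasDerivAt_const x μ).div (hw.pow 3) (pow_ne_zero 3 hw0.ne')
  have hp5 := (((hasDerivAt_id x).div (hw.pow 5) (pow_ne_zero 5 hw0.ne')).const_mul
    (3 * μ * (1 + s ^ 2) / 2))
  have := ((hp.mul (hu'.pow 2)).add (hp3.mul (hu.mul hu'))).add
    ((hp5.add (hq.mul hp)).mul (hu.pow 2))
  refine this.congr_deriv ?_
  simp only [id, Pi.mul_apply, Pi.pow_apply, Pi.div_apply, Pi.add_apply, Nat.cast_ofNat]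
  norm_num
  have hμ : μ = (1 + s ^ 2) * x ^ 2 - √((1 + s ^ 2) * x ^ 2 - μ) ^ 2 := by rw [hw2]; ring
  generalize √((1 + s ^ 2) * x ^ 2 - μ) = w at *
  generalize u x = a at *
  generalize u' x = b at *
  subst hμ
  field_simp
  ring

theorem transitionEnergy_monotoneOn {s : ℝ} (hμ : 0 < μ) (hs : 0 < s) (hs1 : s ≤ 1)
    (hsμ : s ^ 6 * μ = 15) (hu : ∀ x, 0 < x → HasDerivAt u (u' x) x)
    (hu' : ∀ x, 0 < x → HasDerivAt u' (-(1 - μ / x ^ 2) * u x) x) :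
    MonotoneOn (transitionEnergy μ s u u') (Ici √μ) := by
  have hpos : ∀ x, √μ ≤ x → 0 < x ∧ μ ≤ x ^ 2 ∧ 0 < (1 + s ^ 2) * x ^ 2 - μ := by
    intro x hx
    have hx0 : 0 < x := (Real.sqrt_pos.2 hμ).trans_le hx
    have hx2 : μ ≤ x ^ 2 := (Real.sqrt_le_left hx0.le).1 hx
    have : 0 < s ^ 2 * x ^ 2 := by positivity
    exact ⟨hx0, hx2, by linarith⟩
  have hd : ∀ x, √μ ≤ x → _ := fun x hx =>
    hasDerivAt_transitionEnergy (s := s) (hpos x hx).1 (hpos x hx).2.2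
      (hu x (hpos x hx).1) (hu' x (hpos x hx).1)
  refine monotoneOn_of_hasDerivWithinAt_nonneg (convex_Ici _) ?_
    (fun x hx => (hd x (interior_subset hx)).hasDerivWithinAt) ?_
  · exact fun x hx => (hd x hx).continuousAt.continuousWithinAt
  · intro x hx
    obtain ⟨hx0, hx2, hD⟩ := hpos x (interior_subset hx)
    have hw0 : 0 < √((1 + s ^ 2) * x ^ 2 - μ) := Real.sqrt_pos.2 hD
    refine mul_nonneg (mul_nonneg (by positivity) ?_) (sq_nonneg _)
    have hs2 : s ^ 2 ≤ 1 := by nlinarith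
    have hD1 : s ^ 2 * x ^ 2 ≤ (1 + s ^ 2) * x ^ 2 - μ := by linarith
    have hD2 : (s ^ 2 * x ^ 2) ^ 2 ≤ ((1 + s ^ 2) * x ^ 2 - μ) ^ 2 :=
      pow_le_pow_left₀ (by positivity) hD1 2
    have h1 : 30 * x ^ 2 ≤ 2 * s ^ 2 * (s ^ 2 * x ^ 2) ^ 2 := by
      have : s ^ 6 * μ * x ^ 2 ≤ s ^ 6 * x ^ 2 * x ^ 2 := by
        nlinarith [mul_nonneg (by positivity : 0 ≤ s ^ 6 * x ^ 2) (sub_nonneg.2 hx2)]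
      rw [hsμ] at this
      nlinarith
    have h2 : 2 * s ^ 2 * (s ^ 2 * x ^ 2) ^ 2 ≤ 2 * s ^ 2 * ((1 + s ^ 2) * x ^ 2 - μ) ^ 2 := by
      gcongr
    have h3 : 3 / 2 * (1 + s ^ 2) * (4 * (1 + s ^ 2) * x ^ 2 + μ) ≤
        3 / 2 * (1 + 1) * (4 * (1 + 1) * x ^ 2 + x ^ 2) := by gcongr
    nlinarith [sq_nonneg x]

theorem transitionEnergy_le {s : ℝ} (hμ : 0 < μ) (hs : 0 < s) (hs1 : s ≤ 1)
    (hsμ : s ^ 6 * μ = 15) (hu : ∀ x, 0 < x → HasDerivAt u (u' x) x)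
    (hu' : ∀ x, 0 < x → HasDerivAt u' (-(1 - μ / x ^ 2) * u x) x)
    (hlim : ∀ᶠ x in Filter.atTop, |u x| ≤ 1 ∧ |u' x| ≤ 2) {x : ℝ} (hx : √μ ≤ x) :
    transitionEnergy μ s u u' x ≤ 8 := by
  obtain ⟨y, ⟨h1, h2⟩, ⟨hxy, hy1⟩, hyμ⟩ := (hlim.and ((Filter.eventually_ge_atTop x).and
    (Filter.eventually_ge_atTop 1) |>.and (Filter.eventually_ge_atTop (6 * μ / s ^ 2)))).exists
  refine (transitionEnergy_monotoneOn hμ hs hs1 hsμ hu hu' hx (hx.trans hxy) hxy).trans ?_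
  have hy : 0 < y := by linarith
  have hs2 : s ^ 2 ≤ 1 := by nlinarith
  rw [div_le_iff₀ (by positivity)] at hyμ
  have hyμ' : 6 * μ ≤ y ^ 2 * s ^ 2 := by
    nlinarith [mul_nonneg (mul_nonneg hy.le (sub_nonneg.2 hy1)) (sq_nonneg s)]
  have hy6 : 6 * μ ≤ y := by nlinarith
  set w := √((1 + s ^ 2) * y ^ 2 - μ) with hw
  have hyw : y ≤ w := Real.le_sqrt_of_sq_le (by linarith)
  have hw0 : 0 < w := hy.trans_le hyw
  have hw1 : 1 ≤ w := hy1.trans hyw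
  have e1 : u y ^ 2 ≤ 1 := by rw [← sq_abs]; nlinarith [abs_nonneg (u y)]
  have e2 : u' y ^ 2 ≤ 4 := by rw [← sq_abs]; nlinarith [abs_nonneg (u' y)]
  have a1 : y / w ≤ 1 := (div_le_one hw0).2 hyw
  have a2 : μ / w ^ 3 ≤ 1 / 6 := by
    rw [div_le_div_iff₀ (by positivity) (by norm_num)]
    have : w ≤ w ^ 3 := le_self_pow₀ hw1 (by norm_num)
    linarith
  have a3 : 3 * μ * (1 + s ^ 2) / 2 * (y / w ^ 5) ≤ 1 := by
    have b1 : y / w ^ 5 ≤ 1 / w := by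
      rw [div_le_div_iff₀ (by positivity) hw0]
      have : w ^ 2 ≤ w ^ 5 := pow_le_pow_right₀ hw1 (by norm_num)
      nlinarith
    calc 3 * μ * (1 + s ^ 2) / 2 * (y / w ^ 5) ≤ 3 * μ * (1 + 1) / 2 * (1 / w) := by gcongr
      _ ≤ 1 := by
        rw [mul_one_div, div_le_one hw0]
        linarith
  have a4 : (1 - μ / y ^ 2) * (y / w) ≤ 1 := by
    have : 0 ≤ μ / y ^ 2 := by positivity
    exact mul_le_one₀ (by linarith) (by positivity) a1 |>.trans le_rfl
  have a5 : u y * u' y ≤ 2 := by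
    calc u y * u' y ≤ |u y * u' y| := le_abs_self _
      _ = |u y| * |u' y| := abs_mul _ _
      _ ≤ 1 * 2 := by gcongr
      _ = 2 := by norm_num
  rw [transitionEnergy, ← hw]
  have t1 : y / w * u' y ^ 2 ≤ 1 * 4 := by gcongr
  have t2 : μ / w ^ 3 * (u y * u' y) ≤ 1 / 6 * 2 :=
    (mul_le_mul_of_nonneg_left a5 (by positivity)).trans (by gcongr)
  have t3 : (3 * μ * (1 + s ^ 2) / 2 * (y / w ^ 5) + (1 - μ / y ^ 2) * (y / w)) * u y ^ 2 ≤
      2 * 1 := by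
    exact (mul_le_mul_of_nonneg_right (by linarith : _ ≤ (2 : ℝ)) (sq_nonneg _)).trans (by gcongr)
  linarith

theorem le_transitionEnergy {s x : ℝ} (hμ : 0 < μ) (hx : 0 < x)
    (hD : 0 < (1 + s ^ 2) * x ^ 2 - μ) :
    (μ * x / √((1 + s ^ 2) * x ^ 2 - μ) ^ 5 +
      (x ^ 2 - μ) / (x * √((1 + s ^ 2) * x ^ 2 - μ))) * u x ^ 2 ≤
      transitionEnergy μ s u u' x := by
  rw [transitionEnergy]
  set w := √((1 + s ^ 2) * x ^ 2 - μ) with hw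
  have hw0 : 0 < w := Real.sqrt_pos.2 hD
  have key : x / w * u' x ^ 2 + μ / w ^ 3 * (u x * u' x) +
      (3 * μ * (1 + s ^ 2) / 2 * (x / w ^ 5) + (1 - μ / x ^ 2) * (x / w)) * u x ^ 2 -
      (μ * x / w ^ 5 + (x ^ 2 - μ) / (x * w)) * u x ^ 2 =
      x / w * (u' x + μ / (2 * x * w ^ 2) * u x) ^ 2 +
      μ * (2 * x ^ 2 - μ + 6 * s ^ 2 * x ^ 2) / (4 * x * w ^ 5) * u x ^ 2 := by
    field_simp
    ring
  have h1 : 0 ≤ x / w * (u' x + μ / (2 * x * w ^ 2) * u x) ^ 2 := by positivity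
  have h2 : 0 ≤ μ * (2 * x ^ 2 - μ + 6 * s ^ 2 * x ^ 2) / (4 * x * w ^ 5) * u x ^ 2 := by
    have : 0 ≤ 2 * x ^ 2 - μ + 6 * s ^ 2 * x ^ 2 := by nlinarith [sq_nonneg (s * x)]
    positivity
  linarith

theorem sq_le_of_transition (hμ : 15 ≤ μ) (hu : ∀ x, 0 < x → HasDerivAt u (u' x) x)
    (hu' : ∀ x, 0 < x → HasDerivAt u' (-(1 - μ / x ^ 2) * u x) x)
    (hlim : ∀ᶠ x in Filter.atTop, |u x| ≤ 1 ∧ |u' x| ≤ 2) {x : ℝ} (hx : √μ ≤ x)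
    (hx4 : x ^ 2 ≤ 4 * μ) : u x ^ 2 ≤ 61440 * μ ^ (1 / 6 : ℝ) := by
  have hμ0 : 0 < μ := by linarith
  set s := (15 / μ) ^ (1 / 6 : ℝ) with hsdef
  have hs : 0 < s := by positivity
  have hs1 : s ≤ 1 := Real.rpow_le_one (by positivity) ((div_le_one hμ0).2 hμ) (by norm_num)
  have hsμ : s ^ 6 * μ = 15 := by
    rw [hsdef, ← Real.rpow_natCast, ← Real.rpow_mul (by positivity)]
    norm_num
    field_simp
  have hx0 : 0 < x := (Real.sqrt_pos.2 hμ0).trans_le hx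
  have hx2 : μ ≤ x ^ 2 := (Real.sqrt_le_left hx0.le).1 hx
  have hsx : 0 < s ^ 2 * x ^ 2 := by positivity
  have hD : 0 < (1 + s ^ 2) * x ^ 2 - μ := by linarith
  have hW := (le_transitionEnergy (u := u) (u' := u') hμ0 hx0 hD).trans
    (transitionEnergy_le hμ0 hs hs1 hsμ hu hu' hlim hx)
  set w := √((1 + s ^ 2) * x ^ 2 - μ) with hw
  have hw0 : 0 < w := Real.sqrt_pos.2 hD
  have hw2 : w ^ 2 = s ^ 2 * x ^ 2 + (x ^ 2 - μ) := by
    rw [hw, Real.sq_sqrt hD.le]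
    ring
  have n1 : 0 ≤ μ * x / w ^ 5 := by positivity
  have n2 : 0 ≤ (x ^ 2 - μ) / (x * w) := div_nonneg (by linarith) (by positivity)
  have hκ : s / 7680 ≤ μ * x / w ^ 5 + (x ^ 2 - μ) / (x * w) := by
    rcases le_total (x ^ 2 - μ) (s ^ 2 * x ^ 2) with h | h
    · have hw' : w ≤ 2 * s * x := by
        refine (pow_le_pow_iff_left₀ hw0.le (by positivity) two_ne_zero).1 ?_
        nlinarith
      have h5 : w ^ 5 ≤ (2 * s * x) ^ 5 := pow_le_pow_left₀ hw0.le hw' 5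
      have : s / 7680 ≤ μ * x / w ^ 5 := by
        rw [div_le_div_iff₀ (by norm_num) (by positivity)]
        have h6 : s * (2 * s * x) ^ 5 ≤ μ * x * 7680 := by
          have e1 : s * (2 * s * x) ^ 5 = 32 * (s ^ 6 * x ^ 4) * x := by ring
          have e2 : s ^ 6 * x ^ 4 ≤ 240 * μ := by
            have : s ^ 6 * (x ^ 2) ^ 2 ≤ s ^ 6 * (4 * μ) ^ 2 := by gcongr
            nlinarith
          rw [e1]
          nlinarith
        exact (mul_le_mul_of_nonneg_left h5 hs.le).trans h6
      linarith
    · have hw' : s * x ≤ w := by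
        refine (pow_le_pow_iff_left₀ (by positivity) hw0.le two_ne_zero).1 ?_
        nlinarith
      have : s / 2 ≤ (x ^ 2 - μ) / (x * w) := by
        rw [div_le_div_iff₀ (by norm_num) (by positivity)]
        nlinarith
      linarith
  have h1 : s / 7680 * u x ^ 2 ≤ 8 := (mul_le_mul_of_nonneg_right hκ (sq_nonneg _)).trans hW
  have h2 : 1 ≤ s * μ ^ (1 / 6 : ℝ) := by
    rw [hsdef, ← Real.mul_rpow (by positivity) hμ0.le, div_mul_cancel₀ _ hμ0.ne']
    exact Real.one_le_rpow (by norm_num) (by norm_num)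
  nlinarith [sq_nonneg (u x), Real.rpow_pos_of_pos hμ0 (1 / 6 : ℝ)]

end Energy

/-! ### Uniform bounds for the Bessel functions -/

theorem exists_pos_le_Gamma : ∃ c : ℝ, 0 < c ∧ ∀ x : ℝ, 1 / 2 ≤ x → c ≤ Real.Gamma x := by
  obtain ⟨z, hz, hmin⟩ := (isCompact_Icc (a := (1 / 2 : ℝ)) (b := 2)).exists_isMinOn
    ⟨1, by norm_num⟩ (f := Real.Gamma) fun x hx =>
      (Real.differentiableAt_Gamma fun m => by
        have : 0 < x := by linarith [hx.1]
        have : (0 : ℝ) ≤ m := m.cast_nonneg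
        linarith).continuousAt.continuousWithinAt
  refine ⟨Real.Gamma z, Real.Gamma_pos_of_pos (by linarith [hz.1]), fun x hx => ?_⟩
  rcases le_total x 2 with h | h
  · exact hmin ⟨hx, h⟩
  · exact (hmin ⟨by norm_num, le_rfl⟩).trans
      (Real.Gamma_strictMonoOn_Ici.monotoneOn (mem_Ici.2 le_rfl) (mem_Ici.2 h) h)

/-- Uniform bound of the Bessel functions by the leading power at the origin. -/
theorem exists_abs_realBessel_le_rpow {ν₀ : ℝ} (h₀ : 0 < ν₀) :
    ∃ C : ℝ, 0 < C ∧ ∀ ν x : ℝ, ν₀ ≤ ν → 0 < x → |realBessel ν x| ≤ C * (x / 2) ^ ν := by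
  obtain ⟨c, hc, hG⟩ := exists_pos_le_Gamma
  have hi := intervalIntegrable_one_sub_sq_rpow (a := ν₀ - 1 / 2) (by linarith)
  set M := ∫ s in (-1 : ℝ)..1, (1 - s ^ 2) ^ (ν₀ - 1 / 2)
  have hM : 0 ≤ M := intervalIntegral.integral_nonneg (by norm_num) fun s hs =>
    Real.rpow_nonneg (by nlinarith [hs.1, hs.2]) _
  refine ⟨1 / (c * c) * (M + 1), by positivity, fun ν x hν hx => ?_⟩
  have hp : |poissonCos (ν - 1 / 2) x| ≤ M + 1 := by
    refine le_trans ?_ (lt_add_one M).le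
    rw [← Real.norm_eq_abs]
    refine intervalIntegral.norm_integral_le_of_norm_le (by norm_num) ?_ hi
    filter_upwards [Measure.ae_ne volume (1 : ℝ)] with s hs1 hs
    have h1 : 0 < 1 - s ^ 2 := by nlinarith [hs.1, lt_of_le_of_ne hs.2 hs1]
    rw [norm_mul, Real.norm_of_nonneg (Real.rpow_nonneg h1.le _)]
    calc ‖Real.cos (s * x)‖ * (1 - s ^ 2) ^ (ν - 1 / 2)
        ≤ 1 * (1 - s ^ 2) ^ (ν₀ - 1 / 2) := by
          refine mul_le_mul (Real.abs_cos_le_one _) ?_ (Real.rpow_nonneg h1.le _) zero_le_one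
          exact Real.rpow_le_rpow_of_exponent_ge h1 (by nlinarith) (by linarith)
      _ = _ := one_mul _
  have g1 := hG (ν + 1 / 2) (by linarith)
  have g2 := hG (1 / 2) le_rfl
  have hx2 : 0 ≤ (x / 2) ^ ν := by positivity
  have g3 := hc.le.trans g1
  rw [realBessel, abs_mul, abs_of_nonneg (div_nonneg hx2
    (mul_nonneg (hc.le.trans g1) (hc.le.trans g2)))]
  calc (x / 2) ^ ν / (Real.Gamma (ν + 1 / 2) * Real.Gamma (1 / 2)) * |poissonCos (ν - 1 / 2) x|
      ≤ (x / 2) ^ ν / (c * c) * (M + 1) := by gcongr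
    _ = _ := by ring

section BesselEnergy

/-- `√x J_ν(x)`. -/
noncomputable def besselU (ν x : ℝ) : ℝ := √x * realBessel ν x

/-- The derivative of `√x J_ν(x)`. -/
noncomputable def besselU' (ν x : ℝ) : ℝ := (ν + 1 / 2) / x * besselU ν x - besselU (ν + 1) x

theorem hasDerivAt_besselU {ν x : ℝ} (hν : -(1 / 2) < ν) (hx : 0 < x) :
    HasDerivAt (besselU ν) (besselU' ν x) x := by
  have := (Real.hasDerivAt_sqrt hx.ne').mul (hasDerivAt_realBessel hν hx)
  refine this.congr_deriv ?_
  have h : 1 / (2 * √x) = √x / (2 * x) := by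
    have := Real.sqrt_pos.2 hx
    rw [div_eq_div_iff (by positivity) (by positivity)]
    linear_combination -2 * Real.mul_self_sqrt hx.le
  rw [besselU', besselU, besselU, h]
  field_simp
  ring

theorem hasDerivAt_besselU_add_one {ν x : ℝ} (hν : -(1 / 2) < ν) (hx : 0 < x) :
    HasDerivAt (besselU (ν + 1)) (besselU ν x - (ν + 1 / 2) / x * besselU (ν + 1) x) x := by
  have := (Real.hasDerivAt_sqrt hx.ne').mul (hasDerivAt_realBessel_add_one hν hx)
  refine this.congr_deriv ?_
  have h : 1 / (2 * √x) = √x / (2 * x) := by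
    have := Real.sqrt_pos.2 hx
    rw [div_eq_div_iff (by positivity) (by positivity)]
    linear_combination -2 * Real.mul_self_sqrt hx.le
  rw [besselU, besselU, h]
  field_simp
  ring

theorem hasDerivAt_besselU' {ν x : ℝ} (hν : -(1 / 2) < ν) (hx : 0 < x) :
    HasDerivAt (besselU' ν) (-(1 - (ν ^ 2 - 1 / 4) / x ^ 2) * besselU ν x) x := by
  have h1 : HasDerivAt (fun y : ℝ => (ν + 1 / 2) / y) (-(ν + 1 / 2) / x ^ 2) x := by
    refine ((hasDerivAt_const x (ν + 1 / 2)).div (hasDerivAt_id x) hx.ne').congr_deriv ?_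
    simp
  refine ((h1.mul (hasDerivAt_besselU hν hx)).sub
    (hasDerivAt_besselU_add_one hν hx)).congr_deriv ?_
  rw [besselU']
  field_simp
  ring

theorem eventually_besselU_le {ν : ℝ} (hν : 1 / 2 ≤ ν) :
    ∀ᶠ x in Filter.atTop, |besselU ν x| ≤ 1 ∧ |besselU' ν x| ≤ 2 := by
  filter_upwards [eventually_sqrt_mul_abs_realBessel_le_one hν,
    eventually_sqrt_mul_abs_realBessel_le_one (ν := ν + 1) (by linarith),
    Filter.eventually_ge_atTop (ν + 1 / 2)] with x h1 h2 h3
  have hx : 0 < x := by linarith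
  have e1 : |besselU ν x| ≤ 1 := by rwa [besselU, abs_mul, abs_of_nonneg (Real.sqrt_nonneg x)]
  have e2 : |besselU (ν + 1) x| ≤ 1 := by
    rwa [besselU, abs_mul, abs_of_nonneg (Real.sqrt_nonneg x)]
  refine ⟨e1, ?_⟩
  rw [besselU']
  refine (abs_sub _ _).trans ?_
  rw [abs_mul, abs_of_nonneg (by positivity : 0 ≤ (ν + 1 / 2) / x)]
  have : (ν + 1 / 2) / x * |besselU ν x| ≤ 1 * 1 := by
    gcongr
    exact (div_le_one hx).2 h3
  linarith

theorem realBessel_sq_eq {ν x : ℝ} (hx : 0 < x) : realBessel ν x ^ 2 = besselU ν x ^ 2 / x := by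
  rw [besselU, mul_pow, Real.sq_sqrt hx.le]
  field_simp

end BesselEnergy

theorem realBessel_sq_le_div {ν x : ℝ} (hν : 1 / 2 ≤ ν) (hx : 0 < x)
    (h : 4 * (ν ^ 2 - 1 / 4) ≤ x ^ 2) : realBessel ν x ^ 2 ≤ 7 / x := by
  rw [realBessel_sq_eq hx]
  gcongr
  exact (sq_le_of_energy (by nlinarith) (fun x hx => hasDerivAt_besselU (by linarith) hx)
    (fun x hx => hasDerivAt_besselU' (by linarith) hx) (eventually_besselU_le hν) hx h).1

theorem tendsto_realBessel_zero {ν : ℝ} (hν : 0 < ν) :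
    Filter.Tendsto (realBessel ν) (nhdsWithin 0 (Ioi 0)) (nhds 0) := by
  obtain ⟨C, hC, hb⟩ := exists_abs_realBessel_le_rpow hν
  have h1 : Filter.Tendsto (fun x : ℝ => C * (x / 2) ^ ν) (nhdsWithin 0 (Ioi 0)) (nhds 0) := by
    have : ContinuousAt (fun x : ℝ => C * (x / 2) ^ ν) 0 := by
      refine ContinuousAt.mul continuousAt_const (ContinuousAt.rpow_const (by fun_prop) (Or.inr hν.le))
    have h := this.tendsto
    simp only [zero_div, Real.zero_rpow hν.ne', mul_zero] at h
    exact h.mono_left nhdsWithin_le_nhds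
  refine squeeze_zero_norm' ?_ h1
  filter_upwards [self_mem_nhdsWithin] with x hx using hb ν x le_rfl hx

theorem monotoneOn_realBessel_mul_deriv {ν : ℝ} (hν : 0 < ν) :
    MonotoneOn (fun x => realBessel ν x * (ν * realBessel ν x - x * realBessel (ν + 1) x))
      (Ioc 0 ν) := by
  have hd : ∀ x : ℝ, 0 < x → HasDerivAt
      (fun x => realBessel ν x * (ν * realBessel ν x - x * realBessel (ν + 1) x))
      ((ν * realBessel ν x - x * realBessel (ν + 1) x) ^ 2 / x +
        (ν ^ 2 - x ^ 2) / x * realBessel ν x ^ 2) x := by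
    intro x hx
    have h1 := hasDerivAt_realBessel (ν := ν) (by linarith) hx
    have h2 := hasDerivAt_realBessel_add_one (ν := ν) (by linarith) hx
    refine (h1.mul ((h1.const_mul ν).sub ((hasDerivAt_id x).mul h2))).congr_deriv ?_
    simp only [id, Pi.sub_apply, Pi.mul_apply]
    field_simp
    ring
  refine monotoneOn_of_hasDerivWithinAt_nonneg (convex_Ioc 0 ν)
    (fun x hx => (hd x hx.1).continuousAt.continuousWithinAt)
    (fun x hx => (hd x (interior_subset hx).1).hasDerivWithinAt) fun x hx => ?_
  obtain ⟨h1, h2⟩ := interior_subset hx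
  have : 0 ≤ ν ^ 2 - x ^ 2 := by nlinarith
  positivity

theorem realBessel_mul_deriv_nonneg {ν x : ℝ} (hν : 0 < ν) (hx : x ∈ Ioc 0 ν) :
    0 ≤ realBessel ν x * (ν * realBessel ν x - x * realBessel (ν + 1) x) := by
  have h1 := tendsto_realBessel_zero hν
  have h2 := tendsto_realBessel_zero (ν := ν + 1) (by linarith)
  have h3 : Filter.Tendsto (fun x : ℝ => x) (nhdsWithin 0 (Ioi 0)) (nhds 0) :=
    Filter.tendsto_id.mono_left nhdsWithin_le_nhds
  have h4 := h1.mul ((h1.const_mul ν).sub (h3.mul h2))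
  rw [zero_mul] at h4
  refine le_of_tendsto h4 ?_
  filter_upwards [Ioo_mem_nhdsGT hx.1] with y hy
  exact monotoneOn_realBessel_mul_deriv hν ⟨hy.1, hy.2.le.trans hx.2⟩ hx hy.2.le

theorem monotoneOn_realBessel_sq {ν : ℝ} (hν : 0 < ν) :
    MonotoneOn (fun x => realBessel ν x ^ 2) (Ioc 0 ν) := by
  have hd : ∀ x : ℝ, 0 < x → HasDerivAt (fun x => realBessel ν x ^ 2)
      (2 / x * (realBessel ν x * (ν * realBessel ν x - x * realBessel (ν + 1) x))) x := by
    intro x hx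
    refine ((hasDerivAt_realBessel (ν := ν) (by linarith) hx).pow 2).congr_deriv ?_
    field_simp
    norm_num
    ring
  refine monotoneOn_of_hasDerivWithinAt_nonneg (convex_Ioc 0 ν)
    (fun x hx => (hd x hx.1).continuousAt.continuousWithinAt)
    (fun x hx => (hd x (interior_subset hx).1).hasDerivWithinAt) fun x hx => ?_
  have h := interior_subset hx
  have := h.1
  exact mul_nonneg (by positivity) (realBessel_mul_deriv_nonneg hν h)

theorem realBessel_sq_le_of_large {ν x : ℝ} (hν : 1 / 2 ≤ ν) (hμ : 15 ≤ ν ^ 2 - 1 / 4)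
    (hx : 1 / 2 ≤ x) : realBessel ν x ^ 2 ≤ 61440 * x ^ (-(2 / 3) : ℝ) := by
  set μ := ν ^ 2 - 1 / 4 with hμdef
  have hx0 : 0 < x := by linarith
  have trans : ∀ y, √μ ≤ y → y ^ 2 ≤ 4 * μ →
      realBessel ν y ^ 2 ≤ 61440 * y ^ (-(2 / 3) : ℝ) := by
    intro y hy hy4
    have hy0 : 0 < y := (Real.sqrt_pos.2 (by linarith)).trans_le hy
    have hy2 : μ ≤ y ^ 2 := (Real.sqrt_le_left hy0.le).1 hy
    have h := sq_le_of_transition hμ (fun x hx => hasDerivAt_besselU (ν := ν) (by linarith) hx)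
      (fun x hx => hasDerivAt_besselU' (by linarith) hx) (eventually_besselU_le hν) hy hy4
    rw [realBessel_sq_eq hy0, div_le_iff₀ hy0]
    refine h.trans ?_
    rw [mul_assoc]
    gcongr
    calc μ ^ (1 / 6 : ℝ) ≤ (y ^ 2) ^ (1 / 6 : ℝ) := by gcongr
      _ = y ^ (-(2 / 3) : ℝ) * y := by
        rw [← Real.rpow_natCast, ← Real.rpow_mul hy0.le, ← Real.rpow_add_one hy0.ne']
        norm_num
  rcases le_total (√μ) x with h1 | h1
  · rcases le_total (x ^ 2) (4 * μ) with h2 | h2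
    · exact trans x h1 h2
    · refine (realBessel_sq_le_div hν hx0 h2).trans ?_
      rw [div_le_iff₀ hx0, mul_assoc, ← Real.rpow_add_one hx0.ne']
      have : (1 / 2 : ℝ) ≤ x ^ (-(2 / 3) + 1 : ℝ) := by
        calc (1 / 2 : ℝ) ≤ (1 / 2) ^ (-(2 / 3) + 1 : ℝ) := by
              apply Real.self_le_rpow_of_le_one <;> norm_num
          _ ≤ _ := by gcongr
      linarith
  · have hs : 0 < √μ := Real.sqrt_pos.2 (by linarith)
    have hsν : √μ ≤ ν := (Real.sqrt_le_left (by linarith)).2 (by linarith)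
    refine (monotoneOn_realBessel_sq (ν := ν) (by linarith) ⟨hx0, h1.trans hsν⟩ ⟨hs, hsν⟩ h1).trans ?_
    refine (trans _ le_rfl ?_).trans ?_
    · rw [Real.sq_sqrt (by linarith)]
      linarith
    · gcongr 61440 * ?_
      exact Real.rpow_le_rpow_of_nonpos hx0 h1 (by norm_num)

theorem exists_realBessel_sq_le_div_of_small {ν₀ : ℝ} (h₀ : 0 < ν₀) :
    ∃ C : ℝ, 0 < C ∧ ∀ ν x : ℝ, ν₀ ≤ ν → ν ≤ 4 → 1 / 2 ≤ x →
      realBessel ν x ^ 2 ≤ C / x := by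
  obtain ⟨C, hC, hb⟩ := exists_abs_realBessel_le_rpow h₀
  refine ⟨C ^ 2 * 4 ^ 8 * 8 + 80, by positivity, fun ν x hν hν4 hx => ?_⟩
  have hx0 : 0 < x := by linarith
  rcases le_total x 8 with hx8 | hx8
  · have h1 : |realBessel ν x| ≤ C * 4 ^ 4 := by
      refine (hb ν x hν hx0).trans ?_
      gcongr
      calc (x / 2) ^ ν ≤ 4 ^ ν := by gcongr <;> linarith
        _ ≤ 4 ^ (4 : ℝ) := Real.rpow_le_rpow_of_exponent_le (by norm_num) hν4
        _ = 4 ^ 4 := by norm_cast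
    rw [← sq_abs, le_div_iff₀ hx0]
    calc |realBessel ν x| ^ 2 * x ≤ (C * 4 ^ 4) ^ 2 * 8 := by gcongr
      _ ≤ _ := by nlinarith
  · have hC8 : 0 ≤ C ^ 2 * 4 ^ 8 * 8 := by positivity
    rcases le_total (1 / 2) ν with h | h
    · refine (realBessel_sq_le_div h hx0 (by nlinarith)).trans ?_
      gcongr
      linarith
    · have hE := sq_le_of_energy (μ := (ν + 1) ^ 2 - 1 / 4) (by nlinarith)
        (fun x hx => hasDerivAt_besselU (ν := ν + 1) (by linarith) hx)
        (fun x hx => hasDerivAt_besselU' (by linarith) hx)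
        (eventually_besselU_le (by linarith)) hx0 (by nlinarith)
      have hU : besselU ν x = besselU' (ν + 1) x + (ν + 1 / 2) / x * besselU (ν + 1) x := by
        have e1 := (hasDerivAt_besselU (ν := ν + 1) (by linarith) hx0).unique
          (hasDerivAt_besselU_add_one (ν := ν) (by linarith) hx0)
        linarith
      rw [realBessel_sq_eq hx0]
      gcongr
      have hk : (ν + 1 / 2) / x ≤ 1 := (div_le_one hx0).2 (by linarith)
      have hk0 : 0 ≤ (ν + 1 / 2) / x := div_nonneg (by linarith) hx0.le
      rw [hU]
      generalize (ν + 1 / 2) / x = k at *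
      generalize besselU' (ν + 1) x = p at *
      generalize besselU (ν + 1) x = r at *
      have : (k * r) ^ 2 ≤ r ^ 2 := by
        rw [mul_pow]
        exact mul_le_of_le_one_left (sq_nonneg _) (by nlinarith)
      nlinarith [sq_nonneg (p - k * r)]

/-- Uniform decay `|J_ν(x)| ≤ C x^{-1/3}`. -/
theorem exists_abs_realBessel_le_rpow_neg {ν₀ : ℝ} (h₀ : 0 < ν₀) :
    ∃ C : ℝ, 0 < C ∧ ∀ ν x : ℝ, ν₀ ≤ ν → 1 / 2 ≤ x →
      |realBessel ν x| ≤ C * x ^ (-(1 / 3) : ℝ) := by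
  obtain ⟨C, hC, hb⟩ := exists_realBessel_sq_le_div_of_small h₀
  refine ⟨2 * C + 61440, by positivity, fun ν x hν hx => ?_⟩
  have hx0 : 0 < x := by linarith
  have hsq : realBessel ν x ^ 2 ≤ (2 * C + 61440) * x ^ (-(2 / 3) : ℝ) := by
    rcases le_total ν 4 with h | h
    · refine (hb ν x hν h hx).trans ?_
      rw [div_le_iff₀ hx0, mul_assoc, ← Real.rpow_add_one hx0.ne']
      have : (1 / 2 : ℝ) ≤ x ^ (-(2 / 3) + 1 : ℝ) := by
        calc (1 / 2 : ℝ) ≤ (1 / 2) ^ (-(2 / 3) + 1 : ℝ) := by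
              apply Real.self_le_rpow_of_le_one <;> norm_num
          _ ≤ _ := by gcongr
      nlinarith
    · refine (realBessel_sq_le_of_large (by linarith) (by nlinarith) hx).trans ?_
      gcongr
      linarith
  refine abs_le_of_sq_le_sq (hsq.trans ?_) (by positivity)
  rw [mul_pow, ← Real.rpow_natCast (x ^ _), ← Real.rpow_mul hx0.le]
  norm_num
  gcongr
  nlinarith

/-- Uniform mean-square bound on dyadic intervals. -/
theorem exists_integral_realBessel_sq_le {ν₀ : ℝ} (h₀ : 0 < ν₀) :
    ∃ C : ℝ, 0 < C ∧ ∀ ν X : ℝ, ν₀ ≤ ν → 1 / 2 ≤ X →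
      ∫ x in X..(2 * X), realBessel ν x ^ 2 ≤ C := by
  obtain ⟨C, hC, hb⟩ := exists_realBessel_sq_le_div_of_small h₀
  refine ⟨C + 40, by positivity, fun ν X hν hX => ?_⟩
  have hX0 : 0 < X := by linarith
  rcases le_total ν 4 with h | h
  · have hle : ∫ x in X..(2 * X), realBessel ν x ^ 2 ≤ ∫ x in X..(2 * X), C / X := by
      refine intervalIntegral.integral_mono_on (by linarith) ?_ (by simp) fun x hx => ?_
      · refine ContinuousOn.intervalIntegrable fun x hx => ?_
        rw [uIcc_of_le (by linarith)] at hx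
        exact ((hasDerivAt_realBessel (ν := ν) (by linarith)
          (by linarith [hx.1])).continuousAt.pow 2).continuousWithinAt
      · refine (hb ν x hν h (hX.trans hx.1)).trans ?_
        gcongr
        exact hx.1
    refine hle.trans ?_
    simp only [intervalIntegral.integral_const, smul_eq_mul]
    field_simp
    linarith
  · have h1 : ∫ x in X..(2 * X), realBessel ν x ^ 2 = ∫ x in X..(2 * X), besselU ν x ^ 2 / x := by
      apply intervalIntegral.integral_congr
      intro x hx
      rw [uIcc_of_le (by linarith)] at hx
      exact realBessel_sq_eq (by linarith [hx.1])
    rw [h1]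
    refine (integral_sq_div_le (μ := ν ^ 2 - 1 / 4) (by nlinarith)
      (fun x hx => hasDerivAt_besselU (by linarith) hx)
      (fun x hx => hasDerivAt_besselU' (by linarith) hx)
      (eventually_besselU_le (by linarith)) (fun _ => ?_) hX0).trans (by linarith)
    obtain ⟨K, hK, hbd⟩ := exists_abs_realBessel_le_rpow (ν₀ := ν) (by linarith)
    have hlim : Filter.Tendsto (fun x : ℝ => K ^ 2 * x) (nhdsWithin 0 (Ioi 0)) (nhds 0) := by
      have : ContinuousAt (fun x : ℝ => K ^ 2 * x) 0 := by fun_prop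
      have h := this.tendsto
      rw [mul_zero] at h
      exact h.mono_left nhdsWithin_le_nhds
    refine squeeze_zero' (Filter.Eventually.of_forall fun x => by positivity) ?_ hlim
    filter_upwards [Ioo_mem_nhdsGT one_pos] with x hx
    have hx0 : 0 < x := hx.1
    have e1 : |realBessel ν x| ≤ K * x := by
      refine (hbd ν x le_rfl hx0).trans ?_
      gcongr
      calc (x / 2) ^ ν ≤ x ^ ν := by gcongr; linarith
        _ ≤ x ^ (1 : ℝ) := Real.rpow_le_rpow_of_exponent_ge hx0 hx.2.le (by linarith)
        _ = x := Real.rpow_one x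
    rw [besselU, mul_pow, Real.sq_sqrt hx0.le, ← sq_abs, div_le_iff₀ (by positivity)]
    calc x * |realBessel ν x| ^ 2 ≤ x * (K * x) ^ 2 := by gcongr
      _ = K ^ 2 * x * x ^ 2 := by ring

/-! ### The `ℓ²` norm of a family and Minkowski's inequality -/

section EllTwo

variable {ι : Type*}

theorem ell2Norm_sq (z : ι → ℂ) : ell2Norm z ^ 2 = ∑' i, ‖z i‖ₑ ^ 2 := by
  rw [ell2Norm, ← ENNReal.rpow_natCast, ← ENNReal.rpow_mul]
  norm_num

theorem ell2Norm_le_of_finset {z : ι → ℂ} {M : ℝ≥0∞}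
    (h : ∀ s : Finset ι, ∑ i ∈ s, ‖z i‖ₑ ^ 2 ≤ M ^ 2) : ell2Norm z ≤ M := by
  refine (ENNReal.pow_le_pow_left_iff two_ne_zero).1 ?_
  rw [ell2Norm_sq, ENNReal.tsum_eq_iSup_sum]
  exact iSup_le h

theorem enorm_le_ell2Norm (z : ι → ℂ) (i : ι) : ‖z i‖ₑ ≤ ell2Norm z := by
  refine (ENNReal.pow_le_pow_left_iff two_ne_zero).1 ?_
  rw [ell2Norm_sq]
  exact ENNReal.le_tsum i

theorem ell2Norm_mul_right (z : ι → ℂ) (c : ℂ) :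
    ell2Norm (fun i => z i * c) = ell2Norm z * ‖c‖ₑ := by
  refine (ENNReal.pow_right_strictMono two_ne_zero).injective ?_
  simp only [mul_pow, ell2Norm_sq, enorm_mul, ENNReal.tsum_mul_right]

theorem ell2Norm_zero : ell2Norm (fun _ : ι => (0 : ℂ)) = 0 := by
  simp [ell2Norm]

theorem ell2Norm_add_le (z w : ι → ℂ) :
    ell2Norm (fun i => z i + w i) ≤ ell2Norm z + ell2Norm w := by
  refine ell2Norm_le_of_finset fun s => ?_
  have h := ENNReal.Lp_add_le s (fun i => ‖z i‖ₑ) (fun i => ‖w i‖ₑ) (p := 2) (by norm_num)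
  simp only [ENNReal.rpow_two] at h
  have hz : (∑ i ∈ s, ‖z i‖ₑ ^ 2) ^ (1 / 2 : ℝ) ≤ ell2Norm z :=
    ENNReal.rpow_le_rpow (ENNReal.sum_le_tsum s) (by norm_num)
  have hw : (∑ i ∈ s, ‖w i‖ₑ ^ 2) ^ (1 / 2 : ℝ) ≤ ell2Norm w :=
    ENNReal.rpow_le_rpow (ENNReal.sum_le_tsum s) (by norm_num)
  calc ∑ i ∈ s, ‖z i + w i‖ₑ ^ 2 ≤ ∑ i ∈ s, (‖z i‖ₑ + ‖w i‖ₑ) ^ 2 := by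
        gcongr with i
        exact enorm_add_le _ _
    _ = ((∑ i ∈ s, (‖z i‖ₑ + ‖w i‖ₑ) ^ 2) ^ (1 / 2 : ℝ)) ^ 2 := by
        rw [← ENNReal.rpow_natCast, ← ENNReal.rpow_mul]
        norm_num
    _ ≤ (ell2Norm z + ell2Norm w) ^ 2 := by
        gcongr
        exact h.trans (add_le_add hz hw)

theorem measurable_ell2Norm [Countable ι] {α : Type*} [MeasurableSpace α] {G : ι → α → ℂ}
    (hG : ∀ i, Measurable (G i)) : Measurable fun x => ell2Norm fun i => G i x := by
  unfold ell2Norm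
  exact (Measurable.tsum fun i => (hG i).enorm.pow_const 2).pow_const _

/-- Minkowski's integral inequality for an `ℓ²` sum. -/
theorem sum_lintegral_sq_le {α : Type*} [MeasurableSpace α] {m : Measure α} {f : ι → α → ℝ≥0∞}
    (hf : ∀ i, AEMeasurable (f i) m) {N : α → ℝ≥0∞} (s : Finset ι)
    (hN : ∀ x, ∑ i ∈ s, f i x ^ 2 ≤ N x ^ 2) :
    ∑ i ∈ s, (∫⁻ x, f i x ∂m) ^ 2 ≤ (∫⁻ x, N x ∂m) ^ 2 := by
  by_cases htop : ∫⁻ x, N x ∂m = ⊤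
  · simp [htop]
  have hfN : ∀ i ∈ s, ∀ x, f i x ≤ N x := fun i hi x =>
    (ENNReal.pow_le_pow_left_iff two_ne_zero).1
      ((Finset.single_le_sum (f := fun i => f i x ^ 2) (fun _ _ => zero_le) hi).trans (hN x))
  have ha : ∀ i ∈ s, ∫⁻ x, f i x ∂m ≠ ⊤ := fun i hi =>
    ((lintegral_mono (hfN i hi)).trans_lt (lt_top_iff_ne_top.2 htop)).ne
  set A := ∑ i ∈ s, (∫⁻ x, f i x ∂m) ^ 2 with hA
  have hAtop : A ≠ ⊤ := ENNReal.sum_ne_top.2 fun i hi => ENNReal.pow_ne_top (ha i hi)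
  by_cases hA0 : A = 0
  · simp [hA0]
  have hroot : (A ^ (1 / 2 : ℝ)) ^ 2 = A := by
    rw [← ENNReal.rpow_natCast, ← ENNReal.rpow_mul]
    norm_num
  have hr0 : A ^ (1 / 2 : ℝ) ≠ 0 := fun h => hA0 (by rw [← hroot, h]; simp)
  have hrt : A ^ (1 / 2 : ℝ) ≠ ⊤ := ENNReal.rpow_ne_top_of_nonneg (by norm_num) hAtop
  have key : A ^ (1 / 2 : ℝ) * A ^ (1 / 2 : ℝ) ≤ A ^ (1 / 2 : ℝ) * ∫⁻ x, N x ∂m := by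
    rw [← sq, hroot]
    calc A = ∑ i ∈ s, ∫⁻ x, (∫⁻ y, f i y ∂m) * f i x ∂m := by
          refine Finset.sum_congr rfl fun i hi => ?_
          rw [lintegral_const_mul' _ _ (ha i hi), sq]
      _ = ∫⁻ x, ∑ i ∈ s, (∫⁻ y, f i y ∂m) * f i x ∂m :=
          (lintegral_finsetSum' s fun i _ => (hf i).const_mul _).symm
      _ ≤ ∫⁻ x, A ^ (1 / 2 : ℝ) * N x ∂m := by
          refine lintegral_mono fun x => ?_
          have h := ENNReal.inner_le_Lp_mul_Lq s (fun i => ∫⁻ y, f i y ∂m) (fun i => f i x)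
            Real.HolderConjugate.two_two
          simp only [ENNReal.rpow_two] at h
          refine h.trans ?_
          gcongr
          calc (∑ i ∈ s, f i x ^ 2) ^ (1 / 2 : ℝ) ≤ (N x ^ 2) ^ (1 / 2 : ℝ) := by
                gcongr
                exact hN x
            _ = N x := by
              rw [← ENNReal.rpow_natCast, ← ENNReal.rpow_mul]
              norm_num
      _ = _ := lintegral_const_mul' _ _ hrt
  have := (ENNReal.mul_le_mul_iff_right hr0 hrt).1 key
  calc A = (A ^ (1 / 2 : ℝ)) ^ 2 := hroot.symm
    _ ≤ _ := by gcongr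

theorem tsum_lintegral_enorm_sq_le {α : Type*} [MeasurableSpace α] {m : Measure α}
    {G : ι → α → ℂ} (hG : ∀ i, AEStronglyMeasurable (G i) m) :
    ∑' i, (∫⁻ x, ‖G i x‖ₑ ∂m) ^ 2 ≤ (∫⁻ x, ell2Norm (fun i => G i x) ∂m) ^ 2 := by
  rw [ENNReal.tsum_eq_iSup_sum]
  refine iSup_le fun s => sum_lintegral_sq_le (fun i => (hG i).enorm) s fun x => ?_
  rw [ell2Norm_sq]
  exact ENNReal.sum_le_tsum s

end EllTwo

/-! ### Plancherel's inequality for functions supported in `[1, 2]` -/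

theorem lintegral_eq_lintegral_Ioc_tsum_int {H : ℝ → ℝ≥0∞} (hH : Measurable H) :
    ∫⁻ t, H t = ∫⁻ s in Ioc (0 : ℝ) 1, ∑' k : ℤ, H (s + k) := by
  have hm : ∀ k : ℤ, AEMeasurable (fun s : ℝ => H (s + k)) (volume.restrict (Ioc (0 : ℝ) 1)) :=
    fun k => (hH.comp (measurable_id.add_const (k : ℝ))).aemeasurable
  rw [lintegral_tsum hm, ← setLIntegral_univ, ← iUnion_Ioc_intCast ℝ,
    lintegral_iUnion (fun _ => measurableSet_Ioc) (pairwise_disjoint_Ioc_intCast ℝ)]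
  refine tsum_congr fun k => ?_
  rw [← lintegral_indicator measurableSet_Ioc, ← lintegral_indicator measurableSet_Ioc,
    ← lintegral_add_right_eq_self _ (k : ℝ)]
  refine lintegral_congr fun s => ?_
  have : s + (k : ℝ) ∈ Ioc (k : ℝ) (k + 1) ↔ s ∈ Ioc (0 : ℝ) 1 := by
    simp only [mem_Ioc]
    constructor <;> rintro ⟨h1, h2⟩ <;> constructor <;> linarith
  by_cases h : s ∈ Ioc (0 : ℝ) 1
  · rw [indicator_of_mem h, indicator_of_mem (this.2 h)]
  · rw [indicator_of_notMem h, indicator_of_notMem (this.not.2 h)]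

theorem norm_exp_neg_I_mul_mul (t ρ : ℝ) : ‖Complex.exp (-(Complex.I * t * ρ))‖ = 1 := by
  rw [show -(Complex.I * t * ρ) = ((-(t * ρ) : ℝ) : ℂ) * Complex.I by push_cast; ring,
    Complex.norm_exp_ofReal_mul_I]

theorem continuous_integral_exp_mul {m : Measure ℝ} {F : ℝ → ℂ} (hF : Integrable F m) :
    Continuous fun t : ℝ => ∫ ρ, Complex.exp (-(Complex.I * t * ρ)) * F ρ ∂m := by
  refine continuous_of_dominated (bound := fun ρ => ‖F ρ‖) (fun t => ?_) (fun t => ?_) hF.norm ?_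
  · exact (by fun_prop : Continuous fun ρ : ℝ =>
      Complex.exp (-(Complex.I * t * ρ))).aestronglyMeasurable.mul hF.1
  · refine Filter.Eventually.of_forall fun ρ => ?_
    rw [norm_mul, norm_exp_neg_I_mul_mul, one_mul]
  · exact Filter.Eventually.of_forall fun ρ => by fun_prop

theorem tsum_enorm_integral_exp_sq_eq {F : ℝ → ℂ} (hF : MemLp F 2 (volume.restrict (Icc 1 2)))
    (s : ℝ) :
    ∑' k : ℤ, ‖∫ ρ : ℝ in Icc 1 2, Complex.exp (-(Complex.I * (s + k : ℝ) * ρ)) * F ρ‖ₑ ^ 2 =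
      ENNReal.ofReal (2 * Real.pi) * ∫⁻ ρ in Icc 1 2, ‖F ρ‖ₑ ^ 2 := by
  have hπ := Real.pi_gt_three
  have hab : (1 / 2 : ℝ) < 1 / 2 + 2 * Real.pi := by linarith
  have hsub : Icc (1 : ℝ) 2 ⊆ Ioc (1 / 2) (1 / 2 + 2 * Real.pi) := fun x hx =>
    ⟨by linarith [hx.1], by linarith [hx.2]⟩
  set g : ℝ → ℂ := fun ρ => (Icc (1 : ℝ) 2).indicator
    (fun ρ => Complex.exp (-(Complex.I * s * ρ)) * F ρ) ρ with hg
  have hgm : MemLp (fun ρ : ℝ => Complex.exp (-(Complex.I * s * ρ)) * F ρ) 2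
      (volume.restrict (Icc 1 2)) := by
    refine hF.of_le ((by fun_prop : Continuous fun ρ : ℝ =>
      Complex.exp (-(Complex.I * s * ρ))).aestronglyMeasurable.mul hF.1) ?_
    refine Filter.Eventually.of_forall fun ρ => ?_
    rw [norm_mul, norm_exp_neg_I_mul_mul, one_mul]
  have hgL : MemLp g 2 (volume.restrict (Ioc (1 / 2) (1 / 2 + 2 * Real.pi))) := by
    rw [hg, memLp_indicator_iff_restrict measurableSet_Icc,
      Measure.restrict_restrict measurableSet_Icc, inter_eq_left.2 hsub]
    exact hgm
  have hsum := hasSum_sq_fourierCoeffOn hab hgL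
  have hcoef : ∀ k : ℤ, ∫ ρ : ℝ in Icc 1 2, Complex.exp (-(Complex.I * (s + k : ℝ) * ρ)) * F ρ =
      (2 * Real.pi : ℝ) * fourierCoeffOn hab g k := by
    intro k
    have : ∫ x in (1 / 2 : ℝ)..(1 / 2 + 2 * Real.pi),
        (fourier (-k) (x : AddCircle (1 / 2 + 2 * Real.pi - 1 / 2))) • g x =
        ∫ ρ : ℝ in Icc 1 2, Complex.exp (-(Complex.I * (s + k : ℝ) * ρ)) * F ρ := by
      rw [intervalIntegral.integral_of_le hab.le, ← inter_eq_left.2 hsub,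
        ← Measure.restrict_restrict measurableSet_Icc, ← integral_indicator measurableSet_Icc]
      refine integral_congr_ae (Filter.Eventually.of_forall fun x => ?_)
      simp only [hg]
      by_cases hx : x ∈ Icc (1 : ℝ) 2
      · rw [indicator_of_mem hx, indicator_of_mem hx, fourier_coe_apply, smul_eq_mul, ← mul_assoc,
          ← Complex.exp_add]
        congr 2
        have : (Real.pi : ℂ) ≠ 0 := by exact_mod_cast Real.pi_ne_zero
        push_cast
        field_simp
        ring
      · rw [indicator_of_notMem hx, indicator_of_notMem hx, smul_zero]
    rw [fourierCoeffOn_eq_integral, this, add_sub_cancel_left, Complex.real_smul]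
    have : (Real.pi : ℂ) ≠ 0 := by exact_mod_cast Real.pi_ne_zero
    push_cast
    field_simp
  have hnorm : ∫ x in (1 / 2 : ℝ)..(1 / 2 + 2 * Real.pi), ‖g x‖ ^ 2 =
      ∫ ρ in Icc 1 2, ‖F ρ‖ ^ 2 := by
    rw [intervalIntegral.integral_of_le hab.le, ← inter_eq_left.2 hsub,
        ← Measure.restrict_restrict measurableSet_Icc, ← integral_indicator measurableSet_Icc]
    refine integral_congr_ae (Filter.Eventually.of_forall fun x => ?_)
    simp only [hg]
    by_cases hx : x ∈ Icc (1 : ℝ) 2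
    · rw [indicator_of_mem hx, indicator_of_mem hx, norm_mul, norm_exp_neg_I_mul_mul, one_mul]
    · rw [indicator_of_notMem hx, indicator_of_notMem hx]
      simp
  have hFi : Integrable (fun ρ => ‖F ρ‖ ^ 2) (volume.restrict (Icc 1 2)) := hF.integrable_norm_pow two_ne_zero
  have e1 : ∫⁻ ρ in Icc 1 2, ‖F ρ‖ₑ ^ 2 = ENNReal.ofReal (∫ ρ in Icc 1 2, ‖F ρ‖ ^ 2) := by
    rw [ofReal_integral_eq_lintegral_ofReal hFi
      (Filter.Eventually.of_forall fun _ => by positivity)]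
    refine lintegral_congr fun ρ => ?_
    rw [ENNReal.ofReal_pow (norm_nonneg _), ofReal_norm]
  have e2 : ∀ k : ℤ, ‖∫ ρ : ℝ in Icc 1 2, Complex.exp (-(Complex.I * (s + k : ℝ) * ρ)) * F ρ‖ₑ ^ 2 =
      ENNReal.ofReal ((2 * Real.pi) ^ 2 * ‖fourierCoeffOn hab g k‖ ^ 2) := by
    intro k
    rw [hcoef, ← ofReal_norm, ← ENNReal.ofReal_pow (norm_nonneg _), norm_mul, mul_pow,
      Complex.norm_real, Real.norm_of_nonneg (by positivity)]
  simp_rw [e2]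
  rw [← ENNReal.ofReal_tsum_of_nonneg (fun _ => by positivity) (hsum.summable.mul_left _),
    tsum_mul_left, hsum.tsum_eq, hnorm, e1, ← ENNReal.ofReal_mul (by positivity),
    add_sub_cancel_left, smul_eq_mul]
  congr 1
  field_simp

theorem lintegral_enorm_integral_exp_sq_le {F : ℝ → ℂ}
    (hF : AEStronglyMeasurable F (volume.restrict (Icc 1 2))) :
    ∫⁻ t : ℝ, ‖∫ ρ : ℝ in Icc 1 2, Complex.exp (-(Complex.I * t * ρ)) * F ρ‖ₑ ^ 2 ≤
      ENNReal.ofReal (2 * Real.pi) * ∫⁻ ρ in Icc 1 2, ‖F ρ‖ₑ ^ 2 := by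
  by_cases htop : ∫⁻ ρ in Icc 1 2, ‖F ρ‖ₑ ^ 2 = ⊤
  · rw [htop, ENNReal.mul_top (by simp [Real.pi_pos])]
    exact le_top
  have hL : MemLp F 2 (volume.restrict (Icc 1 2)) := by
    refine ⟨hF, ?_⟩
    rw [eLpNorm_lt_top_iff_lintegral_rpow_enorm_lt_top two_ne_zero ENNReal.ofNat_ne_top]
    simpa using lt_top_iff_ne_top.2 htop
  have hc := continuous_integral_exp_mul (hL.integrable (by norm_num))
  rw [lintegral_eq_lintegral_Ioc_tsum_int (hc.measurable.enorm.pow_const 2)]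
  simp_rw [tsum_enorm_integral_exp_sq_eq hL]
  simp

/-! ### Interpolation between `L¹ → L^∞` and `L² → L²` by splitting -/

theorem lintegral_Ioc_rpow_eq {a b : ℝ} (ha : -1 < a) (hb : 0 ≤ b) :
    ∫⁻ t in Ioc 0 b, ENNReal.ofReal (t ^ a) = ENNReal.ofReal (b ^ (a + 1) / (a + 1)) := by
  have hi := intervalIntegral.intervalIntegrable_rpow' (a := 0) (b := b) ha
  rw [← ofReal_integral_eq_lintegral_ofReal
    ((intervalIntegrable_iff_integrableOn_Ioc_of_le hb).1 hi),
    ← intervalIntegral.integral_of_le hb, integral_rpow (Or.inl ha),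
    Real.zero_rpow (by linarith), sub_zero]
  filter_upwards [ae_restrict_mem measurableSet_Ioc] with t ht
  exact Real.rpow_nonneg ht.1.le _

theorem lintegral_gt_le_of_lintegral_rpow {β : Type*} [MeasurableSpace β] {m : Measure β}
    {p : ℝ} (hp : 1 < p) {f : β → ℝ} (hfm : Measurable f) {l Q : ℝ} (hl : 0 < l)
    (hf : ∫⁻ y, ENNReal.ofReal (f y ^ p) ∂m ≤ ENNReal.ofReal Q) :
    ∫⁻ y in {y | l < f y}, ENNReal.ofReal (f y) ∂m ≤ ENNReal.ofReal (l ^ (1 - p) * Q) := by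
  rw [ENNReal.ofReal_mul (by positivity)]
  calc ∫⁻ y in {y | l < f y}, ENNReal.ofReal (f y) ∂m
      ≤ ∫⁻ y in {y | l < f y}, ENNReal.ofReal (l ^ (1 - p)) * ENNReal.ofReal (f y ^ p) ∂m := by
        refine setLIntegral_mono' (measurableSet_lt measurable_const hfm) fun y hy => ?_
        have hy0 : 0 < f y := hl.trans hy
        rw [← ENNReal.ofReal_mul (by positivity)]
        refine ENNReal.ofReal_le_ofReal ?_
        calc f y = f y ^ (1 - p) * f y ^ p := by
              rw [← Real.rpow_add hy0]
              norm_num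
          _ ≤ l ^ (1 - p) * f y ^ p := by
              gcongr ?_ * _
              exact Real.rpow_le_rpow_of_nonpos hl (le_of_lt hy) (by linarith)
    _ = ENNReal.ofReal (l ^ (1 - p)) * ∫⁻ y in {y | l < f y}, ENNReal.ofReal (f y ^ p) ∂m :=
        lintegral_const_mul' _ _ ENNReal.ofReal_ne_top
    _ ≤ ENNReal.ofReal (l ^ (1 - p)) * ENNReal.ofReal Q := by
        gcongr
        exact (setLIntegral_le_lintegral _ _).trans hf

/-- Strong-type interpolation: if for every level `l` the function `F` splits into a part bounded
by `A` times the `L¹` norm of `f` above `l` and a part whose `L²` norm is bounded by `B` times the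
`L²` norm of `f` below `l`, then `‖F‖_q` is controlled by `‖f‖_p` for `1 < p < 2` and
`1/p + 1/q = 1`. -/
theorem lintegral_rpow_le_of_split {α β : Type*} [MeasurableSpace α] [MeasurableSpace β]
    {μ : Measure α} {m : Measure β} [SFinite m] {p q : ℝ} (hq : 2 < q)
    (hpq : p.HolderConjugate q) {A B M : ℝ} (hA : 0 < A) (hM : 0 < M)
    {f : β → ℝ} (hf0 : ∀ y, 0 ≤ f y) (hfm : Measurable f)
    (hfM : ∫⁻ y, ENNReal.ofReal (f y ^ p) ∂m ≤ ENNReal.ofReal (M ^ p))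
    {F : α → ℝ} (hF0 : ∀ x, 0 ≤ F x) (hFm : AEMeasurable F μ)
    (hsplit : ∀ l : ℝ, 0 < l → ∃ Q : α → ℝ≥0∞, AEMeasurable Q μ ∧
      (∀ᵐ x ∂μ, ENNReal.ofReal (F x) ≤
        ENNReal.ofReal A * ∫⁻ y in {y | l < f y}, ENNReal.ofReal (f y) ∂m + Q x) ∧
      ∫⁻ x, Q x ^ 2 ∂μ ≤ ENNReal.ofReal (B ^ 2) *
        ∫⁻ y in {y | f y ≤ l}, ENNReal.ofReal (f y ^ 2) ∂m) :
    ∫⁻ x, ENNReal.ofReal (F x ^ q) ∂μ ≤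
      ENNReal.ofReal (q * 4 * 2 ^ (q - 2) / (q - 2) * (B ^ 2 * A ^ (q - 2)) * M ^ q) := by
  have hp1 : 1 < p := hpq.lt
  have hpq1 : (p - 1) * (q - 1) = 1 := by
    linear_combination hpq.sub_one_mul_conj
  set K := 2 * A * M ^ p with hK
  have hK0 : 0 < K := by positivity
  set lam : ℝ → ℝ := fun t => (K / t) ^ (p - 1)⁻¹ with hlam
  have level : ∀ t : ℝ, 0 < t → μ {x | t < F x} ≤ ENNReal.ofReal (4 / t ^ 2 * B ^ 2) *
      ∫⁻ y, {y | f y ≤ lam t}.indicator (fun y => ENNReal.ofReal (f y ^ 2)) y ∂m := by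
    intro t ht
    have hl : 0 < lam t := by positivity
    obtain ⟨Q, hQm, hQ1, hQ2⟩ := hsplit (lam t) hl
    have hP : ENNReal.ofReal A * ∫⁻ y in {y | lam t < f y}, ENNReal.ofReal (f y) ∂m ≤
        ENNReal.ofReal (t / 2) := by
      refine (mul_le_mul_right (lintegral_gt_le_of_lintegral_rpow hp1 hfm hl hfM) _).trans ?_
      rw [← ENNReal.ofReal_mul hA.le]
      refine ENNReal.ofReal_le_ofReal (le_of_eq ?_)
      rw [hlam]
      simp only
      rw [← Real.rpow_mul (by positivity), show (p - 1)⁻¹ * (1 - p) = -1 by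
        field_simp [show p - 1 ≠ 0 by linarith]
        ring, Real.rpow_neg_one, hK]
      field_simp
    have hsub : ∀ᵐ x ∂μ, x ∈ {x | t < F x} → x ∈ {x | ENNReal.ofReal (t / 2) ≤ Q x} := by
      filter_upwards [hQ1] with x hx htx
      have h1 : ENNReal.ofReal (t / 2) + ENNReal.ofReal (t / 2) ≤ ENNReal.ofReal (t / 2) + Q x := by
        rw [← ENNReal.ofReal_add (by positivity) (by positivity), add_halves]
        exact (ENNReal.ofReal_le_ofReal (le_of_lt htx)).trans (hx.trans (by gcongr))
      exact (ENNReal.add_le_add_iff_left ENNReal.ofReal_ne_top).1 h1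
    have hcheb := mul_meas_ge_le_lintegral₀ (hQm.pow_const 2) (ENNReal.ofReal (t / 2) ^ 2)
    have hset : {x | ENNReal.ofReal (t / 2) ≤ Q x} ⊆ {x | ENNReal.ofReal (t / 2) ^ 2 ≤ Q x ^ 2} :=
      fun x hx => by
        have hx' : ENNReal.ofReal (t / 2) ≤ Q x := hx
        simp only [mem_ofPred_eq]
        gcongr
    rw [lintegral_indicator (measurableSet_le hfm measurable_const)]
    have hfin : ENNReal.ofReal (4 / t ^ 2) * ENNReal.ofReal (t / 2) ^ 2 = 1 := by
      rw [← ENNReal.ofReal_pow (by positivity), ← ENNReal.ofReal_mul (by positivity)]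
      rw [show 4 / t ^ 2 * (t / 2) ^ 2 = 1 by field_simp; norm_num, ENNReal.ofReal_one]
    calc μ {x | t < F x} ≤ μ {x | ENNReal.ofReal (t / 2) ^ 2 ≤ Q x ^ 2} :=
          (measure_mono_ae hsub).trans (measure_mono hset)
      _ = ENNReal.ofReal (4 / t ^ 2) * (ENNReal.ofReal (t / 2) ^ 2 *
          μ {x | ENNReal.ofReal (t / 2) ^ 2 ≤ Q x ^ 2}) := by
          rw [← mul_assoc, hfin, one_mul]
      _ ≤ ENNReal.ofReal (4 / t ^ 2) * (ENNReal.ofReal (B ^ 2) *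
        ∫⁻ y in {y | f y ≤ lam t}, ENNReal.ofReal (f y ^ 2) ∂m) := by
          exact mul_le_mul_right (hcheb.trans hQ2) _
      _ = _ := by rw [← mul_assoc, ← ENNReal.ofReal_mul (by positivity)]
  have hmeas : Measurable (fun z : ℝ × β => ENNReal.ofReal (z.1 ^ (q - 3)) *
      {z : ℝ × β | f z.2 ≤ lam z.1}.indicator (fun z => ENNReal.ofReal (f z.2 ^ 2)) z) := by
    refine Measurable.mul (by fun_prop) (Measurable.indicator (by fun_prop) ?_)
    exact measurableSet_le (by fun_prop) (by fun_prop)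
  have inner : ∀ y, ∫⁻ t in Ioi (0 : ℝ), ENNReal.ofReal (t ^ (q - 3)) *
      {y | f y ≤ lam t}.indicator (fun y => ENNReal.ofReal (f y ^ 2)) y ≤
      ENNReal.ofReal (K ^ (q - 2) / (q - 2)) * ENNReal.ofReal (f y ^ p) := by
    intro y
    rcases (hf0 y).eq_or_lt with h0 | h0
    · have : ∀ t : ℝ, {y | f y ≤ lam t}.indicator (fun y => ENNReal.ofReal (f y ^ 2)) y = 0 := by
        intro t
        rw [indicator_apply_eq_zero]
        intro _
        simp [← h0]
      simp [this]
    · set b := K * f y ^ (-(p - 1)) with hb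
      have hb0 : 0 < b := by positivity
      have hle : ∀ t ∈ Ioi (0 : ℝ), ENNReal.ofReal (t ^ (q - 3)) *
          {y | f y ≤ lam t}.indicator (fun y => ENNReal.ofReal (f y ^ 2)) y ≤
          (Ioc 0 b).indicator (fun t => ENNReal.ofReal (t ^ (q - 3))) t *
            ENNReal.ofReal (f y ^ 2) := by
        intro t ht
        have ht0 : 0 < t := ht
        by_cases hy : f y ≤ lam t
        · have htb : t ≤ b := by
            have h1 : f y ^ (p - 1) ≤ K / t := by
              calc f y ^ (p - 1) ≤ lam t ^ (p - 1) := by gcongr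
                _ = K / t := by
                  rw [hlam]
                  simp only
                  rw [← Real.rpow_mul (by positivity), inv_mul_cancel₀ (by linarith),
                    Real.rpow_one]
            rw [hb, Real.rpow_neg h0.le, ← div_eq_mul_inv, le_div_iff₀ (by positivity)]
            rw [le_div_iff₀ ht0] at h1
            linarith
          rw [indicator_of_mem (show y ∈ {y | f y ≤ lam t} from hy), indicator_of_mem (mem_Ioc.2 ⟨ht0, htb⟩)]
        · rw [indicator_of_notMem (show y ∉ {y | f y ≤ lam t} from hy), mul_zero]
          exact zero_le
      refine (setLIntegral_mono' measurableSet_Ioi hle).trans ?_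
      rw [lintegral_mul_const' _ _ ENNReal.ofReal_ne_top, lintegral_indicator measurableSet_Ioc,
        Measure.restrict_restrict measurableSet_Ioc,
        inter_eq_left.2 Ioc_subset_Ioi_self, lintegral_Ioc_rpow_eq (by linarith) hb0.le,
        ← ENNReal.ofReal_mul (by
          have : 0 < q - 3 + 1 := by linarith
          positivity),
        ← ENNReal.ofReal_mul (by
          have : 0 < q - 2 := by linarith
          positivity)]
      refine ENNReal.ofReal_le_ofReal (le_of_eq ?_)
      rw [show q - 3 + 1 = q - 2 by ring, hb, Real.mul_rpow hK0.le (by positivity),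
        ← Real.rpow_mul h0.le, ← Real.rpow_natCast (f y) 2,
        show -(p - 1) * (q - 2) = p - 2 by linear_combination -hpq1]
      have : f y ^ p = f y ^ (p - 2) * f y ^ ((2 : ℕ) : ℝ) := by
        rw [← Real.rpow_add h0]
        norm_num
      rw [this]
      ring
  have hB4 : 0 ≤ 4 * B ^ 2 := by positivity
  have hq2 : 0 < q - 2 := by linarith
  rw [lintegral_rpow_eq_lintegral_meas_lt_mul μ (Filter.Eventually.of_forall hF0) hFm
    (by linarith)]
  calc ENNReal.ofReal q * ∫⁻ t in Ioi (0 : ℝ), μ {x | t < F x} * ENNReal.ofReal (t ^ (q - 1))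
      ≤ ENNReal.ofReal q * ∫⁻ t in Ioi (0 : ℝ), ENNReal.ofReal (4 * B ^ 2) *
        ∫⁻ y, ENNReal.ofReal (t ^ (q - 3)) *
          {y | f y ≤ lam t}.indicator (fun y => ENNReal.ofReal (f y ^ 2)) y ∂m := by
        gcongr ENNReal.ofReal q * ?_
        refine setLIntegral_mono' measurableSet_Ioi fun t ht => ?_
        have ht0 : 0 < t := ht
        refine (mul_le_mul_left (level t ht) _).trans (le_of_eq ?_)
        rw [lintegral_const_mul' _ _ ENNReal.ofReal_ne_top, mul_right_comm, ← mul_assoc,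
          ← ENNReal.ofReal_mul (by positivity), ← ENNReal.ofReal_mul (by positivity)]
        congr 2
        rw [show q - 1 = q - 3 + (2 : ℕ) by push_cast; ring, Real.rpow_add_natCast ht0.ne']
        field_simp
    _ = ENNReal.ofReal q * (ENNReal.ofReal (4 * B ^ 2) * ∫⁻ y, (∫⁻ t in Ioi (0 : ℝ),
          ENNReal.ofReal (t ^ (q - 3)) *
          {y | f y ≤ lam t}.indicator (fun y => ENNReal.ofReal (f y ^ 2)) y) ∂m) := by
        rw [lintegral_const_mul' _ _ ENNReal.ofReal_ne_top,
          lintegral_lintegral_swap (by exact hmeas.aemeasurable)]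
    _ ≤ ENNReal.ofReal q * (ENNReal.ofReal (4 * B ^ 2) *
          (ENNReal.ofReal (K ^ (q - 2) / (q - 2)) * ENNReal.ofReal (M ^ p))) := by
        gcongr
        refine (lintegral_mono inner).trans ?_
        rw [lintegral_const_mul' _ _ ENNReal.ofReal_ne_top]
        gcongr
    _ = _ := by
        rw [← ENNReal.ofReal_mul (by positivity), ← ENNReal.ofReal_mul hB4,
          ← ENNReal.ofReal_mul (by linarith)]
        congr 1
        rw [hK, Real.mul_rpow (by positivity) (by positivity),
          Real.mul_rpow (by positivity) (by positivity), ← Real.rpow_mul hM.le]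
        have : M ^ q = M ^ (p * (q - 2)) * M ^ p := by
          rw [← Real.rpow_add hM]
          congr 1
          linear_combination -hpq1
        rw [this]
        ring

/-! ### Square functions of oscillatory integrals -/

/-- `∫_1^2 e^{-itρ} k(r, ρ) g(ρ) dρ` at `x = (t, r)`. -/
noncomputable def oscInt (k : ℝ → ℝ → ℝ) (g : ℝ → ℂ) (x : ℝ × ℝ) : ℂ :=
  ∫ ρ : ℝ in Icc 1 2, Complex.exp (-(Complex.I * x.1 * ρ)) * ((k x.2 ρ : ℂ) * g ρ)

/-- Uniform bounds for a family of kernels `k i r ρ`, with `r` distributed according to `σ`. -/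
structure KernelBounds {ι : Type*} (k : ι → ℝ → ℝ → ℝ) (σ : Measure ℝ) (A A₂ B : ℝ) : Prop where
  measurable : ∀ i, Measurable (Function.uncurry (k i))
  abs_le : ∀ᵐ r ∂σ, ∀ i, ∀ ρ ∈ Icc (1 : ℝ) 2, |k i r ρ| ≤ A
  lintegral_right_le : ∀ᵐ r ∂σ, ∀ i,
    ∫⁻ ρ in Icc (1 : ℝ) 2, ENNReal.ofReal (k i r ρ ^ 2) ≤ ENNReal.ofReal (A₂ ^ 2)
  lintegral_left_le : ∀ i, ∀ ρ ∈ Icc (1 : ℝ) 2,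
    ENNReal.ofReal (2 * Real.pi) * ∫⁻ r, ENNReal.ofReal (k i r ρ ^ 2) ∂σ ≤ ENNReal.ofReal (B ^ 2)

theorem oscInt_congr {k : ℝ → ℝ → ℝ} {g h : ℝ → ℂ} (hgh : g =ᵐ[volume.restrict (Icc 1 2)] h)
    (x : ℝ × ℝ) : oscInt k g x = oscInt k h x := by
  refine integral_congr_ae ?_
  filter_upwards [hgh] with ρ hρ
  rw [hρ]

theorem measurable_oscInt {k : ℝ → ℝ → ℝ} (hk : Measurable (Function.uncurry k)) {g : ℝ → ℂ}
    (hg : Measurable g) : Measurable (oscInt k g) := by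
  have hk' : Measurable fun z : (ℝ × ℝ) × ℝ => k z.1.2 z.2 :=
    hk.comp (f := fun z : (ℝ × ℝ) × ℝ => (z.1.2, z.2)) (by fun_prop)
  have h : Measurable fun z : (ℝ × ℝ) × ℝ =>
      Complex.exp (-(Complex.I * z.1.1 * z.2)) * ((k z.1.2 z.2 : ℂ) * g z.2) := by fun_prop
  exact (StronglyMeasurable.integral_prod_right' (ν := volume.restrict (Icc (1 : ℝ) 2))
    h.stronglyMeasurable).measurable

theorem enorm_oscInt_le (k : ℝ → ℝ → ℝ) (g : ℝ → ℂ) (x : ℝ × ℝ) :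
    ‖oscInt k g x‖ₑ ≤ ∫⁻ ρ in Icc (1 : ℝ) 2, ENNReal.ofReal |k x.2 ρ| * ‖g ρ‖ₑ := by
  refine (enorm_integral_le_lintegral_enorm _).trans (le_of_eq (lintegral_congr fun ρ => ?_))
  rw [enorm_mul, enorm_mul, ← ofReal_norm (Complex.exp _), norm_exp_neg_I_mul_mul,
    ENNReal.ofReal_one, one_mul, ← ofReal_norm (k x.2 ρ : ℂ), Complex.norm_real, Real.norm_eq_abs]

theorem oscInt_add {k : ℝ → ℝ → ℝ} (hk : Measurable (Function.uncurry k)) {A : ℝ} {x : ℝ × ℝ}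
    (hA : ∀ ρ ∈ Icc (1 : ℝ) 2, |k x.2 ρ| ≤ A) {g h : ℝ → ℂ}
    (hg : IntegrableOn g (Icc 1 2)) (hh : IntegrableOn h (Icc 1 2)) :
    oscInt k (fun ρ => g ρ + h ρ) x = oscInt k g x + oscInt k h x := by
  have hkm : Measurable (k x.2) := hk.comp (f := fun ρ : ℝ => (x.2, ρ)) (by fun_prop)
  have hm : ∀ g : ℝ → ℂ, IntegrableOn g (Icc 1 2) → IntegrableOn (fun ρ : ℝ =>
      Complex.exp (-(Complex.I * x.1 * ρ)) * ((k x.2 ρ : ℂ) * g ρ)) (Icc 1 2) := by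
    intro g hg
    have h1 : IntegrableOn (fun ρ : ℝ =>
        (Complex.exp (-(Complex.I * x.1 * ρ)) * (k x.2 ρ : ℂ)) * g ρ) (Icc 1 2) := by
      refine Integrable.bdd_mul (c := A) hg ?_ ?_
      · exact (by fun_prop : Measurable fun ρ : ℝ =>
          Complex.exp (-(Complex.I * x.1 * ρ)) * (k x.2 ρ : ℂ)).aestronglyMeasurable
      · filter_upwards [ae_restrict_mem measurableSet_Icc] with ρ hρ
        rw [norm_mul, norm_exp_neg_I_mul_mul, one_mul, Complex.norm_real]
        exact hA ρ hρ
    simpa only [mul_assoc] using h1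
  rw [oscInt, oscInt, oscInt, ← integral_add (hm g hg) (hm h hh)]
  congr 1
  ext ρ
  ring

section SquareFunction

variable {ι : Type*} {k : ι → ℝ → ℝ → ℝ} {σ : Measure ℝ} {A A₂ B : ℝ}

theorem ell2Norm_oscInt_le_lintegral {x : ℝ × ℝ}
    (hA : ∀ i, ∀ ρ ∈ Icc (1 : ℝ) 2, |k i x.2 ρ| ≤ A) {G : ι → ℝ → ℂ}
    (hG : ∀ i, Measurable (G i)) :
    ell2Norm (fun i => oscInt (k i) (G i) x) ≤
      ENNReal.ofReal A * ∫⁻ ρ in Icc (1 : ℝ) 2, ell2Norm fun i => G i ρ := by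
  rw [← lintegral_const_mul' _ _ ENNReal.ofReal_ne_top]
  refine ell2Norm_le_of_finset fun s => ?_
  refine le_trans ?_ (sum_lintegral_sq_le (m := volume.restrict (Icc (1 : ℝ) 2))
    (f := fun i ρ => ENNReal.ofReal A * ‖G i ρ‖ₑ)
    (fun i => ((hG i).enorm.const_mul _).aemeasurable) s fun ρ => ?_)
  · gcongr with i
    refine (enorm_oscInt_le _ _ _).trans ?_
    refine setLIntegral_mono' measurableSet_Icc fun ρ hρ => ?_
    gcongr
    exact hA i ρ hρ
  · simp only [mul_pow, ell2Norm_sq, ← Finset.mul_sum]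
    gcongr
    exact ENNReal.sum_le_tsum s

theorem lintegral_ell2Norm_sq [Countable ι] {G : ι → ℝ → ℂ}
    (hG : ∀ i, Measurable (G i)) (m : Measure ℝ) :
    ∫⁻ ρ, ell2Norm (fun i => G i ρ) ^ 2 ∂m = ∑' i, ∫⁻ ρ, ‖G i ρ‖ₑ ^ 2 ∂m := by
  simp_rw [ell2Norm_sq]
  exact lintegral_tsum fun i => ((hG i).enorm.pow_const 2).aemeasurable

theorem ell2Norm_oscInt_sq_le [Countable ι] (hk : ∀ i, Measurable (Function.uncurry (k i)))
    {x : ℝ × ℝ} (hA : ∀ i, ∫⁻ ρ in Icc (1 : ℝ) 2, ENNReal.ofReal (k i x.2 ρ ^ 2) ≤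
      ENNReal.ofReal (A₂ ^ 2)) {G : ι → ℝ → ℂ} (hG : ∀ i, Measurable (G i)) :
    ell2Norm (fun i => oscInt (k i) (G i) x) ^ 2 ≤
      ENNReal.ofReal (A₂ ^ 2) * ∫⁻ ρ in Icc (1 : ℝ) 2, ell2Norm (fun i => G i ρ) ^ 2 := by
  rw [lintegral_ell2Norm_sq hG, ell2Norm_sq, ← ENNReal.tsum_mul_left]
  refine ENNReal.tsum_le_tsum fun i => ?_
  have hkm : Measurable (k i x.2) := (hk i).comp (f := fun ρ : ℝ => (x.2, ρ)) (by fun_prop)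
  have h := ENNReal.lintegral_mul_le_Lp_mul_Lq (volume.restrict (Icc (1 : ℝ) 2))
    Real.HolderConjugate.two_two (f := fun ρ => ENNReal.ofReal |k i x.2 ρ|)
    (g := fun ρ => ‖G i ρ‖ₑ) (by fun_prop) (hG i).enorm.aemeasurable
  simp only [Pi.mul_apply, ENNReal.rpow_two] at h
  have e : ∀ a : ℝ≥0∞, (a ^ (1 / 2 : ℝ)) ^ 2 = a := fun a => by
    rw [← ENNReal.rpow_natCast, ← ENNReal.rpow_mul]
    norm_num
  calc ‖oscInt (k i) (G i) x‖ₑ ^ 2 ≤ _ :=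
        pow_le_pow_left' ((enorm_oscInt_le _ _ _).trans h) 2
    _ = (∫⁻ ρ in Icc (1 : ℝ) 2, ENNReal.ofReal (k i x.2 ρ ^ 2)) *
          ∫⁻ ρ in Icc (1 : ℝ) 2, ‖G i ρ‖ₑ ^ 2 := by
        rw [mul_pow, e, e]
        simp_rw [← ENNReal.ofReal_pow (abs_nonneg _), sq_abs]
    _ ≤ _ := by
        gcongr
        exact hA i

theorem lintegral_ell2Norm_oscInt_sq_le [Countable ι] [SFinite σ]
    (hk : ∀ i, Measurable (Function.uncurry (k i)))
    (hB : ∀ i, ∀ ρ ∈ Icc (1 : ℝ) 2, ENNReal.ofReal (2 * Real.pi) *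
      ∫⁻ r, ENNReal.ofReal (k i r ρ ^ 2) ∂σ ≤ ENNReal.ofReal (B ^ 2))
    {G : ι → ℝ → ℂ} (hG : ∀ i, Measurable (G i)) :
    ∫⁻ x, ell2Norm (fun i => oscInt (k i) (G i) x) ^ 2 ∂((volume : Measure ℝ).prod σ) ≤
      ENNReal.ofReal (B ^ 2) * ∫⁻ ρ in Icc (1 : ℝ) 2, ell2Norm (fun i => G i ρ) ^ 2 := by
  rw [lintegral_ell2Norm_sq hG, ← ENNReal.tsum_mul_left]
  simp_rw [ell2Norm_sq]
  rw [lintegral_tsum fun i => ((measurable_oscInt (hk i) (hG i)).enorm.pow_const 2).aemeasurable]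
  refine ENNReal.tsum_le_tsum fun i => ?_
  have hki := hk i
  have hGi := hG i
  have hmeas : Measurable (Function.uncurry fun r ρ : ℝ =>
      ENNReal.ofReal (k i r ρ ^ 2) * ‖G i ρ‖ₑ ^ 2) := by
    have : Measurable fun z : ℝ × ℝ => ENNReal.ofReal (Function.uncurry (k i) z ^ 2) *
      ‖G i z.2‖ₑ ^ 2 := by fun_prop
    exact this
  rw [lintegral_prod_symm' _ ((measurable_oscInt hki hGi).enorm.pow_const 2)]
  calc ∫⁻ r, (∫⁻ t, ‖oscInt (k i) (G i) (t, r)‖ₑ ^ 2) ∂σ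
      ≤ ∫⁻ r, ENNReal.ofReal (2 * Real.pi) *
          (∫⁻ ρ in Icc (1 : ℝ) 2, ENNReal.ofReal (k i r ρ ^ 2) * ‖G i ρ‖ₑ ^ 2) ∂σ := by
        refine lintegral_mono fun r => ?_
        have hkm : Measurable (k i r) := hki.comp (f := fun ρ : ℝ => (r, ρ)) (by fun_prop)
        have hm : Measurable fun ρ => (k i r ρ : ℂ) * G i ρ := by fun_prop
        refine (lintegral_enorm_integral_exp_sq_le hm.aestronglyMeasurable).trans
          (le_of_eq ?_)
        congr 1
        refine lintegral_congr fun ρ => ?_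
        rw [enorm_mul, mul_pow, ← ofReal_norm (k i r ρ : ℂ), Complex.norm_real, Real.norm_eq_abs,
          ← ENNReal.ofReal_pow (abs_nonneg _), sq_abs]
    _ = ∫⁻ ρ in Icc (1 : ℝ) 2, (ENNReal.ofReal (2 * Real.pi) *
          ∫⁻ r, ENNReal.ofReal (k i r ρ ^ 2) ∂σ) * ‖G i ρ‖ₑ ^ 2 := by
        rw [lintegral_const_mul' _ _ ENNReal.ofReal_ne_top,
          lintegral_lintegral_swap hmeas.aemeasurable,
          ← lintegral_const_mul' _ _ ENNReal.ofReal_ne_top]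
        refine lintegral_congr fun ρ => ?_
        have hkm : Measurable fun r => k i r ρ := hki.comp (f := fun r : ℝ => (r, ρ)) (by fun_prop)
        rw [lintegral_mul_const _ (by fun_prop), mul_assoc]
    _ ≤ ∫⁻ ρ in Icc (1 : ℝ) 2, ENNReal.ofReal (B ^ 2) * ‖G i ρ‖ₑ ^ 2 := by
        refine setLIntegral_mono' measurableSet_Icc fun ρ hρ => ?_
        gcongr
        exact hB i ρ hρ
    _ = _ := lintegral_const_mul' _ _ ENNReal.ofReal_ne_top

theorem ell2Norm_indicator (s : Set ℝ) (G : ι → ℝ → ℂ) (ρ : ℝ) :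
    ell2Norm (fun i => s.indicator (G i) ρ) = s.indicator (fun ρ => ell2Norm fun i => G i ρ) ρ := by
  by_cases h : ρ ∈ s
  · simp only [indicator_of_mem h]
  · simp only [indicator_of_notMem h, ell2Norm_zero]

theorem lintegral_ne_top_of_eLpNorm_ne_top {N : ℝ → ℝ≥0∞} {m : Measure ℝ} [IsFiniteMeasure m]
    {p : ℝ≥0∞} (hp1 : 1 ≤ p) (hp : p ≠ ⊤) (hN : eLpNorm N p m ≠ ⊤) : ∫⁻ ρ, N ρ ∂m ≠ ⊤ := by
  have hp0 : p ≠ 0 := (one_pos.trans_le hp1).ne'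
  have h1 : 1 ≤ p.toReal := by
    rw [← ENNReal.toReal_one]
    exact ENNReal.toReal_mono hp hp1
  have h := (eLpNorm_lt_top_iff_lintegral_rpow_enorm_lt_top hp0 hp).1 (lt_top_iff_ne_top.2 hN)
  simp only [enorm_eq_self] at h
  have hle : ∫⁻ ρ, N ρ ∂m ≤ ∫⁻ ρ, 1 + N ρ ^ p.toReal ∂m := by
    refine lintegral_mono fun ρ => ?_
    rcases le_total (N ρ) 1 with h' | h'
    · exact h'.trans le_self_add
    · refine le_trans ?_ le_add_self
      calc N ρ = N ρ ^ (1 : ℝ) := (ENNReal.rpow_one _).symm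
        _ ≤ _ := ENNReal.rpow_le_rpow_of_exponent_le h' h1
  rw [lintegral_add_left measurable_const] at hle
  refine (hle.trans_lt (ENNReal.add_lt_top.2 ⟨?_, h⟩)).ne
  simp

/-- The constant in the interpolated bound. -/
noncomputable def interpConst (q : ℝ) : ℝ := (q * 4 * 2 ^ (q - 2) / (q - 2)) ^ q⁻¹

theorem eLpNorm_oscInt_le_of_two_lt [Countable ι] [SFinite σ] (hk : KernelBounds k σ A A₂ B)
    (hA : 0 < A) (hB : 0 < B) {p q : ℝ} (hq : 2 < q) (hpq : p.HolderConjugate q)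
    {G : ι → ℝ → ℂ} (hG : ∀ i, Measurable (G i)) :
    eLpNorm (fun x => ell2Norm fun i => oscInt (k i) (G i) x) (ENNReal.ofReal q)
        ((volume : Measure ℝ).prod σ) ≤
      ENNReal.ofReal (interpConst q) * ENNReal.ofReal (A ^ (1 - 2 * q⁻¹) * B ^ (2 * q⁻¹)) *
        eLpNorm (fun ρ => ell2Norm fun i => G i ρ) (ENNReal.ofReal p)
          (volume.restrict (Icc 1 2)) := by
  have hq2 : 0 < q - 2 := by linarith
  have hq0 : 0 < q := by linarith
  have hp1 : 1 < p := hpq.lt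
  have hp0 : 0 < p := by linarith
  have hI : 0 < interpConst q := by
    rw [interpConst]
    positivity
  have hP0 : ENNReal.ofReal p ≠ 0 := by simpa using hp0
  have hQ0 : ENNReal.ofReal q ≠ 0 := by simpa using hq0
  have habs : ∀ᵐ x ∂((volume : Measure ℝ).prod σ), ∀ i, ∀ ρ ∈ Icc (1 : ℝ) 2, |k i x.2 ρ| ≤ A :=
    Measure.quasiMeasurePreserving_snd.ae hk.abs_le
  set m := (volume : Measure ℝ).restrict (Icc 1 2) with hm
  set N : ℝ → ℝ≥0∞ := fun ρ => ell2Norm fun i => G i ρ with hN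
  set S : ℝ × ℝ → ℝ≥0∞ := fun x => ell2Norm fun i => oscInt (k i) (G i) x with hS
  have hNm : Measurable N := measurable_ell2Norm hG
  have hSm : Measurable S := measurable_ell2Norm fun i => measurable_oscInt (hk.measurable i) (hG i)
  by_cases htop : eLpNorm N (ENNReal.ofReal p) m = ⊤
  · rw [htop, ENNReal.mul_top]
    · exact le_top
    · have : 0 < A ^ (1 - 2 * q⁻¹) * B ^ (2 * q⁻¹) := by positivity
      simpa [hI] using this
  have hN1 : ∫⁻ ρ, N ρ ∂m ≠ ⊤ :=
    lintegral_ne_top_of_eLpNorm_ne_top (by simpa using hp1.le) ENNReal.ofReal_ne_top htop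
  have hSle : ∀ᵐ x ∂((volume : Measure ℝ).prod σ), S x ≤ ENNReal.ofReal A * ∫⁻ ρ, N ρ ∂m := by
    filter_upwards [habs] with x hx using ell2Norm_oscInt_le_lintegral hx hG
  by_cases hzero : eLpNorm N (ENNReal.ofReal p) m = 0
  · have h0 := (eLpNorm_eq_zero_iff hNm.aestronglyMeasurable hP0).1 hzero
    have h1 : ∫⁻ ρ, N ρ ∂m = 0 := (lintegral_eq_zero_iff hNm).2 h0
    have h2 : S =ᵐ[(volume : Measure ℝ).prod σ] 0 := by
      filter_upwards [hSle] with x hx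
      simpa [h1] using hx
    rw [eLpNorm_congr_ae h2]
    simp
  have hNfin : ∀ᵐ ρ ∂m, N ρ = ENNReal.ofReal (N ρ).toReal := by
    filter_upwards [ae_lt_top hNm hN1] with ρ hρ
    rw [ENNReal.ofReal_toReal hρ.ne]
  have hSfin : ∀ᵐ x ∂((volume : Measure ℝ).prod σ), S x = ENNReal.ofReal (S x).toReal := by
    filter_upwards [hSle] with x hx
    rw [ENNReal.ofReal_toReal]
    exact (hx.trans_lt (ENNReal.mul_lt_top ENNReal.ofReal_lt_top (lt_top_iff_ne_top.2 hN1))).ne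
  set M := (eLpNorm N (ENNReal.ofReal p) m).toReal with hMdef
  have hM : 0 < M := ENNReal.toReal_pos hzero htop
  have hMeq : eLpNorm N (ENNReal.ofReal p) m = ENNReal.ofReal M := (ENNReal.ofReal_toReal htop).symm
  have hG1 : ∀ i, Integrable (G i) m := fun i => by
    refine ⟨(hG i).aestronglyMeasurable, ?_⟩
    exact (lintegral_mono fun ρ => enorm_le_ell2Norm (fun i => G i ρ) i).trans_lt
      (lt_top_iff_ne_top.2 hN1)
  have hf : Measurable fun ρ => (N ρ).toReal := hNm.ennreal_toReal
  have key := lintegral_rpow_le_of_split (μ := (volume : Measure ℝ).prod σ) (m := m) hq hpq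
    (A := A) (B := B) (M := M) hA hM (f := fun ρ => (N ρ).toReal)
    (fun _ => ENNReal.toReal_nonneg) hf ?_ (F := fun x => (S x).toReal)
    (fun _ => ENNReal.toReal_nonneg) hSm.ennreal_toReal.aemeasurable ?_
  · have e1 : ∫⁻ x, S x ^ q ∂((volume : Measure ℝ).prod σ) =
        ∫⁻ x, ENNReal.ofReal ((S x).toReal ^ q) ∂((volume : Measure ℝ).prod σ) := by
      refine lintegral_congr_ae ?_
      filter_upwards [hSfin] with x hx
      rw [← ENNReal.ofReal_rpow_of_nonneg ENNReal.toReal_nonneg hq0.le, ← hx]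
    rw [eLpNorm_eq_lintegral_rpow_enorm_toReal hQ0 ENNReal.ofReal_ne_top,
      ENNReal.toReal_ofReal hq0.le, hMeq]
    simp only [enorm_eq_self]
    rw [e1]
    refine (ENNReal.rpow_le_rpow key (by positivity)).trans (le_of_eq ?_)
    rw [ENNReal.ofReal_rpow_of_nonneg (by positivity) (by positivity),
      ← ENNReal.ofReal_mul hI.le, ← ENNReal.ofReal_mul (by positivity)]
    congr 1
    rw [one_div, Real.mul_rpow (by positivity) (by positivity),
      Real.mul_rpow (by positivity) (by positivity), Real.mul_rpow (by positivity) (by positivity),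
      ← Real.rpow_natCast B, ← Real.rpow_mul hB.le, ← Real.rpow_mul hA.le, ← Real.rpow_mul hM.le,
      mul_inv_cancel₀ hq0.ne', Real.rpow_one, interpConst,
      show (q - 2) * q⁻¹ = 1 - 2 * q⁻¹ by field_simp]
    push_cast
    ring
  · have e1 : ∫⁻ ρ, ENNReal.ofReal ((N ρ).toReal ^ p) ∂m = ∫⁻ ρ, N ρ ^ p ∂m := by
      refine lintegral_congr_ae ?_
      filter_upwards [hNfin] with ρ hρ
      rw [← ENNReal.ofReal_rpow_of_nonneg ENNReal.toReal_nonneg hp0.le, ← hρ]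
    have e2 := eLpNorm_eq_lintegral_rpow_enorm_toReal (f := N) (μ := m) hP0 ENNReal.ofReal_ne_top
    rw [ENNReal.toReal_ofReal hp0.le, hMeq] at e2
    simp only [enorm_eq_self] at e2
    rw [e1, ← ENNReal.ofReal_rpow_of_nonneg hM.le hp0.le, e2, ← ENNReal.rpow_mul, one_div,
      inv_mul_cancel₀ hp0.ne', ENNReal.rpow_one]
  · intro l hl
    set big : Set ℝ := {ρ | l < (N ρ).toReal} with hbig
    set small : Set ℝ := {ρ | (N ρ).toReal ≤ l} with hsmall
    have hbm : MeasurableSet big := measurableSet_lt measurable_const hf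
    have hsm : MeasurableSet small := measurableSet_le hf measurable_const
    have hGb : ∀ i, Measurable (big.indicator (G i)) := fun i => (hG i).indicator hbm
    have hGs : ∀ i, Measurable (small.indicator (G i)) := fun i => (hG i).indicator hsm
    refine ⟨fun x => ell2Norm fun i => oscInt (k i) (small.indicator (G i)) x,
      (measurable_ell2Norm fun i => measurable_oscInt (hk.measurable i) (hGs i)).aemeasurable,
      ?_, ?_⟩
    · filter_upwards [habs, hSfin] with x hx hxf
      rw [← hxf]
      have hadd : ∀ i, oscInt (k i) (G i) x = oscInt (k i) (big.indicator (G i)) x +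
          oscInt (k i) (small.indicator (G i)) x := by
        intro i
        rw [← oscInt_add (hk.measurable i) (hx i) ((hG1 i).indicator hbm) ((hG1 i).indicator hsm)]
        refine oscInt_congr (Filter.Eventually.of_forall fun ρ => ?_) x
        by_cases h : ρ ∈ big
        · have h' : ρ ∉ small := fun h2 => not_le.2 (show l < (N ρ).toReal from h) h2
          simp [h, h']
        · have h' : ρ ∈ small := show (N ρ).toReal ≤ l from not_lt.1 fun h2 => h h2
          simp [h, h']
      have hSx : S x = ell2Norm fun i => oscInt (k i) (big.indicator (G i)) x +
          oscInt (k i) (small.indicator (G i)) x := by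
        simp only [hS, hadd]
      rw [hSx]
      refine (ell2Norm_add_le _ _).trans ?_
      gcongr
      refine (ell2Norm_oscInt_le_lintegral hx hGb).trans (mul_le_mul_right ?_ _)
      simp_rw [ell2Norm_indicator]
      rw [lintegral_indicator hbm]
      refine le_of_eq (lintegral_congr_ae (ae_restrict_of_ae ?_))
      exact hNfin
    · refine (lintegral_ell2Norm_oscInt_sq_le hk.measurable hk.lintegral_left_le hGs).trans
        (mul_le_mul_right ?_ _)
      simp_rw [ell2Norm_indicator]
      rw [← lintegral_indicator hsm]
      refine lintegral_mono_ae ?_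
      filter_upwards [hNfin] with ρ hρ
      by_cases h : ρ ∈ small
      · rw [indicator_of_mem h, indicator_of_mem h, ENNReal.ofReal_pow ENNReal.toReal_nonneg, ← hρ]
      · rw [indicator_of_notMem h, indicator_of_notMem h]
        simp

end SquareFunction

section SquareFunctionBounds

variable {ι : Type*} {k : ι → ℝ → ℝ → ℝ} {σ : Measure ℝ} {A A₂ B : ℝ}

theorem eLpNorm_two_sq (N : ℝ → ℝ≥0∞) (m : Measure ℝ) :
    eLpNorm N 2 m ^ 2 = ∫⁻ ρ, N ρ ^ 2 ∂m := by
  rw [eLpNorm_eq_lintegral_rpow_enorm_toReal two_ne_zero ENNReal.ofNat_ne_top,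
    ← ENNReal.rpow_natCast, ← ENNReal.rpow_mul]
  norm_num

theorem ae_ell2Norm_oscInt_le_eLpNorm_two [Countable ι] [SFinite σ]
    (hk : KernelBounds k σ A A₂ B) (hA₂ : 0 < A₂) {G : ι → ℝ → ℂ} (hG : ∀ i, Measurable (G i)) :
    ∀ᵐ x ∂((volume : Measure ℝ).prod σ), ell2Norm (fun i => oscInt (k i) (G i) x) ≤
      ENNReal.ofReal A₂ *
        eLpNorm (fun ρ => ell2Norm fun i => G i ρ) 2 (volume.restrict (Icc 1 2)) := by
  have h := Measure.quasiMeasurePreserving_snd (μ := (volume : Measure ℝ)) (ν := σ) |>.ae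
    hk.lintegral_right_le
  filter_upwards [h] with x hx
  refine (ENNReal.pow_le_pow_left_iff two_ne_zero).1 ?_
  rw [mul_pow, eLpNorm_two_sq, ← ENNReal.ofReal_pow hA₂.le]
  exact ell2Norm_oscInt_sq_le hk.measurable hx hG

theorem eLpNorm_oscInt_le_eLpNorm_two [Countable ι] [SFinite σ]
    (hk : KernelBounds k σ A A₂ B) (hA₂ : 0 < A₂) (hB : 0 < B) {q : ℝ≥0∞} (hq : 2 ≤ q)
    {G : ι → ℝ → ℂ} (hG : ∀ i, Measurable (G i)) :
    eLpNorm (fun x => ell2Norm fun i => oscInt (k i) (G i) x) q ((volume : Measure ℝ).prod σ) ≤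
      ENNReal.ofReal (A₂ ^ (1 - 2 * (q⁻¹).toReal) * B ^ (2 * (q⁻¹).toReal)) *
        eLpNorm (fun ρ => ell2Norm fun i => G i ρ) 2 (volume.restrict (Icc 1 2)) := by
  have hae := ae_ell2Norm_oscInt_le_eLpNorm_two hk hA₂ hG
  have hL2 := lintegral_ell2Norm_oscInt_sq_le hk.measurable hk.lintegral_left_le hG
  rw [← eLpNorm_two_sq] at hL2
  set M := eLpNorm (fun ρ => ell2Norm fun i => G i ρ) 2 (volume.restrict (Icc (1 : ℝ) 2))
  set S : ℝ × ℝ → ℝ≥0∞ := fun x => ell2Norm fun i => oscInt (k i) (G i) x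
  by_cases htop : q = ⊤
  · subst htop
    simp only [ENNReal.inv_top, ENNReal.toReal_zero, mul_zero, sub_zero, Real.rpow_one,
      Real.rpow_zero, mul_one, eLpNorm_exponent_top]
    exact eLpNormEssSup_le_of_ae_enorm_bound hae
  have hq0 : q ≠ 0 := (two_pos.trans_le hq).ne'
  set r := q.toReal with hr
  have hr2 : 2 ≤ r := ENNReal.toReal_mono htop hq
  have hr0 : 0 < r := by linarith
  rw [ENNReal.toReal_inv, ← hr, eLpNorm_eq_lintegral_rpow_enorm_toReal hq0 htop, ← hr]
  simp only [enorm_eq_self]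
  have hpow : ∀ a : ℝ≥0∞, a ^ r = a ^ (r - 2) * a ^ 2 := fun a => by
    rw [← ENNReal.rpow_natCast, ← ENNReal.rpow_add_of_nonneg _ _ (by linarith) (by norm_num)]
    norm_num
  have hint : ∫⁻ x, S x ^ r ∂((volume : Measure ℝ).prod σ) ≤
      (ENNReal.ofReal A₂ * M) ^ (r - 2) * (ENNReal.ofReal (B ^ 2) * M ^ 2) := by
    calc ∫⁻ x, S x ^ r ∂((volume : Measure ℝ).prod σ)
        ≤ ∫⁻ x, (ENNReal.ofReal A₂ * M) ^ (r - 2) * S x ^ 2 ∂((volume : Measure ℝ).prod σ) := by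
          refine lintegral_mono_ae ?_
          filter_upwards [hae] with x hx
          rw [hpow]
          exact mul_le_mul_left (ENNReal.rpow_le_rpow hx (by linarith)) _
      _ = (ENNReal.ofReal A₂ * M) ^ (r - 2) * ∫⁻ x, S x ^ 2 ∂((volume : Measure ℝ).prod σ) := by
          refine lintegral_const_mul _ (Measurable.pow_const ?_ _)
          exact measurable_ell2Norm fun i => measurable_oscInt (hk.measurable i) (hG i)
      _ ≤ _ := mul_le_mul_right hL2 _
  refine (ENNReal.rpow_le_rpow hint (by positivity)).trans (le_of_eq ?_)
  have e : (ENNReal.ofReal A₂ * M) ^ (r - 2) * (ENNReal.ofReal (B ^ 2) * M ^ 2) =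
      ENNReal.ofReal (A₂ ^ (r - 2) * B ^ 2) * M ^ r := by
    rw [ENNReal.mul_rpow_of_nonneg _ _ (by linarith), hpow M,
      ENNReal.ofReal_rpow_of_pos hA₂, ENNReal.ofReal_mul (by positivity)]
    ring
  rw [e, ENNReal.mul_rpow_of_nonneg _ _ (by positivity), ← ENNReal.rpow_mul, one_div,
    mul_inv_cancel₀ hr0.ne', ENNReal.rpow_one, ENNReal.ofReal_rpow_of_pos (by positivity),
    Real.mul_rpow (by positivity) (by positivity), ← Real.rpow_mul hA₂.le, ← Real.rpow_natCast B,
    ← Real.rpow_mul hB.le, show (r - 2) * r⁻¹ = 1 - 2 * r⁻¹ by field_simp]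
  norm_num

theorem eLpNorm_oscInt_le_eLpNorm_dual [Countable ι] [SFinite σ]
    (hk : KernelBounds k σ A A₂ B) (hA : 0 < A) (hA₂ : 0 < A₂) (hB : 0 < B) {q q' : ℝ≥0∞}
    (hq : 2 ≤ q) (hqq' : q⁻¹ + q'⁻¹ = 1) {G : ι → ℝ → ℂ} (hG : ∀ i, Measurable (G i)) :
    eLpNorm (fun x => ell2Norm fun i => oscInt (k i) (G i) x) q ((volume : Measure ℝ).prod σ) ≤
      ENNReal.ofReal (1 + |interpConst q.toReal|) *
      ENNReal.ofReal (A ^ (1 - 2 * (q⁻¹).toReal) * B ^ (2 * (q⁻¹).toReal)) *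
        eLpNorm (fun ρ => ell2Norm fun i => G i ρ) q' (volume.restrict (Icc 1 2)) := by
  have h1 : 1 ≤ ENNReal.ofReal (1 + |interpConst q.toReal|) := by
    rw [ENNReal.one_le_ofReal]
    linarith [abs_nonneg (interpConst q.toReal)]
  have hle : ∀ a b : ℝ≥0∞, a * b ≤ ENNReal.ofReal (1 + |interpConst q.toReal|) * a * b :=
    fun a b => mul_le_mul_left (le_mul_of_one_le_left' h1) b
  by_cases htop : q = ⊤
  · subst htop
    have hq' : q' = 1 := by simpa using hqq'
    subst hq'
    refine le_trans ?_ (hle _ _)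
    simp only [ENNReal.inv_top, ENNReal.toReal_zero, mul_zero, sub_zero, Real.rpow_one,
      Real.rpow_zero, mul_one, eLpNorm_exponent_top]
    refine eLpNormEssSup_le_of_ae_enorm_bound ?_
    have habs : ∀ᵐ x ∂((volume : Measure ℝ).prod σ), ∀ i, ∀ ρ ∈ Icc (1 : ℝ) 2, |k i x.2 ρ| ≤ A :=
      Measure.quasiMeasurePreserving_snd.ae hk.abs_le
    filter_upwards [habs] with x hx
    rw [eLpNorm_one_eq_lintegral_enorm]
    exact ell2Norm_oscInt_le_lintegral hx hG
  rcases hq.eq_or_lt with h2 | h2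
  · subst h2
    have hq' : q' = 2 := by
      have h3 : (2 : ℝ≥0∞)⁻¹ + q'⁻¹ = 2⁻¹ + 2⁻¹ := by rw [hqq', ENNReal.inv_two_add_inv_two]
      exact inv_injective ((ENNReal.add_right_inj (by simp)).1 h3)
    subst hq'
    refine le_trans ?_ (hle _ _)
    have := eLpNorm_oscInt_le_eLpNorm_two hk hA₂ hB le_rfl hG
    simpa using this
  · have hr : 2 < q.toReal := by
      have := (ENNReal.toReal_lt_toReal ENNReal.ofNat_ne_top htop).2 h2
      simpa using this
    have hpq : (Real.conjExponent q.toReal).HolderConjugate q.toReal :=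
      (Real.HolderConjugate.conjExponent (by linarith)).symm
    have hqr : ENNReal.ofReal q.toReal = q := ENNReal.ofReal_toReal htop
    have hq' : q' = ENNReal.ofReal (Real.conjExponent q.toReal) := by
      have h3 := hpq.symm.inv_add_inv_ennreal
      rw [hqr, ← hqq'] at h3
      refine inv_injective ((ENNReal.add_right_inj ?_).1 h3.symm)
      exact ENNReal.inv_ne_top.2 (two_pos.trans_le hq).ne'
    have := eLpNorm_oscInt_le_of_two_lt hk hA hB hr hpq hG
    rw [hqr, ← hq'] at this
    rw [ENNReal.toReal_inv]
    refine this.trans ?_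
    gcongr
    exact (le_abs_self _).trans (by linarith)

theorem exists_countable_ell2Norm_oscInt_eq {G : ι → ℝ → ℂ}
    (hG : ∀ i, AEStronglyMeasurable (G i) (volume.restrict (Icc 1 2)))
    (hN : ∫⁻ ρ in Icc (1 : ℝ) 2, ell2Norm (fun i => G i ρ) ≠ ⊤) (k : ι → ℝ → ℝ → ℝ) :
    ∃ s : Set ι, s.Countable ∧ ∀ x, ell2Norm (fun i => oscInt (k i) (G i) x) =
      ell2Norm fun i : s => oscInt (k i) (G i) x := by
  have hsum : ∑' i, (∫⁻ ρ in Icc (1 : ℝ) 2, ‖G i ρ‖ₑ) ^ 2 ≠ ⊤ :=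
    ((tsum_lintegral_enorm_sq_le hG).trans_lt
      (ENNReal.pow_lt_top (lt_top_iff_ne_top.2 hN))).ne
  refine ⟨_, Summable.countable_support_ennreal hsum, fun x => ?_⟩
  rw [ell2Norm, ell2Norm]
  congr 1
  refine (tsum_subtype_eq_of_support_subset (f := fun i => ‖oscInt (k i) (G i) x‖ₑ ^ 2) ?_).symm
  intro i hi
  contrapose! hi
  simp only [Function.mem_support, ne_eq, not_not, pow_eq_zero_iff two_ne_zero] at hi ⊢
  rw [lintegral_eq_zero_iff' (hG i).enorm] at hi
  have : G i =ᵐ[volume.restrict (Icc 1 2)] fun _ => 0 := by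
    filter_upwards [hi] with ρ hρ
    simpa using hρ
  rw [oscInt_congr this]
  simp [oscInt]

theorem eLpNorm_oscInt_le_of_countable_case {p q : ℝ≥0∞} (hp1 : 1 ≤ p) (hp : p ≠ ⊤)
    {c : ℝ≥0∞} (hc : c ≠ 0)
    (hcount : ∀ s : Set ι, s.Countable → ∀ G : s → ℝ → ℂ, (∀ i, Measurable (G i)) →
      eLpNorm (fun x => ell2Norm fun i : s => oscInt (k i) (G i) x) q
        ((volume : Measure ℝ).prod σ) ≤
      c * eLpNorm (fun ρ => ell2Norm fun i => G i ρ) p (volume.restrict (Icc 1 2)))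
    {G : ι → ℝ → ℂ} (hG : ∀ i, AEStronglyMeasurable (G i) (volume.restrict (Icc 1 2))) :
    eLpNorm (fun x => ell2Norm fun i => oscInt (k i) (G i) x) q ((volume : Measure ℝ).prod σ) ≤
      c * eLpNorm (fun ρ => ell2Norm fun i => G i ρ) p (volume.restrict (Icc 1 2)) := by
  by_cases htop : eLpNorm (fun ρ => ell2Norm fun i => G i ρ) p (volume.restrict (Icc 1 2)) = ⊤
  · rw [htop, ENNReal.mul_top hc]
    exact le_top
  obtain ⟨s, hs, heq⟩ := exists_countable_ell2Norm_oscInt_eq hG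
    (lintegral_ne_top_of_eLpNorm_ne_top hp1 hp htop) k
  have : Countable s := hs.to_subtype
  simp_rw [heq]
  have hmk : ∀ x, ell2Norm (fun i : s => oscInt (k i) (G i) x) =
      ell2Norm fun i : s => oscInt (k i) ((hG i).mk (G i)) x := by
    intro x
    simp_rw [oscInt_congr (hG _).ae_eq_mk]
  simp_rw [hmk]
  refine (hcount s hs _ fun i => (hG i).stronglyMeasurable_mk.measurable).trans ?_
  gcongr c * ?_
  refine eLpNorm_mono_enorm_ae ?_
  have hae : ∀ᵐ ρ ∂((volume : Measure ℝ).restrict (Icc 1 2)), ∀ i : s,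
      G i ρ = (hG i).mk (G i) ρ := ae_all_iff.2 fun i => (hG i).ae_eq_mk
  filter_upwards [hae] with ρ hρ
  simp only [enorm_eq_self, ← hρ]
  rw [ell2Norm, ell2Norm]
  gcongr
  exact ENNReal.tsum_comp_le_tsum_of_injective Subtype.val_injective fun i => ‖G i ρ‖ₑ ^ 2

end SquareFunctionBounds

/-! ### The kernels of the localized Hankel wave -/

theorem KernelBounds.comp {ι κ : Type*} {k : ι → ℝ → ℝ → ℝ} {σ : Measure ℝ} {A A₂ B : ℝ}
    (hk : KernelBounds k σ A A₂ B) (e : κ → ι) : KernelBounds (fun j => k (e j)) σ A A₂ B where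
  measurable j := hk.measurable (e j)
  abs_le := hk.abs_le.mono fun _ h j => h (e j)
  lintegral_right_le := hk.lintegral_right_le.mono fun _ h j => h (e j)
  lintegral_left_le j := hk.lintegral_left_le (e j)

theorem eLpNorm_oscInt_le {ι : Type*} {k : ι → ℝ → ℝ → ℝ} {σ : Measure ℝ} [SFinite σ]
    {A A₂ B : ℝ} (hk : KernelBounds k σ A A₂ B) (hA : 0 < A) (hA₂ : 0 < A₂) (hB : 0 < B)
    {q q' : ℝ≥0∞} (hq : 2 ≤ q) (hqq' : q⁻¹ + q'⁻¹ = 1) {G : ι → ℝ → ℂ}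
    (hG : ∀ i, AEStronglyMeasurable (G i) (volume.restrict (Icc 1 2))) :
    eLpNorm (fun x => ell2Norm fun i => oscInt (k i) (G i) x) q ((volume : Measure ℝ).prod σ) ≤
      ENNReal.ofReal (1 + |interpConst q.toReal|) *
      ENNReal.ofReal (A ^ (1 - 2 * (q⁻¹).toReal) * B ^ (2 * (q⁻¹).toReal)) *
        eLpNorm (fun ρ => ell2Norm fun i => G i ρ) q' (volume.restrict (Icc 1 2)) ∧
    eLpNorm (fun x => ell2Norm fun i => oscInt (k i) (G i) x) q ((volume : Measure ℝ).prod σ) ≤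
      ENNReal.ofReal (1 + |interpConst q.toReal|) *
      ENNReal.ofReal (A₂ ^ (1 - 2 * (q⁻¹).toReal) * B ^ (2 * (q⁻¹).toReal)) *
        eLpNorm (fun ρ => ell2Norm fun i => G i ρ) 2 (volume.restrict (Icc 1 2)) := by
  have hI : 0 < 1 + |interpConst q.toReal| := by positivity
  have hne : ∀ a : ℝ, 0 < a → ENNReal.ofReal (1 + |interpConst q.toReal|) *
      ENNReal.ofReal (a ^ (1 - 2 * (q⁻¹).toReal) * B ^ (2 * (q⁻¹).toReal)) ≠ 0 := by
    intro a ha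
    have : 0 < a ^ (1 - 2 * (q⁻¹).toReal) * B ^ (2 * (q⁻¹).toReal) := by positivity
    exact mul_ne_zero (by simpa using hI) (by simpa using this)
  have hq'1 : 1 ≤ q' := by
    rw [← ENNReal.inv_le_one, ← hqq']
    exact le_add_self
  have hq't : q' ≠ ⊤ := by
    rintro rfl
    rw [ENNReal.inv_top, add_zero] at hqq'
    have : q = 1 := by simpa using congrArg (·⁻¹) hqq'
    rw [this] at hq
    norm_num at hq
  constructor
  · refine eLpNorm_oscInt_le_of_countable_case hq'1 hq't (hne A hA) (fun s hs G hG => ?_) hG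
    have : Countable s := hs.to_subtype
    exact eLpNorm_oscInt_le_eLpNorm_dual (hk.comp (Subtype.val : s → ι)) hA hA₂ hB hq hqq' hG
  · refine eLpNorm_oscInt_le_of_countable_case (by norm_num) (by simp) (hne A₂ hA₂)
      (fun s hs G hG => ?_) hG
    have : Countable s := hs.to_subtype
    refine (eLpNorm_oscInt_le_eLpNorm_two (hk.comp (Subtype.val : s → ι)) hA₂ hB hq hG).trans ?_
    rw [mul_assoc]
    refine le_mul_of_one_le_left' ?_
    rw [ENNReal.one_le_ofReal]
    linarith [abs_nonneg (interpConst q.toReal)]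

/-- The kernel `r^{-(n-2)/2} J_ν(rρ) ρ^{(n-2)/2}`. -/
noncomputable def hankelKernel (n : ℕ) (ν r ρ : ℝ) : ℝ :=
  r ^ (-(((n : ℝ) - 2) / 2)) * realBessel ν (r * ρ) * ρ ^ (((n : ℝ) - 2) / 2)

/-- The measure `r^{n-1} dr` on `[R/2, R]`. -/
noncomputable def radialMeasure (n : ℕ) (R : ℝ) : Measure ℝ :=
  (volume.restrict (Icc (R / 2) R)).withDensity fun r => ENNReal.ofReal (r ^ (n - 1))

instance (n : ℕ) (R : ℝ) : SFinite (radialMeasure n R) := by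
  unfold radialMeasure
  infer_instance

theorem hankelWave_eq_oscInt {n : ℕ} {ν : ℝ} (hν : 0 < ν) {φ : ℝ → ℂ}
    (hφ : tsupport φ ⊆ Icc 1 2) (b : ℝ → ℂ) (x : ℝ × ℝ) :
    hankelWave n ν φ b x.1 x.2 = oscInt (hankelKernel n ν) (fun ρ => b ρ * φ ρ) x := by
  rw [hankelWave, oscInt, ← setIntegral_eq_of_subset_of_forall_sdiff_eq_zero measurableSet_Ioi
    (s := Icc (1 : ℝ) 2) (fun ρ hρ => lt_of_lt_of_le one_pos hρ.1)]
  · refine integral_congr_ae (Filter.Eventually.of_forall fun ρ => ?_)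
    simp only [hankelKernel, besselJ_eq_realBessel (show -(1 / 2) < ν by linarith)]
    push_cast
    ring
  · intro ρ hρ
    have : φ ρ = 0 := image_eq_zero_of_notMem_tsupport fun h => hρ.2 (hφ h)
    simp [this]

theorem measurable_hankelKernel (n : ℕ) {ν : ℝ} (hν : 0 < ν) :
    Measurable (Function.uncurry (hankelKernel n ν)) := by
  have h := measurable_realBessel (ν := ν) (by linarith)
  have : Measurable fun z : ℝ × ℝ => z.1 ^ (-(((n : ℝ) - 2) / 2)) * realBessel ν (z.1 * z.2) *
    z.2 ^ (((n : ℝ) - 2) / 2) := by fun_prop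
  exact this

theorem abs_hankelKernel_le {n : ℕ} (hn : 2 ≤ n) {R : ℝ} (hR : 0 < R) (ν : ℝ) {r ρ : ℝ}
    (hr : r ∈ Icc (R / 2) R) (hρ : ρ ∈ Icc (1 : ℝ) 2) :
    |hankelKernel n ν r ρ| ≤
      4 ^ (((n : ℝ) - 2) / 2) * R ^ (-(((n : ℝ) - 2) / 2)) * |realBessel ν (r * ρ)| := by
  have hn' : (2 : ℝ) ≤ n := by exact_mod_cast hn
  set a := ((n : ℝ) - 2) / 2 with ha
  have ha0 : 0 ≤ a := by rw [ha]; linarith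
  have hr0 : 0 < r := by linarith [hr.1]
  have hρ0 : 0 < ρ := by linarith [hρ.1]
  have h1 : r ^ (-a) ≤ 2 ^ a * R ^ (-a) := by
    calc r ^ (-a) ≤ (R / 2) ^ (-a) := Real.rpow_le_rpow_of_nonpos (by positivity) hr.1 (by linarith)
      _ = 2 ^ a * R ^ (-a) := by
        rw [Real.div_rpow hR.le two_pos.le, Real.rpow_neg two_pos.le, div_inv_eq_mul, mul_comm]
  have h2 : ρ ^ a ≤ 2 ^ a := Real.rpow_le_rpow hρ0.le hρ.2 ha0
  have h4 : (4 : ℝ) ^ a = 2 ^ a * 2 ^ a := by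
    rw [← Real.mul_rpow two_pos.le two_pos.le]
    norm_num
  rw [hankelKernel, abs_mul, abs_mul, abs_of_nonneg (by positivity : 0 ≤ r ^ (-a)),
    abs_of_nonneg (by positivity : 0 ≤ ρ ^ a), h4]
  calc r ^ (-a) * |realBessel ν (r * ρ)| * ρ ^ a
      ≤ (2 ^ a * R ^ (-a)) * |realBessel ν (r * ρ)| * 2 ^ a := by gcongr
    _ = _ := by ring

theorem ae_radialMeasure {n : ℕ} {R : ℝ} {P : ℝ → Prop} (h : ∀ r ∈ Icc (R / 2) R, P r) :
    ∀ᵐ r ∂(radialMeasure n R), P r := by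
  refine (withDensity_absolutelyContinuous _ _).ae_le ?_
  filter_upwards [ae_restrict_mem measurableSet_Icc] with r hr using h r hr

theorem lintegral_radialMeasure_le {n : ℕ} {R : ℝ} (hR : 0 < R) {f : ℝ → ℝ≥0∞}
    (hf : Measurable f) : ∫⁻ r, f r ∂(radialMeasure n R) ≤
      ENNReal.ofReal (R ^ (n - 1)) * ∫⁻ r in Icc (R / 2) R, f r := by
  rw [radialMeasure, lintegral_withDensity_eq_lintegral_mul _ (by fun_prop) hf,
    ← lintegral_const_mul' _ _ ENNReal.ofReal_ne_top]
  refine setLIntegral_mono' measurableSet_Icc fun r hr => ?_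
  simp only [Pi.mul_apply]
  have : 0 ≤ r := by linarith [hr.1]
  gcongr
  exact hr.2

theorem exists_kernelBounds_small {n : ℕ} (hn : 2 ≤ n) {ν₀ : ℝ} (h₀ : 0 < ν₀) :
    ∃ c : ℝ, 0 < c ∧ ∀ {ι : Type} (ν : ι → ℝ), (∀ i, ν₀ ≤ ν i) → ∀ R : ℝ, 0 < R → R ≤ 1 →
      KernelBounds (fun i => hankelKernel n (ν i)) (radialMeasure n R)
        (c * R ^ (ν₀ - ((n : ℝ) - 2) / 2)) (c * R ^ (ν₀ - ((n : ℝ) - 2) / 2))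
        (√(2 * Real.pi) * c * R ^ (ν₀ - ((n : ℝ) - 2) / 2 + n / 2)) := by
  obtain ⟨C, hC, hb⟩ := exists_abs_realBessel_le_rpow h₀
  set a := ((n : ℝ) - 2) / 2 with ha
  refine ⟨4 ^ a * C, by positivity, fun {ι} ν hν R hR hR1 => ?_⟩
  have hbd : ∀ i, ∀ r ∈ Icc (R / 2) R, ∀ ρ ∈ Icc (1 : ℝ) 2,
      |hankelKernel n (ν i) r ρ| ≤ 4 ^ a * C * R ^ (ν₀ - a) := by
    intro i r hr ρ hρ
    have hr0 : 0 < r := by linarith [hr.1]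
    have hρ0 : 0 < ρ := by linarith [hρ.1]
    have hx : r * ρ / 2 ≤ R := by nlinarith [hr.2, hρ.2]
    have hJ : |realBessel (ν i) (r * ρ)| ≤ C * R ^ ν₀ := by
      refine (hb (ν i) (r * ρ) (hν i) (by positivity)).trans ?_
      gcongr
      calc (r * ρ / 2) ^ ν i ≤ R ^ ν i :=
            Real.rpow_le_rpow (by positivity) hx (h₀.le.trans (hν i))
        _ ≤ R ^ ν₀ := Real.rpow_le_rpow_of_exponent_ge hR hR1 (hν i)
    refine (abs_hankelKernel_le hn hR (ν i) hr hρ).trans ?_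
    rw [← ha, sub_eq_add_neg, Real.rpow_add hR]
    calc 4 ^ a * R ^ (-a) * |realBessel (ν i) (r * ρ)| ≤ 4 ^ a * R ^ (-a) * (C * R ^ ν₀) := by
          gcongr
      _ = _ := by ring
  have hsq : ∀ i, ∀ r ∈ Icc (R / 2) R, ∀ ρ ∈ Icc (1 : ℝ) 2,
      ENNReal.ofReal (hankelKernel n (ν i) r ρ ^ 2) ≤
        ENNReal.ofReal ((4 ^ a * C * R ^ (ν₀ - a)) ^ 2) := by
    intro i r hr ρ hρ
    refine ENNReal.ofReal_le_ofReal ?_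
    rw [← sq_abs]
    gcongr
    exact hbd i r hr ρ hρ
  refine ⟨fun i => measurable_hankelKernel n (h₀.trans_le (hν i)),
    ae_radialMeasure fun r hr i ρ hρ => hbd i r hr ρ hρ, ae_radialMeasure fun r hr i => ?_,
    fun i ρ hρ => ?_⟩
  · refine (setLIntegral_mono' measurableSet_Icc fun ρ hρ => hsq i r hr ρ hρ).trans ?_
    rw [setLIntegral_const, Real.volume_Icc]
    norm_num
  · have hkm : Measurable fun r => hankelKernel n (ν i) r ρ :=
      (measurable_hankelKernel n (h₀.trans_le (hν i))).comp (f := fun r : ℝ => (r, ρ)) (by fun_prop)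
    have h1 := lintegral_radialMeasure_le (n := n) hR
      (f := fun r => ENNReal.ofReal (hankelKernel n (ν i) r ρ ^ 2)) (by fun_prop)
    have h2 : ∫⁻ r in Icc (R / 2) R, ENNReal.ofReal (hankelKernel n (ν i) r ρ ^ 2) ≤
        ENNReal.ofReal ((4 ^ a * C * R ^ (ν₀ - a)) ^ 2 * R) := by
      refine (setLIntegral_mono' measurableSet_Icc fun r hr => hsq i r hr ρ hρ).trans ?_
      rw [setLIntegral_const, Real.volume_Icc, ← ENNReal.ofReal_mul (by positivity)]
      refine ENNReal.ofReal_le_ofReal ?_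
      gcongr
      linarith
    calc _ ≤ ENNReal.ofReal (2 * Real.pi) * (ENNReal.ofReal (R ^ (n - 1)) *
          ENNReal.ofReal ((4 ^ a * C * R ^ (ν₀ - a)) ^ 2 * R)) :=
          mul_le_mul_right (h1.trans (mul_le_mul_right h2 _)) _
      _ = _ := by
        rw [← ENNReal.ofReal_mul (by positivity), ← ENNReal.ofReal_mul (by positivity)]
        congr 1
        rw [Real.rpow_add hR]
        simp only [mul_pow]
        rw [Real.sq_sqrt (by positivity),
          ← Real.rpow_natCast (R ^ ((n : ℝ) / 2)), ← Real.rpow_mul hR.le]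
        have : R ^ ((n : ℝ) / 2 * (2 : ℕ)) = R ^ (n - 1) * R := by
          rw [← pow_succ, Nat.sub_add_cancel (by omega), ← Real.rpow_natCast]
          congr 1
          push_cast
          ring
        rw [this]
        ring

theorem lintegral_realBessel_comp_mul_sq_le {C ν₀ : ℝ} (h₀ : 0 < ν₀)
    (hC : ∀ ν X : ℝ, ν₀ ≤ ν → 1 / 2 ≤ X → ∫ x in X..(2 * X), realBessel ν x ^ 2 ≤ C)
    {ν c X : ℝ} (hν : ν₀ ≤ ν) (hc : 0 < c) (hX : 0 < X) (hcX : 1 / 2 ≤ c * X) :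
    ∫⁻ x in Icc X (2 * X), ENNReal.ofReal (realBessel ν (c * x) ^ 2) ≤
      ENNReal.ofReal (C / c) := by
  have hcont : ContinuousOn (fun x => realBessel ν (c * x) ^ 2) (Icc X (2 * X)) := by
    refine ContinuousOn.pow (fun x hx => ?_) 2
    have hx0 : 0 < c * x := mul_pos hc (hX.trans_le hx.1)
    have := (hasDerivAt_realBessel (ν := ν) (by linarith) hx0).continuousAt
    exact (ContinuousAt.comp (g := realBessel ν) (f := fun x => c * x) this
      (by fun_prop)).continuousWithinAt
  rw [← ofReal_integral_eq_lintegral_ofReal (hcont.integrableOn_Icc)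
    (Filter.Eventually.of_forall fun _ => sq_nonneg _), integral_Icc_eq_integral_Ioc,
    ← intervalIntegral.integral_of_le (by linarith),
    intervalIntegral.integral_comp_mul_left (fun y => realBessel ν y ^ 2) hc.ne']
  refine ENNReal.ofReal_le_ofReal ?_
  rw [smul_eq_mul, div_eq_inv_mul, show c * (2 * X) = 2 * (c * X) by ring]
  gcongr
  exact hC ν (c * X) hν hcX

theorem exists_kernelBounds_large {n : ℕ} (hn : 2 ≤ n) {ν₀ : ℝ} (h₀ : 0 < ν₀) :
    ∃ c c₂ c₃ : ℝ, 0 < c ∧ 0 < c₂ ∧ 0 < c₃ ∧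
      ∀ {ι : Type} (ν : ι → ℝ), (∀ i, ν₀ ≤ ν i) → ∀ R : ℝ, 1 ≤ R →
      KernelBounds (fun i => hankelKernel n (ν i)) (radialMeasure n R)
        (c * R ^ (-(((n : ℝ) - 2) / 2) - 1 / 3)) (c₂ * R ^ (-(((n : ℝ) - 2) / 2) - 1 / 2))
        (c₃ * R ^ (1 / 2 : ℝ)) := by
  obtain ⟨C, hC, hb⟩ := exists_abs_realBessel_le_rpow_neg h₀
  obtain ⟨D, hD, hint⟩ := exists_integral_realBessel_sq_le h₀
  set a := ((n : ℝ) - 2) / 2 with ha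
  refine ⟨4 ^ a * (C * 2 ^ (1 / 3 : ℝ)), 4 ^ a * √(2 * D), √(2 * Real.pi * D) * 4 ^ a,
    by positivity, by positivity, by positivity, fun {ι} ν hν R hR => ?_⟩
  have hR0 : 0 < R := by linarith
  have hsq : ∀ i, ∀ r ∈ Icc (R / 2) R, ∀ ρ ∈ Icc (1 : ℝ) 2,
      ENNReal.ofReal (hankelKernel n (ν i) r ρ ^ 2) ≤
        ENNReal.ofReal ((4 ^ a * R ^ (-a)) ^ 2) *
          ENNReal.ofReal (realBessel (ν i) (r * ρ) ^ 2) := by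
    intro i r hr ρ hρ
    rw [← ENNReal.ofReal_mul (by positivity)]
    refine ENNReal.ofReal_le_ofReal ?_
    rw [← sq_abs, ← sq_abs (realBessel _ _), ← mul_pow]
    gcongr
    exact abs_hankelKernel_le hn hR0 (ν i) hr hρ
  refine ⟨fun i => measurable_hankelKernel n (h₀.trans_le (hν i)),
    ae_radialMeasure fun r hr i ρ hρ => ?_, ae_radialMeasure fun r hr i => ?_,
    fun i ρ hρ => ?_⟩
  · have hx : R / 2 ≤ r * ρ := by nlinarith [hr.1, hρ.1]
    have hJ : |realBessel (ν i) (r * ρ)| ≤ C * (2 ^ (1 / 3 : ℝ) * R ^ (-(1 / 3) : ℝ)) := by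
      refine (hb (ν i) (r * ρ) (hν i) (by linarith)).trans ?_
      gcongr
      calc (r * ρ) ^ (-(1 / 3) : ℝ) ≤ (R / 2) ^ (-(1 / 3) : ℝ) :=
            Real.rpow_le_rpow_of_nonpos (by positivity) hx (by norm_num)
        _ = _ := by
          rw [Real.div_rpow hR0.le two_pos.le, Real.rpow_neg two_pos.le, div_inv_eq_mul, mul_comm]
    refine (abs_hankelKernel_le hn hR0 (ν i) hr hρ).trans ?_
    rw [← ha, sub_eq_add_neg, Real.rpow_add hR0]
    calc 4 ^ a * R ^ (-a) * |realBessel (ν i) (r * ρ)| ≤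
        4 ^ a * R ^ (-a) * (C * (2 ^ (1 / 3 : ℝ) * R ^ (-(1 / 3) : ℝ))) := by gcongr
      _ = _ := by ring
  · have hr0 : 0 < r := by linarith [hr.1]
    have h1 := lintegral_realBessel_comp_mul_sq_le h₀ hint (hν i) hr0 one_pos
      (by linarith [hr.1])
    rw [mul_one] at h1
    refine (setLIntegral_mono' measurableSet_Icc fun ρ hρ => hsq i r hr ρ hρ).trans ?_
    rw [lintegral_const_mul' _ _ ENNReal.ofReal_ne_top]
    refine (mul_le_mul_right h1 _).trans ?_
    rw [← ENNReal.ofReal_mul (by positivity)]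
    refine ENNReal.ofReal_le_ofReal ?_
    calc (4 ^ a * R ^ (-a)) ^ 2 * (D / r) ≤ (4 ^ a * R ^ (-a)) ^ 2 * (D / (R / 2)) := by
          gcongr
          exact hr.1
      _ = _ := by
        rw [sub_eq_add_neg, Real.rpow_add hR0, mul_pow, mul_pow, mul_pow, mul_pow,
          Real.sq_sqrt (by positivity), ← Real.rpow_natCast (R ^ (-(1 / 2) : ℝ)),
          ← Real.rpow_mul hR0.le]
        norm_num
        rw [Real.rpow_neg_one]
        field_simp
  · have hρ0 : 0 < ρ := by linarith [hρ.1]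
    have h1 := lintegral_realBessel_comp_mul_sq_le h₀ hint (hν i) hρ0 (X := R / 2) (by positivity)
      (by nlinarith [hρ.1])
    rw [mul_div_cancel₀ R two_ne_zero] at h1
    have hkm : Measurable fun r => hankelKernel n (ν i) r ρ :=
      (measurable_hankelKernel n (h₀.trans_le (hν i))).comp (f := fun r : ℝ => (r, ρ)) (by fun_prop)
    have h2 := lintegral_radialMeasure_le (n := n) hR0
      (f := fun r => ENNReal.ofReal (hankelKernel n (ν i) r ρ ^ 2)) (by fun_prop)
    have h3 : ∫⁻ r in Icc (R / 2) R, ENNReal.ofReal (hankelKernel n (ν i) r ρ ^ 2) ≤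
        ENNReal.ofReal ((4 ^ a * R ^ (-a)) ^ 2 * D) := by
      refine (setLIntegral_mono' measurableSet_Icc fun r hr => hsq i r hr ρ hρ).trans ?_
      rw [lintegral_const_mul' _ _ ENNReal.ofReal_ne_top, ENNReal.ofReal_mul (by positivity)]
      simp_rw [mul_comm _ ρ]
      refine mul_le_mul_right (h1.trans (ENNReal.ofReal_le_ofReal ?_)) _
      exact div_le_self hD.le hρ.1
    calc _ ≤ ENNReal.ofReal (2 * Real.pi) * (ENNReal.ofReal (R ^ (n - 1)) *
          ENNReal.ofReal ((4 ^ a * R ^ (-a)) ^ 2 * D)) :=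
          mul_le_mul_right (h2.trans (mul_le_mul_right h3 _)) _
      _ = _ := by
        rw [← ENNReal.ofReal_mul (by positivity), ← ENNReal.ofReal_mul (by positivity)]
        congr 1
        have e1 : R ^ (n - 1) * (R ^ (-a)) ^ 2 = R := by
          rw [← Real.rpow_natCast, ← Real.rpow_natCast, ← Real.rpow_mul hR0.le,
            ← Real.rpow_add hR0, Nat.cast_sub (by omega), ha]
          convert Real.rpow_one R using 2
          push_cast
          ring
        rw [mul_pow, mul_pow, mul_pow, Real.sq_sqrt (by positivity), ← Real.sqrt_eq_rpow,
          Real.sq_sqrt hR0.le]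
        linear_combination (2 * Real.pi * (4 ^ a) ^ 2 * D) * e1

theorem rpow_interp_eq {c d R α β e θ : ℝ} (hc : 0 < c) (hd : 0 < d) (hR : 0 < R)
    (he : α * (1 - 2 * θ) + β * (2 * θ) = e) :
    (c * R ^ α) ^ (1 - 2 * θ) * (d * R ^ β) ^ (2 * θ) =
      c ^ (1 - 2 * θ) * d ^ (2 * θ) * R ^ e := by
  rw [Real.mul_rpow hc.le (by positivity), Real.mul_rpow hd.le (by positivity),
    ← Real.rpow_mul hR.le, ← Real.rpow_mul hR.le, ← he, Real.rpow_add hR]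
  ring

theorem proposition3p2
    (n : ℕ) (hn : 2 ≤ n)
    {Y : Type*} [TopologicalSpace Y] [T2Space Y] [CompactSpace Y]
    [ChartedSpace (EuclideanSpace ℝ (Fin (n - 1))) Y] [IsManifold (𝓡 (n - 1)) ∞ Y]
    (h : SmoothRiemannianMetric (n - 1) Y)
    (V₀ : C^∞⟮𝓡 (n - 1), Y; 𝓘(ℝ, ℝ), ℝ⟯)
    (ν₀ : ℝ) (hν₀ : 0 < ν₀) (hleast : IsLeast (coneEigenvalues h V₀) (ν₀ ^ 2))
    (q q' : ℝ≥0∞) (hq : 2 ≤ q) (hqq' : q⁻¹ + q'⁻¹ = 1) :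
    ∃ C : ℝ≥0, ∀ φ : ℝ → ℂ, ContDiff ℝ ∞ φ → tsupport φ ⊆ Icc 1 2 →
      ∀ (k : ℤ) (R : ℝ), R = (2 : ℝ) ^ k →
      ∀ b : ConeIndex h V₀ → ℝ → ℂ,
        (∀ i, AEStronglyMeasurable (b i) (volume.restrict (Icc 1 2))) →
        eLpNorm (fun x : ℝ × ℝ => ell2Norm fun i => hankelWave n i.1 φ (b i) x.1 x.2)
            q (coneSlabMeasure n R)
          ≤ C * ENNReal.ofReal
              (min (R ^ ((n : ℝ) * (q⁻¹).toReal + ν₀ - ((n : ℝ) - 2) / 2))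
                (R ^ (-((3 * (n : ℝ) - 4) / 6) *
                  (1 - 2 * (3 * (n : ℝ) - 1) / (3 * (n : ℝ) - 4) * (q⁻¹).toReal))))
            * eLpNorm (fun ρ : ℝ => (ell2Norm fun i => b i ρ) * ‖φ ρ‖ₑ)
                q' (volume.restrict (Icc 1 2)) ∧
        eLpNorm (fun x : ℝ × ℝ => ell2Norm fun i => hankelWave n i.1 φ (b i) x.1 x.2)
            q (coneSlabMeasure n R)
          ≤ C * ENNReal.ofReal
              (min (R ^ ((n : ℝ) * (q⁻¹).toReal + ν₀ - ((n : ℝ) - 2) / 2))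
                (R ^ (-(((n : ℝ) - 1) / 2) *
                  (1 - 2 * (n : ℝ) / ((n : ℝ) - 1) * (q⁻¹).toReal))))
            * eLpNorm (fun ρ : ℝ => (ell2Norm fun i => b i ρ) * ‖φ ρ‖ₑ)
                2 (volume.restrict (Icc 1 2)) := by
  set θ := (q⁻¹).toReal with hθ
  have hθ0 : 0 ≤ θ := ENNReal.toReal_nonneg
  have hn' : (2 : ℝ) ≤ n := by exact_mod_cast hn
  obtain ⟨c, hc, hsmall⟩ := exists_kernelBounds_small hn hν₀
  obtain ⟨c₁, c₂, c₃, hc₁, hc₂, hc₃, hlarge⟩ := exists_kernelBounds_large hn hν₀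
  have hπ : 0 < √(2 * Real.pi) * c := by
    have := Real.pi_pos
    positivity
  set K := 1 + |interpConst q.toReal| with hK
  have hK0 : 0 < K := by positivity
  set k₁ := c ^ (1 - 2 * θ) * (√(2 * Real.pi) * c) ^ (2 * θ) with hk₁
  set k₂ := c₁ ^ (1 - 2 * θ) * c₃ ^ (2 * θ) with hk₂
  set k₃ := c₂ ^ (1 - 2 * θ) * c₃ ^ (2 * θ) with hk₃
  have hk₁0 : 0 < k₁ := by positivity
  have hk₂0 : 0 < k₂ := by positivity
  have hk₃0 : 0 < k₃ := by positivity
  have habsorb : ∀ {j m : ℝ}, j ≤ k₁ + k₂ + k₃ → 0 ≤ m → ∀ {S N : ℝ≥0∞},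
      S ≤ ENNReal.ofReal K * ENNReal.ofReal (j * m) * N →
      S ≤ (Real.toNNReal (K * (k₁ + k₂ + k₃)) : ℝ≥0∞) * ENNReal.ofReal m * N := by
    intro j m hj hm S N hS
    refine hS.trans (mul_le_mul_left ?_ N)
    change _ ≤ ENNReal.ofReal (K * (k₁ + k₂ + k₃)) * ENNReal.ofReal m
    rw [← ENNReal.ofReal_mul hK0.le, ← ENNReal.ofReal_mul (by positivity), mul_assoc]
    exact ENNReal.ofReal_le_ofReal (by gcongr)
  have e₂ : -((3 * (n : ℝ) - 4) / 6) * (1 - 2 * (3 * (n : ℝ) - 1) / (3 * (n : ℝ) - 4) * θ) =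
      -(((n : ℝ) - 2) / 2) - 1 / 3 + (3 * n - 1) / 3 * θ := by
    have : 3 * (n : ℝ) - 4 ≠ 0 := by linarith
    field_simp
    ring
  have e₃ : -(((n : ℝ) - 1) / 2) * (1 - 2 * (n : ℝ) / ((n : ℝ) - 1) * θ) =
      -(((n : ℝ) - 2) / 2) - 1 / 2 + n * θ := by
    have : (n : ℝ) - 1 ≠ 0 := by linarith
    field_simp
    ring
  refine ⟨Real.toNNReal (K * (k₁ + k₂ + k₃)), fun φ _ hφs k R hRk b hb => ?_⟩
  have hR : 0 < R := hRk ▸ zpow_pos two_pos k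
  rw [e₂, e₃]
  have hν : ∀ i : ConeIndex h V₀, ν₀ ≤ i.1 := fun i =>
    (pow_le_pow_iff_left₀ hν₀.le i.1.2.1.le two_ne_zero).1 (hleast.2 i.1.2.2)
  have hG : ∀ i, AEStronglyMeasurable (fun ρ => b i ρ * φ ρ) (volume.restrict (Icc (1 : ℝ) 2)) := by
    intro i
    have hφc : Continuous φ := ContDiff.continuous (by assumption)
    exact (hb i).mul hφc.aestronglyMeasurable
  have hwave : ∀ x : ℝ × ℝ, (ell2Norm fun i => hankelWave n i.1 φ (b i) x.1 x.2) =
      ell2Norm fun i : ConeIndex h V₀ =>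
        oscInt (hankelKernel n i.1) (fun ρ => b i ρ * φ ρ) x := by
    intro x
    congr 1
    ext i
    exact hankelWave_eq_oscInt (hν₀.trans_le (hν i)) hφs (b i) x
  have hnorm : ∀ ρ : ℝ, (ell2Norm fun i => b i ρ) * ‖φ ρ‖ₑ =
      ell2Norm fun i => b i ρ * φ ρ := fun ρ => (ell2Norm_mul_right _ _).symm
  simp_rw [hwave, hnorm]
  change eLpNorm _ q ((volume : Measure ℝ).prod (radialMeasure n R)) ≤ _ ∧
    eLpNorm _ q ((volume : Measure ℝ).prod (radialMeasure n R)) ≤ _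
  rcases le_total R 1 with hR1 | hR1
  · have hmain := eLpNorm_oscInt_le (hsmall (fun i : ConeIndex h V₀ => (i.1 : ℝ)) hν R hR hR1)
      (by positivity) (by positivity) (by positivity) hq hqq' hG
    rw [rpow_interp_eq hc hπ hR (e := n * θ + ν₀ - ((n : ℝ) - 2) / 2) (by ring)] at hmain
    rw [min_eq_left (Real.rpow_le_rpow_of_exponent_ge hR hR1 (by linarith)),
      min_eq_left (Real.rpow_le_rpow_of_exponent_ge hR hR1 (by linarith))]
    exact ⟨habsorb (by linarith) (by positivity) hmain.1,
      habsorb (by linarith) (by positivity) hmain.2⟩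
  · have hmain := eLpNorm_oscInt_le (hlarge (fun i : ConeIndex h V₀ => (i.1 : ℝ)) hν R hR1)
      (by positivity) (by positivity) (by positivity) hq hqq' hG
    rw [rpow_interp_eq hc₁ hc₃ hR (e := -(((n : ℝ) - 2) / 2) - 1 / 3 + (3 * n - 1) / 3 * θ)
      (by ring), rpow_interp_eq hc₂ hc₃ hR (e := -(((n : ℝ) - 2) / 2) - 1 / 2 + n * θ)
      (by ring)] at hmain
    rw [min_eq_right (Real.rpow_le_rpow_of_exponent_le hR1 (by linarith)),
      min_eq_right (Real.rpow_le_rpow_of_exponent_le hR1 (by linarith))]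
    exact ⟨habsorb (by linarith) (by positivity) hmain.1,
      habsorb (by linarith) (by positivity) hmain.2⟩
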